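/- Let $d\in\{2,3\}$, let $\Omega\subset\mathbb R^d$ be open and bounded, $T>0$, and let * $A:\mathbb R\to\mathbb R$ be continuous and nondecreasing with $A(0)=0$, and $\mathfrak f:\mathbb R\to\mathbb R^d$ continuous with $\mathfrak f(0)=0$; * $\mathfrak a(\xi)=k(\xi)\xi$ with $k:\mathbb R^d\to\mathbb R$, where $\mathfrak a$ is continuous and strictly monotone and, for some $p\in(1,\infty)$ and $C>0$, $\frac1C|\xi|^{p-2}\le k(\xi)\le C|\xi|^{p-2}$ for all $\xi\ne0$; * $u_0\in L^\infty(\Omega)$ and $\mathcal S\in L^1(0,T;L^\infty(\Omega))$, i.e. $\mathcal S$ is measurable on $(0,T)\times\Omega$, $\mathcal S(t,\cdot)\in L^\infty(\Omega)$ for a.e. $t$, and $\int_0^T\|\mathcal S(t,\cdot)\|_{L^\infty(\Omega)}dt<\infty$. **Double mesh.** Let $\mathfrak M$ be a finite conforming partition of $\Omega$ into open triangles ($d=2$) or tetrahedra ($d=3$). "Face" means edge if $d=2$. Let $\partial\mathfrak M$ be the set of faces of elements of $\mathfrak M$ that are contained in $\partial\Omega$, and $\overline{\mathfrak M}=\mathfrak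 M\cup\partial\mathfrak M$. The centre $x_K$ of $K\in\overline{\mathfrak M}$ is the centre of its circumscribed circle or ball (the middle of $K$, if $K$ is an edge). Two elements of $\mathfrak M$ are neighbours if they have a common face $K|L$ that is not in $\partial\mathfrak M$; $L\in\partial\mathfrak M$ is a neighbour of the elements of $\mathfrak M$ of which it is a face, with $K|L=L$. $\mathcal N(K)$ is the set of neighbours of $K$. For neighbours put $d_{KL}=|x_K-x_L|$ and let $\nu_{K,L}$ be the unit vector from $x_K$ to $x_L$, which is the unit normal to $K|L$ pointing from $K$ to $L$. The mesh is assumed to satisfy: 1. (strict Delaunay condition) if $K,L\in\mathfrak M$ are neighbours, then the vertex of $L$ that is not in $K$ lies outside the closed ball circumscribed about $K$; and if $K\in\mathfrak M$ has a face $F\in\partial\mathfrak M$, then $x_K$ lies strictly on the same side of $F$ as $K$ (in particular $d_{KL}>0$ for all neighbours); 2. if $d=3$, every face of every tetrahedron contains the centre of its circumscribed circle. For every vertex $v$ of $\mathfrak M$, the dual control volume $v^*$ with centre $v$ is the set of points of $\Omega$ that are closer to $v$ than to any other vertex, the distance being the length of the shortest path in $\overline\Omega$. Vertices in $\Omega$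 give the set $\mathfrak M^*$ of dual control volumes, those on $\partial\Omega$ the set $\partial\mathfrak M^*$ of boundary ones; $\overline{\mathfrak M^*}=\mathfrak M^*\cup\partial\mathfrak M^*$. Two of them, with centres $a,b$, are (dual) neighbours, $b^*\in\mathcal N^*(a^*)$, if $[a,b]$ is an edge of the mesh; $d_{ab}=|a-b|$, and $\nu_{a,b}$ is the unit vector from $a$ to $b$. Each unordered pair of neighbours $K,L\in\overline{\mathfrak M}$ defines a diamond $D=D^{K,L}$, which is the union of the subdiamonds $S=S^{K,L}_{a,b}$, one for each edge $[a,b]$ of $K|L$. For $d=3$, $S$ is the convex hull of $x_K,x_L,a,b$; for $d=2$, $S=D$ is the union of the triangles $x_Kx_La$ and $x_Kx_Lb$. Let $\sigma_S$ be the segment $[a,b]$ if $d=2$, and the triangle formed by $a$, $b$ and the centre of the circle circumscribed about $K|L$ if $d=3$; let $\sigma_S^*$ be the segment $[x_K,x_L]$ if $d=2$, and the triangle formed by $x_K$, $x_L$ and the middle of $[a,b]$ if $d=3$. The interface of the dual neighbours $a^*,b^*$ is made of the $\sigma^*_S$ for all subdiamonds $S=S^{K,L}_{a,b}$, and its measure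 $m_{a^*|b^*}$ is the sum of their measures. $m_E$ denotes the measure of $E$ in its natural dimension ($m_D$ is the sum of the $m_S$, $S\subset D$), and $\mathrm{size}$ the largest diameter of the elements of $\overline{\mathfrak M}$, of $\overline{\mathfrak M^*}$ and of the diamonds. **Scheme.** For every $K\in\overline{\mathfrak M}$ and $L\in\mathcal N(K)$ let $g_{K,L}:\mathbb R^2\to\mathbb R$ be continuous, nondecreasing in the first and nonincreasing in the second variable, with $g_{K,L}(s,s)=\mathfrak f(s)\cdot\nu_{K,L}$ and $g_{K,L}(s,t)=-g_{L,K}(t,s)$; for dual neighbours with centres $a,b$ let $g_{a,b}$ have the same properties with respect to $\nu_{a,b}$. For a family $w$ of real values $w_K$ ($K\in\overline{\mathfrak M}$), $w_{v}$ ($v^*\in\overline{\mathfrak M^*}$) the discrete gradient on $D=D^{K,L}$ is $$\nabla_Dw=\frac{w_L-w_K}{d_{KL}}\nu_{K,L}+\frac{w_b-w_a}{d_{ab}}\nu_{a,b}\quad(d=2,\ K|L=[a,b]),$$ $$\nabla_Dw=\frac{w_L-w_K}{d_{KL}}\nu_{K,L}+\frac2{m_D}\sum_{S=S^{K,L}_{a,b}\subset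 D}m_S\frac{w_b-w_a}{d_{ab}}\nu_{a,b}\quad(d=3).$$ Let $\Delta t>0$, let $N$ be the integer part of $T/\Delta t$, and put $\mathcal S^n(x)=\frac1{\Delta t}\int_{(n-1)\Delta t}^{n\Delta t}\mathcal S(t,x)\,dt$. **Claim.** For every such double mesh and every $\Delta t>0$ there exist real numbers $u_K^n$ ($K\in\overline{\mathfrak M}$) and $u_v^n$ ($v^*\in\overline{\mathfrak M^*}$), $n=0,\dots,N$, such that, with $w^n=A(u^n)$, the following hold. For $n=1,\dots,N$ and all $K\in\mathfrak M$, $$\frac{u_K^n-u_K^{n-1}}{\Delta t}+\frac1{m_K}\sum_{L\in\mathcal N(K)}m_{K|L}\,g_{K,L}(u_K^n,u_L^n)-\frac1{m_K}\sum_{L\in\mathcal N(K)}\sum_{S\subset D^{K,L}}m_{\sigma_S}\,\mathfrak a(\nabla_{D^{K,L}}w^n)\cdot\nu_{K,L}+\frac{d-1}{\mathrm{size}\;m_K}\sum_{v^*\in\overline{\mathfrak M^*}}m_{K\cap v^*}(w_K^n-w_v^n)=\frac1{m_K}\int_K\mathcal S^n;$$ for $n=1,\dots,N$ and all $v^*\in\mathfrak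 M^*$, $$\frac{u_v^n-u_v^{n-1}}{\Delta t}+\frac1{m_{v^*}}\sum_{b^*\in\mathcal N^*(v^*)}m_{v^*|b^*}\,g_{v,b}(u_v^n,u_b^n)-\frac1{m_{v^*}}\sum_{b^*\in\mathcal N^*(v^*)}\ \sum_{S=S^{K,L}_{v,b}}m_{\sigma^*_S}\,\mathfrak a(\nabla_{D^{K,L}}w^n)\cdot\nu_{v,b}+\frac1{\mathrm{size}\;m_{v^*}}\sum_{K\in\overline{\mathfrak M}}m_{K\cap v^*}(w_v^n-w_K^n)=\frac1{m_{v^*}}\int_{v^*}\mathcal S^n;$$ the boundary conditions $u_K^n=0$ for $K\in\partial\mathfrak M$ and $u_v^n=0$ for $v^*\in\partial\mathfrak M^*$ hold for $n=1,\dots,N$; and the initial conditions $u_K^0=\frac1{m_K}\int_Ku_0$ for $K\in\mathfrak M$ and $u_v^0=\frac1{m_{v^*}}\int_{v^*}u_0$ for $v^*\in\mathfrak M^*$ hold. -/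

import Mathlib

noncomputable section

open scoped Classical

namespace DDFV

/-- The ambient Euclidean space of dimension `d`. -/
abbrev Pt (d : ℕ) : Type := EuclideanSpace ℝ (Fin d)

/-- Length of the shortest path from `x` to `y` inside `X` (infimum of the lengths of the
continuous curves in `X` joining `x` to `y`; it is `∞` if there is no rectifiable one). -/
def pathDist {d : ℕ} (X : Set (Pt d)) (x y : Pt d) : ENNReal :=
  ⨅ (γ : ℝ → Pt d) (_ : ContinuousOn γ (Set.Icc 0 1) ∧ γ 0 = x ∧ γ 1 = y ∧
    Set.MapsTo γ (Set.Icc 0 1) X), eVariationOn γ (Set.Icc 0 1)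

/-- Centre of the sphere circumscribed about the simplex with vertex set `F`: the unique point of
the affine hull of `F` that is equidistant from all elements of `F`. For a triangle in the plane or
a tetrahedron in space this is the centre of the circumscribed circle or ball, for a triangle in
space the centre of its circumscribed circle, and for a segment its middle. -/
def center {d : ℕ} (F : Finset (Pt d)) : Pt d :=
  Classical.epsilon fun c =>
    c ∈ affineSpan ℝ (F : Set (Pt d)) ∧ ∀ p ∈ F, ∀ q ∈ F, dist p c = dist q c

/-- The `(d - 1)`-dimensional Euclidean measure (length if `d = 2`, area if `d = 3`). -/
def faceMeasure {d : ℕ} (s : Set (Pt d)) : ℝ :=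
  (MeasureTheory.Measure.euclideanHausdorffMeasure (d - 1) s).toReal

/-- The unit vector pointing from `x` to `y`. -/
def unitVec {d : ℕ} (x y : Pt d) : Pt d := (dist x y)⁻¹ • (y - x)

/-- A conforming partition of the open set `Ω` into open simplices (triangles if `d = 2`,
tetrahedra if `d = 3`): a finite, pure `d`-dimensional simplicial complex such that the open
`d`-simplices lie in `Ω` and the closed ones cover `Ω` (`Ω` being open, this is the same as
covering it up to a null set by the open simplices). A simplex is given by its set of vertices. -/
structure SimplicialMesh {d : ℕ} (Ω : Set (Pt d)) where
  complex : Geometry.SimplicialComplex ℝ (Pt d)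
  finite_faces : complex.faces.Finite
  pure : ∀ s ∈ complex.faces, ∃ t ∈ complex.faces, s ⊆ t ∧ t.card = d + 1
  interior_subset : ∀ s ∈ complex.faces, s.card = d + 1 →
    interior (convexHull ℝ (s : Set (Pt d))) ⊆ Ω
  subset_space : Ω ⊆ complex.space

namespace SimplicialMesh

variable {d : ℕ} {Ω : Set (Pt d)} (T : SimplicialMesh Ω)

/-! ### Primal control volumes -/

/-- The control volumes `𝔐`: the `d`-simplices. -/
def primal : Finset (Finset (Pt d)) :=
  T.finite_faces.toFinset.filter fun K => K.card = d + 1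

/-- The boundary control volumes `∂𝔐`: the edges (faces, if `d = 3`) of control volumes that are
included in `∂Ω`. -/
def primalBdry : Finset (Finset (Pt d)) :=
  T.finite_faces.toFinset.filter fun K =>
    K.card = d ∧ convexHull ℝ (K : Set (Pt d)) ⊆ frontier Ω

/-- `𝔐 ∪ ∂𝔐`. -/
def primalBar : Finset (Finset (Pt d)) := T.primal ∪ T.primalBdry

/-- The control volume as a set of points: the open simplex with vertex set `K` (the relatively open
edge or face, if `K` is a boundary control volume). -/
def cell {d : ℕ} (K : Finset (Pt d)) : Set (Pt d) :=
  intrinsicInterior ℝ (convexHull ℝ (K : Set (Pt d)))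

/-- The neighbours of `K` in `𝔐 ∪ ∂𝔐`: those `L ≠ K` that share a whole edge (face, if `d = 3`)
with `K`. A boundary control volume is a neighbour of the simplex of which it is a face. If that
common edge or face is a boundary control volume, then it separates the simplices on its two sides
(if there are two, as along a crack), and these are not neighbours of each other.
The interface `K|L` is the simplex with vertex set `K ∩ L`. -/
def neighbours (K : Finset (Pt d)) : Finset (Finset (Pt d)) :=
  T.primalBar.filter fun L => L ≠ K ∧ (K ∩ L).card = d ∧
    (K ∩ L ∈ T.primalBdry → K ∈ T.primalBdry ∨ L ∈ T.primalBdry)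

/-- `m_{K|L}`. -/
def interfaceMeasure {d : ℕ} (K L : Finset (Pt d)) : ℝ :=
  faceMeasure (convexHull ℝ ((K ∩ L : Finset (Pt d)) : Set (Pt d)))

/-- `ν_{K,L}`, the unit normal to `K|L` pointing from `K` to `L`. The line through the centres of
two neighbours is orthogonal to their interface, and on the Delaunay meshes considered below
it runs from `K` to `L`. -/
def normal {d : ℕ} (K L : Finset (Pt d)) : Pt d := unitVec (center K) (center L)

/-! ### Dual control volumes -/

/-- The vertices of the mesh; they are the centres of the dual control volumes, and dual control
volumes are indexed by them. -/
def vertices : Finset (Pt d) := T.primal.biUnion id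

/-- The dual control volumes `𝔐*`: those whose centre lies in `Ω`. -/
def dual : Finset (Pt d) := T.vertices.filter fun v => v ∈ Ω

/-- The boundary dual control volumes `∂𝔐*`: those whose centre lies on `∂Ω`. -/
def dualBdry : Finset (Pt d) := T.vertices.filter fun v => v ∈ frontier Ω

/-- The dual control volume with centre `v` as a set of points, i.e. the Voronoi cell: the points
of `Ω` that are closer to `v` than to any other vertex, for the path distance in the closure
of `Ω`. -/
def dualCell (v : Pt d) : Set (Pt d) :=
  {x | x ∈ Ω ∧ ∀ w ∈ T.vertices, w ≠ v →
    pathDist (closure Ω) x v < pathDist (closure Ω) x w}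

/-- The dual neighbours of `v`: the vertices joined to `v` by an edge of the mesh. -/
def dualNeighbours (v : Pt d) : Finset (Pt d) :=
  T.vertices.filter fun w => w ≠ v ∧ ({v, w} : Finset (Pt d)) ∈ T.complex.faces

/-! ### Diamonds and subdiamonds -/

/-- The diamonds, indexed by the unordered pairs of neighbours `K, L ∈ 𝔐 ∪ ∂𝔐`. -/
def diamonds : Finset (Sym2 (Finset (Pt d))) :=
  T.primalBar.sym2.filter fun D => ∃ K L, D = s(K, L) ∧ L ∈ T.neighbours K

/-- A (fixed but arbitrary) choice of which of the two control volumes of a diamond is called `K`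
and which `L`; all formulas below are symmetric in the two. -/
def diaK {d : ℕ} (D : Sym2 (Finset (Pt d))) : Finset (Pt d) := (Quot.out D).1

/-- The other control volume of the diamond. -/
def diaL {d : ℕ} (D : Sym2 (Finset (Pt d))) : Finset (Pt d) := (Quot.out D).2

/-- Vertices of the interface `K|L` of the diamond `D^{K,L}`. -/
def diaFace {d : ℕ} (D : Sym2 (Finset (Pt d))) : Finset (Pt d) := diaK D ∩ diaL D

/-- The edges `{a, b}` of the simplex with vertex set `F`. The subdiamonds of a diamond `D` are
indexed by the edges `e` of its interface (for `d = 2` there is just one). -/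
def edges {d : ℕ} (F : Finset (Pt d)) : Finset (Sym2 (Pt d)) :=
  F.sym2.filter fun e => ¬ e.IsDiag

/-- The subdiamond `S^{K,L}_{a,b}` of the diamond `D = D^{K,L}`. For `d = 3` it is the convex hull
of `x_K, x_L, a, b`. For `d = 2` it is the diamond, which is cut by the line `x_K x_L` into the
triangles `x_K x_L a` and `x_K x_L b` (this is so both when it is the union and when it is the
difference of the triangles `x_K a b` and `x_L a b`). -/
def subdiamond {d : ℕ} (D : Sym2 (Finset (Pt d))) (a b : Pt d) : Set (Pt d) :=
  if d = 2 then
    convexHull ℝ {center (diaK D), center (diaL D), a} ∪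
      convexHull ℝ {center (diaK D), center (diaL D), b}
  else convexHull ℝ {center (diaK D), center (diaL D), a, b}

/-- The diamond as a set: the union of its subdiamonds. -/
def diamondSet {d : ℕ} (D : Sym2 (Finset (Pt d))) : Set (Pt d) :=
  ⋃ e ∈ edges (diaFace D), subdiamond D (Quot.out e).1 (Quot.out e).2

/-- `m_S`, the volume of a subdiamond. -/
def subdiamondVolume {d : ℕ} (D : Sym2 (Finset (Pt d))) (a b : Pt d) : ℝ :=
  MeasureTheory.volume.real (subdiamond D a b)

/-- `m_D`, the volume of a diamond, which is split into its subdiamonds. -/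
def diamondVolume {d : ℕ} (D : Sym2 (Finset (Pt d))) : ℝ :=
  ∑ e ∈ edges (diaFace D), subdiamondVolume D (Quot.out e).1 (Quot.out e).2

/-- `m_{σ_S}` for the subdiamond `S = S^{K,L}_{a,b}`: the measure of its part `σ_S` of the interface
`K|L`. It is the whole edge `[a, b]` if `d = 2` (where the centre of `K|L` is the middle of `[a, b]`)
and the triangle formed by `a`, `b` and the centre of the circle circumscribed about `K|L` if
`d = 3`. -/
def sigmaMeasure {d : ℕ} (D : Sym2 (Finset (Pt d))) (a b : Pt d) : ℝ :=
  faceMeasure (convexHull ℝ {a, b, center (diaFace D)})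

/-- `m_{σ*_S}` for the subdiamond `S = S^{K,L}_{a,b}`: the measure of its part `σ*_S` of the dual
interface between the dual control volumes with centres `a` and `b`, that is, of the section of `S`
by the hyperplane of the points equidistant from `a` and `b`. It is the segment `[x_K, x_L]` if
`d = 2` and the triangle formed by `x_K`, `x_L` and the middle of `[a, b]` if `d = 3`. -/
def sigmaStarMeasure {d : ℕ} (D : Sym2 (Finset (Pt d))) (a b : Pt d) : ℝ :=
  if d = 2 then faceMeasure (convexHull ℝ {center (diaK D), center (diaL D)})
  else faceMeasure (convexHull ℝ {center (diaK D), center (diaL D), midpoint ℝ a b})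

/-- The diamonds whose interface has the edge `[v, w]`. -/
def diamondsAt (v w : Pt d) : Finset (Sym2 (Finset (Pt d))) :=
  T.diamonds.filter fun D => v ∈ diaFace D ∧ w ∈ diaFace D

/-- `m_{K*|L*}`: the dual interface between the dual control volumes with centres `v` and `w` is the
Voronoi face with vertices at the centres `x_K`; it is made of the pieces `σ*_S`. -/
def dualInterfaceMeasure (v w : Pt d) : ℝ :=
  ∑ D ∈ T.diamondsAt v w, sigmaStarMeasure D v w

/-- `size(𝔗)`: the maximal diameter of the primal and dual control volumes and of the diamonds. -/
def size : ℝ :=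
  sSup ((fun K => Metric.diam (cell K)) '' (T.primalBar : Set (Finset (Pt d))) ∪
    (fun v => Metric.diam (T.dualCell v)) '' (T.vertices : Set (Pt d)) ∪
    (fun D => Metric.diam (diamondSet D)) '' (T.diamonds : Set (Sym2 (Finset (Pt d)))))

end SimplicialMesh

/-- A double (DDFV) mesh of `Ω`; the primal mesh determines the dual mesh and the diamonds. -/
structure DoubleMesh {d : ℕ} (Ω : Set (Pt d)) extends SimplicialMesh Ω where
  /-- (Strict) Delaunay condition: if two simplices are neighbours, then the closed ball
  circumscribed about one does not contain the remaining vertex of the other. -/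
  delaunay : ∀ K ∈ toSimplicialMesh.primal, ∀ L ∈ toSimplicialMesh.primal,
    L ∈ toSimplicialMesh.neighbours K →
      ∀ q ∈ L \ K, ∀ p ∈ K, dist p (center K) < dist q (center K)
  /-- Delaunay condition at the boundary: the centre of a simplex `K` with a face `F` on `∂Ω` lies
  strictly on the same side of `F` as `K`. -/
  delaunay_bdry : ∀ K ∈ toSimplicialMesh.primal, ∀ F ∈ toSimplicialMesh.primalBdry, F ⊆ K →
    ∀ q ∈ K \ F, 0 < inner ℝ (q - center F) (center K - center F)
  /-- If `d = 3`, each face of each tetrahedron contains the centre of its circumscribed circle. -/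
  center_mem_face : d = 3 → ∀ F ∈ toSimplicialMesh.complex.faces, F.card = 3 →
    center F ∈ convexHull ℝ (F : Set (Pt d))

/-- A discrete function on the closure of `Ω`: one real value for every primal control volume and
one for every dual control volume, boundary ones included. Only the values at elements of
`primalBar` and `vertices` are ever used. -/
structure DiscreteFunction (d : ℕ) where
  onPrimal : Finset (Pt d) → ℝ
  onDual : Pt d → ℝ

/-- Composition of a function of a real variable with a discrete function. -/
def DiscreteFunction.comp {d : ℕ} (A : ℝ → ℝ) (u : DiscreteFunction d) : DiscreteFunction d where
  onPrimal K := A (u.onPrimal K)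
  onDual v := A (u.onDual v)

namespace SimplicialMesh

variable {d : ℕ} {Ω : Set (Pt d)} (T : SimplicialMesh Ω)

/-- The discrete gradient `∇_D w`. For `d = 2` it is
`(w_L - w_K) / d_{KL} ν_{K,L} + (w_b - w_a) / d_{ab} ν_{a,b}`, where `K|L = [a, b]`. For `d = 3` it is
`(w_L - w_K) / d_{KL} ν_{K,L} + (2 / m_D) ∑ m_S (w_b - w_a) / d_{ab} ν_{a,b}`, the sum being over the
three subdiamonds `S = S^{K,L}_{a,b}` of `D`. -/
def discreteGradient {d : ℕ} (w : DiscreteFunction d) (D : Sym2 (Finset (Pt d))) : Pt d :=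
  ((w.onPrimal (diaL D) - w.onPrimal (diaK D)) / dist (center (diaK D)) (center (diaL D))) •
      normal (diaK D) (diaL D) +
    ∑ e ∈ edges (diaFace D),
      (if d = 2 then 1
        else 2 / diamondVolume D * subdiamondVolume D (Quot.out e).1 (Quot.out e).2) •
      ((w.onDual (Quot.out e).2 - w.onDual (Quot.out e).1) / dist (Quot.out e).1 (Quot.out e).2) •
        unitVec (Quot.out e).1 (Quot.out e).2

/-- Discrete divergence of a discrete field `F`, at the primal control volume `K`. -/
def divPrimal (F : Sym2 (Finset (Pt d)) → Pt d) (K : Finset (Pt d)) : ℝ :=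
  (MeasureTheory.volume.real (cell K))⁻¹ *
    ∑ L ∈ T.neighbours K, ∑ e ∈ edges (K ∩ L),
      sigmaMeasure s(K, L) (Quot.out e).1 (Quot.out e).2 * inner ℝ (F s(K, L)) (normal K L)

/-- Discrete divergence of a discrete field `F`, at the dual control volume with centre `v`: the sum
is over the subdiamonds `S^{K,L}_{v,w}`, and `unitVec v w` is the unit normal to the dual interface
that is exterior to the dual control volume of `v`. -/
def divDual (F : Sym2 (Finset (Pt d)) → Pt d) (v : Pt d) : ℝ :=
  (MeasureTheory.volume.real (T.dualCell v))⁻¹ *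
    ∑ w ∈ T.dualNeighbours v, ∑ D ∈ T.diamondsAt v w,
      sigmaStarMeasure D v w * inner ℝ (F D) (unitVec v w)

/-- Penalization operator at the primal control volume `K`. -/
def penalPrimal (w : DiscreteFunction d) (K : Finset (Pt d)) : ℝ :=
  ((d : ℝ) - 1) * T.size⁻¹ * (MeasureTheory.volume.real (cell K))⁻¹ *
    ∑ v ∈ T.vertices, MeasureTheory.volume.real (cell K ∩ T.dualCell v) *
      (w.onPrimal K - w.onDual v)

/-- Penalization operator at the dual control volume with centre `v`. -/
def penalDual (w : DiscreteFunction d) (v : Pt d) : ℝ :=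
  T.size⁻¹ * (MeasureTheory.volume.real (T.dualCell v))⁻¹ *
    ∑ K ∈ T.primalBar, MeasureTheory.volume.real (cell K ∩ T.dualCell v) *
      (w.onDual v - w.onPrimal K)

/-- Discrete convection operator at the primal control volume `K`, for the numerical convection
fluxes `g K L`. -/
def convPrimal (g : Finset (Pt d) → Finset (Pt d) → ℝ → ℝ → ℝ) (u : DiscreteFunction d)
    (K : Finset (Pt d)) : ℝ :=
  (MeasureTheory.volume.real (cell K))⁻¹ *
    ∑ L ∈ T.neighbours K, interfaceMeasure K L * g K L (u.onPrimal K) (u.onPrimal L)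

/-- Discrete convection operator at the dual control volume with centre `v`, for the numerical
convection fluxes `g v w`. -/
def convDual (g : Pt d → Pt d → ℝ → ℝ → ℝ) (u : DiscreteFunction d) (v : Pt d) : ℝ :=
  (MeasureTheory.volume.real (T.dualCell v))⁻¹ *
    ∑ w ∈ T.dualNeighbours v, T.dualInterfaceMeasure v w * g v w (u.onDual v) (u.onDual w)

/-- Admissible numerical convection fluxes on the primal mesh: continuous, monotone, consistent
with `f` and conservative. -/
structure IsPrimalFlux (f : ℝ → Pt d) (g : Finset (Pt d) → Finset (Pt d) → ℝ → ℝ → ℝ) : Prop where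
  continuous : ∀ K ∈ T.primalBar, ∀ L ∈ T.neighbours K,
    Continuous fun x : ℝ × ℝ => g K L x.1 x.2
  monotone_left : ∀ K ∈ T.primalBar, ∀ L ∈ T.neighbours K, ∀ b, Monotone fun a => g K L a b
  antitone_right : ∀ K ∈ T.primalBar, ∀ L ∈ T.neighbours K, ∀ a, Antitone fun b => g K L a b
  consistent : ∀ K ∈ T.primalBar, ∀ L ∈ T.neighbours K, ∀ a,
    g K L a a = inner ℝ (f a) (normal K L)
  conservative : ∀ K ∈ T.primalBar, ∀ L ∈ T.neighbours K, ∀ a b, g K L a b = - g L K b a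

/-- Admissible numerical convection fluxes on the dual mesh. -/
structure IsDualFlux (f : ℝ → Pt d) (g : Pt d → Pt d → ℝ → ℝ → ℝ) : Prop where
  continuous : ∀ v ∈ T.vertices, ∀ w ∈ T.dualNeighbours v,
    Continuous fun x : ℝ × ℝ => g v w x.1 x.2
  monotone_left : ∀ v ∈ T.vertices, ∀ w ∈ T.dualNeighbours v, ∀ b, Monotone fun a => g v w a b
  antitone_right : ∀ v ∈ T.vertices, ∀ w ∈ T.dualNeighbours v, ∀ a, Antitone fun b => g v w a b
  consistent : ∀ v ∈ T.vertices, ∀ w ∈ T.dualNeighbours v, ∀ a,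
    g v w a a = inner ℝ (f a) (unitVec v w)
  conservative : ∀ v ∈ T.vertices, ∀ w ∈ T.dualNeighbours v, ∀ a b, g v w a b = - g w v b a

end SimplicialMesh

/-- Hypotheses on the diffusion flux `𝔞 ξ = k ξ • ξ`: it is continuous, strictly monotone and, for
some `1 < p < ∞`, `k` is comparable to `|ξ| ^ (p - 2)`. -/
structure IsDiffusionFlux {d : ℕ} (k : Pt d → ℝ) : Prop where
  continuous : Continuous fun ξ => k ξ • ξ
  strictMono : ∀ ξ η : Pt d, ξ ≠ η → 0 < inner ℝ (k ξ • ξ - k η • η) (ξ - η)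
  growth : ∃ p : ℝ, 1 < p ∧ ∃ C : ℝ, 0 < C ∧ ∀ ξ : Pt d, ξ ≠ 0 →
    1 / C * ‖ξ‖ ^ (p - 2) ≤ k ξ ∧ k ξ ≤ C * ‖ξ‖ ^ (p - 2)

/-- `S ∈ L¹(0, Tf; L^∞(Ω))` in the following sense: `S` is measurable on `(0, Tf) × Ω`,
`S (t, ·) ∈ L^∞(Ω)` for almost every `t`, and the integral over `(0, Tf)` of the `L^∞(Ω)` norm of
`S (t, ·)` is finite. -/
structure IsSource {d : ℕ} (Ω : Set (Pt d)) (Tf : ℝ) (S : ℝ → Pt d → ℝ) : Prop where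
  measurable : MeasureTheory.AEStronglyMeasurable (fun z : ℝ × Pt d => S z.1 z.2)
    ((MeasureTheory.volume.restrict (Set.Ioo 0 Tf)).prod (MeasureTheory.volume.restrict Ω))
  bounded : ∀ᵐ t ∂(MeasureTheory.volume.restrict (Set.Ioo 0 Tf)),
    MeasureTheory.MemLp (S t) ⊤ (MeasureTheory.volume.restrict Ω)
  integrable : ∫⁻ t in Set.Ioo 0 Tf,
    MeasureTheory.eLpNorm (S t) ⊤ (MeasureTheory.volume.restrict Ω) < ⊤

/-- The mean `Sⁿ` of the source over the `n`-th time step `((n - 1) Δt, n Δt)`. -/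
def timeMean {d : ℕ} (S : ℝ → Pt d → ℝ) (Δt : ℝ) (n : ℕ) (x : Pt d) : ℝ :=
  Δt⁻¹ * ∫ t in (((n : ℝ) - 1) * Δt)..((n : ℝ) * Δt), S t x

/-- `u = (u⁰, …, u^N)`, with `N` the integer part of `Tf / Δt`, is a solution of the finite volume
scheme on the mesh `T` with time step `Δt`, together with its homogeneous Dirichlet boundary
condition and its initial condition. Only the values `u n` for `n ≤ N` are used. -/
structure IsDiscreteSolution {d : ℕ} {Ω : Set (Pt d)} (T : SimplicialMesh Ω) (Tf Δt : ℝ)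
    (A : ℝ → ℝ) (k : Pt d → ℝ)
    (g : Finset (Pt d) → Finset (Pt d) → ℝ → ℝ → ℝ) (gDual : Pt d → Pt d → ℝ → ℝ → ℝ)
    (u₀ : Pt d → ℝ) (S : ℝ → Pt d → ℝ) (u : ℕ → DiscreteFunction d) : Prop where
  scheme_primal : ∀ n ∈ Finset.Icc 1 ⌊Tf / Δt⌋₊, ∀ K ∈ T.primal,
    ((u n).onPrimal K - (u (n - 1)).onPrimal K) / Δt
      + T.convPrimal g (u n) K
      - T.divPrimal (fun D =>
          k (SimplicialMesh.discreteGradient ((u n).comp A) D) •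
            SimplicialMesh.discreteGradient ((u n).comp A) D) K
      + T.penalPrimal ((u n).comp A) K
      = ⨍ x in SimplicialMesh.cell K, timeMean S Δt n x
  scheme_dual : ∀ n ∈ Finset.Icc 1 ⌊Tf / Δt⌋₊, ∀ v ∈ T.dual,
    ((u n).onDual v - (u (n - 1)).onDual v) / Δt
      + T.convDual gDual (u n) v
      - T.divDual (fun D =>
          k (SimplicialMesh.discreteGradient ((u n).comp A) D) •
            SimplicialMesh.discreteGradient ((u n).comp A) D) v
      + T.penalDual ((u n).comp A) v
      = ⨍ x in T.dualCell v, timeMean S Δt n x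
  boundary_primal : ∀ n ∈ Finset.Icc 1 ⌊Tf / Δt⌋₊, ∀ K ∈ T.primalBdry, (u n).onPrimal K = 0
  boundary_dual : ∀ n ∈ Finset.Icc 1 ⌊Tf / Δt⌋₊, ∀ v ∈ T.dualBdry, (u n).onDual v = 0
  initial_primal : ∀ K ∈ T.primal, (u 0).onPrimal K = ⨍ x in SimplicialMesh.cell K, u₀ x
  initial_dual : ∀ v ∈ T.dual, (u 0).onDual v = ⨍ x in T.dualCell v, u₀ x

end DDFV

end

/-!
The right-hand sides and the old values enter only as numbers, so it suffices to solve one implicit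
step for arbitrary data (`DoubleMesh.exists_step`) and to iterate. One step is a finite system
`m u + C(u) + E(A(u)) = m b`, with one unknown for each interior control volume, where `C` is the
convection and `E` the diffusion with the penalization. The equations of the dual mesh are
multiplied by `d - 1`, the weight with which they enter into discrete duality and which makes the
penalization symmetric.

Existence follows from the Leray–Schauder principle, which is derived from Brouwer's theorem in
Milnor's analytic manner (`exists_fixedPoint_of_bounded`). As `A` may be constant on intervals and
bounded, the a priori bound takes two tests (`exists_solution_of_test_nonneg`). Testing with `A(u)`
gives a bound of `A(u)`, hence of the continuous function `E(A(u))`; testing with the sign of `u`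
then gives an `ℓ¹` bound of `u`. It remains to see that `E` and `C` do not spoil these tests.

* Diffusion: by discrete duality (`SimplicialMesh.exists_discrete_duality`), the fluxes tested with
  `w` give a sum over the diamonds of `c_D 𝔞(∇_D w) · ∇_D w ≥ 0`. This rests on expressing the
  measures of the pieces of the interfaces by the volumes of the subdiamonds. The penalization
  gives a sum of squares.
* Convection, tested with the sign: this is a property of each flux, since the fluxes are monotone,
  conservative and vanish at zero (`sign_sub_sign_mul_nonneg`).
* Convection, tested with `A(u)`: let `Φ = ∫ f dA`. By monotonicity and consistency, the
  contribution of an interface is at least `m (Φ(u_K) - Φ(u_L)) · ν_{K,L}` (`exists_entropyFlux`),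
  and the sum of these vanishes if the normals of every interior control volume, weighted by the
  measures of the interfaces, sum up to zero. This is geometry. For a simplex it is the divergence
  theorem, provided that `ν_{K,L}` is the outward normal, which is what the Delaunay condition says
  (`DoubleMesh.sum_interfaceMeasure_smul_normal`). For a dual control volume, the piece of the
  interface in a diamond is written as a difference of an expression for `K` and the same
  expression for `L`, oriented by signs of determinants; the sum around the vertex is then
  rearranged to a sum over the simplices at the vertex, in each of which the terms cancel in pairs
  (`DoubleMesh.sum_dualInterfaceMeasure_smul_unitVec`).
-/

noncomputable section

open scoped Classical

namespace DDFV

section FixedPoints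

open MeasureTheory Metric Set Polynomial

/-! ### Fixed points in finite dimension -/

theorem lipschitzWith_indicator_closedBall {E : Type*} [NormedAddCommGroup E] [NormedSpace ℝ E]
    {K : NNReal} {M : ℝ} {g : E → E} (hg : LipschitzOnWith K g (closedBall 0 M))
    (h0 : ∀ x ∈ sphere (0 : E) M, g x = 0) :
    LipschitzWith K ((closedBall (0 : E) M).indicator g) := by
  have key : ∀ x ∈ closedBall (0 : E) M, ∀ y ∉ closedBall (0 : E) M, ‖g x‖ ≤ K * dist x y := by
    intro x hx y hy
    simp only [mem_closedBall_zero_iff, not_le] at hx hy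
    have hc : ContinuousOn (fun t : ℝ => ‖AffineMap.lineMap x y t‖) (Icc (0 : ℝ) 1) :=
      (AffineMap.lineMap_continuous.norm).continuousOn
    obtain ⟨t, ht, htM⟩ := intermediate_value_Icc zero_le_one hc
      (show M ∈ Icc _ _ by simpa using ⟨hx, hy.le⟩)
    simp only at htM
    have hz : AffineMap.lineMap x y t ∈ sphere (0 : E) M := by simpa using htM
    have := hg.dist_le_mul x (by simpa using hx) _ (sphere_subset_closedBall hz)
    rw [h0 _ hz, dist_zero_right, dist_left_lineMap] at this
    refine this.trans (mul_le_mul_of_nonneg_left ?_ K.2)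
    rw [Real.norm_eq_abs, abs_of_nonneg ht.1]
    exact mul_le_of_le_one_left dist_nonneg ht.2
  refine LipschitzWith.of_dist_le_mul fun x y => ?_
  by_cases hx : x ∈ closedBall (0 : E) M <;> by_cases hy : y ∈ closedBall (0 : E) M
  · rw [indicator_of_mem hx, indicator_of_mem hy]
    exact hg.dist_le_mul x hx y hy
  · rw [indicator_of_mem hx, indicator_of_notMem hy, dist_zero_right]
    exact key x hx y hy
  · rw [indicator_of_notMem hx, indicator_of_mem hy, dist_zero_left, dist_comm]
    exact key y hy x hx
  · rw [indicator_of_notMem hx, indicator_of_notMem hy, dist_self]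
    positivity

/-- A Lipschitz perturbation of the identity that vanishes off a ball maps this ball
bijectively onto itself, if it is small enough. -/
theorem bijOn_closedBall_id_add_smul {E : Type*} [NormedAddCommGroup E] [NormedSpace ℝ E]
    [CompleteSpace E]
    {K : NNReal} {M : ℝ} {g : E → E} (hg : LipschitzOnWith K g (closedBall 0 M))
    (h0 : ∀ x ∈ sphere (0 : E) M, g x = 0) {t : ℝ} (ht : |t| * K < 1) :
    BijOn (fun x => x + t • g x) (closedBall 0 M) (closedBall 0 M) := by
  set G := (closedBall (0 : E) M).indicator g with hG
  have hL : LipschitzWith K G := lipschitzWith_indicator_closedBall hg h0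
  have hcontr : ∀ y : E, ContractingWith (‖t‖₊ * K) (fun x => y - t • G x) := by
    intro y
    refine ⟨?_, LipschitzWith.of_dist_le_mul fun a b => ?_⟩
    · rw [← NNReal.coe_lt_coe]; simpa using ht
    · have h1 : dist (y - t • G a) (y - t • G b) = |t| * dist (G a) (G b) := by
        rw [dist_sub_left, dist_smul₀, Real.norm_eq_abs]
      rw [h1]
      have := hL.dist_le_mul a b
      simp only [NNReal.coe_mul, coe_nnnorm, Real.norm_eq_abs]
      rw [mul_assoc]
      exact mul_le_mul_of_nonneg_left this (abs_nonneg _)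
  have hinj : Function.Injective (fun x => x + t • G x) := by
    intro a b hab
    simp only at hab
    refine (hcontr (a + t • G a)).fixedPoint_unique' ?_ ?_
    · simp [Function.IsFixedPt]
    · simp [Function.IsFixedPt, hab]
  have hsurj : ∀ y, ∃ x, x + t • G x = y := fun y =>
    ⟨ContractingWith.fixedPoint _ (hcontr y), by
      have := (hcontr y).fixedPoint_isFixedPt
      rw [Function.IsFixedPt] at this
      nth_rewrite 1 [← this]
      simp⟩
  have hin : ∀ x ∈ closedBall (0 : E) M, x + t • g x = x + t • G x := fun x hx => by
    rw [hG, indicator_of_mem hx]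
  have hout : ∀ x ∉ closedBall (0 : E) M, x + t • G x = x := fun x hx => by
    rw [hG, indicator_of_notMem hx]; simp
  refine ⟨fun x hx => ?_, fun a ha b hb hab => ?_, fun y hy => ?_⟩
  · simp only
    by_contra hn
    rw [hin x hx] at hn
    have : x + t • G x = x := hinj (hout _ hn)
    rw [this] at hn
    exact hn hx
  · simp only [hin a ha, hin b hb] at hab
    exact hinj hab
  · obtain ⟨x, hx⟩ := hsurj y
    have hxB : x ∈ closedBall (0 : E) M := by
      by_contra hn
      rw [hout x hn] at hx
      exact hn (hx ▸ hy)
    exact ⟨x, hxB, by simpa only [hin x hxB] using hx⟩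

/-- A polynomial of degree at most `n` is extrapolated to `1` from its values at `n + 1` small
nodes. -/
theorem exists_extrapolation (n : ℕ) {δ : ℝ} (hδ : 0 < δ) :
    ∃ c t : ℕ → ℝ, (∀ i ∈ Finset.range (n + 1), 0 ≤ t i ∧ t i < δ) ∧
      ∀ q : ℝ[X], q.natDegree ≤ n → q.eval 1 = ∑ i ∈ Finset.range (n + 1), c i * q.eval (t i) := by
  let t : ℕ → ℝ := fun i => δ * (i / (n + 1 : ℝ))
  refine ⟨fun i => (Lagrange.basis (Finset.range (n + 1)) t i).eval 1, t, fun i hi => ⟨by positivity, ?_⟩,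
    fun q hq => ?_⟩
  · have : (i : ℝ) / (n + 1) < 1 := by
      rw [div_lt_one (by positivity)]
      exact_mod_cast Finset.mem_range.1 hi
    exact (mul_lt_iff_lt_one_right hδ).2 this
  · have hinj : Set.InjOn t (Finset.range (n + 1)) := by
      intro a _ b _ hab
      have h1 : (n + 1 : ℝ) ≠ 0 := by positivity
      have := mul_left_cancel₀ hδ.ne' hab
      field_simp at this
      exact_mod_cast this
    have := Lagrange.eq_interpolate (f := q) hinj
      (lt_of_le_of_lt (degree_le_of_natDegree_le hq) (by simp; exact_mod_cast Nat.lt_succ_self n))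
    conv_lhs => rw [this, Lagrange.interpolate_apply]
    simp [eval_finsetSum, mul_comm]

/-- In the argument for the no-retraction theorem, the Jacobian determinant of `id + t g` is a
polynomial in `t` whose degree does not depend on the point. -/
theorem exists_polynomial_det_id_add_smul {E : Type*} [NormedAddCommGroup E] [NormedSpace ℝ E]
    [FiniteDimensional ℝ E] (A : E →L[ℝ] E) :
    ∃ q : ℝ[X], q.natDegree ≤ Module.finrank ℝ E ∧
      ∀ t : ℝ, q.eval t = (ContinuousLinearMap.id ℝ E + t • A).det := by
  let b := Module.finBasis ℝ E
  let a := LinearMap.toMatrix b b (A : E →ₗ[ℝ] E)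
  refine ⟨((X : ℝ[X]) • a.map C + (1 : Matrix _ _ ℝ).map C).det, ?_, fun t => ?_⟩
  · simpa using natDegree_det_X_add_C_le a 1
  · have h : (ContinuousLinearMap.id ℝ E + t • A).det = (1 + t • a).det := by
      rw [ContinuousLinearMap.det, ← LinearMap.det_toMatrix b]
      congr 1
      simp [a]
    rw [h, ← coe_evalRingHom, RingHom.map_det]
    clear_value a
    congr 1
    ext i j
    simp only [RingHom.mapMatrix_apply, Matrix.map_apply, Matrix.add_apply, Matrix.smul_apply,
      smul_eq_mul, coe_evalRingHom, eval_add, eval_mul, eval_X, eval_C]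
    ring

theorem det_id_add_smul_pos {E : Type*} [NormedAddCommGroup E] [NormedSpace ℝ E]
    [FiniteDimensional ℝ E] (A : E →L[ℝ] E) {K t : ℝ} (hA : ‖A‖ ≤ K) (ht0 : 0 ≤ t)
    (ht : t * K < 1) : 0 < (ContinuousLinearMap.id ℝ E + t • A).det := by
  obtain ⟨q, -, hq⟩ := exists_polynomial_det_id_add_smul A
  have hne : ∀ s ∈ Icc 0 t, q.eval s ≠ 0 := by
    intro s hs h0
    rw [hq, ContinuousLinearMap.det] at h0
    obtain ⟨x, hx, hx0⟩ := (Submodule.ne_bot_iff _).1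
      (LinearMap.bot_lt_ker_of_det_eq_zero h0).ne'
    rw [LinearMap.mem_ker] at hx
    have hx' : x = -(s • A x) := by
      rw [eq_neg_iff_add_eq_zero]; simpa using hx
    have h1 : ‖x‖ ≤ s * (K * ‖x‖) := by
      calc ‖x‖ = s * ‖A x‖ := by
            conv_lhs => rw [hx']
            rw [norm_neg, norm_smul, Real.norm_eq_abs, abs_of_nonneg hs.1]
        _ ≤ _ := mul_le_mul_of_nonneg_left (A.le_of_opNorm_le hA x) hs.1
    have hxp : 0 < ‖x‖ := norm_pos_iff.2 hx0
    have hK : 0 ≤ K := (norm_nonneg _).trans hA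
    have h2 : s * K ≤ t * K := mul_le_mul_of_nonneg_right hs.2 hK
    nlinarith
  rw [← hq]
  by_contra hn
  have h0 : q.eval 0 = 1 := by
    rw [hq, zero_smul, add_zero]
    exact LinearMap.det_id
  obtain ⟨s, hs, hs0⟩ := intermediate_value_Icc' ht0 (q.continuous.continuousOn)
    (show (0 : ℝ) ∈ Icc _ _ from ⟨not_lt.1 hn, by rw [h0]; exact zero_le_one⟩)
  exact hne s hs hs0

/-- There is no `C¹` map `r` into a sphere that fixes the points of this sphere. The map
`x + t (r x - x)` is, for small `t`, a bijection of the ball onto itself, so that the integral of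
its Jacobian determinant is the volume of the ball. This integral is a polynomial in `t`, hence
constant; but at `t = 1` the determinant vanishes, since `r` has its values in a sphere. -/
theorem not_exists_smooth_retraction {E : Type*} [NormedAddCommGroup E] [InnerProductSpace ℝ E]
    [FiniteDimensional ℝ E] {M : ℝ} (hM : 0 < M) {r : E → E}
    (hr : ContDiff ℝ 1 r) (hrM : ∀ x, ‖r x‖ = M) (hfix : ∀ x ∈ sphere (0 : E) M, r x = x) :
    False := by
  borelize E
  let μ : Measure E := Measure.addHaar
  set B := closedBall (0 : E) M
  have hBc : IsCompact B := isCompact_closedBall _ _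
  let A : E → E →L[ℝ] E := fun x => fderiv ℝ r x - ContinuousLinearMap.id ℝ E
  have hAc : Continuous A := (hr.continuous_fderiv one_ne_zero).sub continuous_const
  obtain ⟨K, hK⟩ := hBc.exists_bound_of_continuousOn hAc.continuousOn
  have hK0 : 0 ≤ K := (norm_nonneg _).trans (hK 0 (by simp [B, hM.le]))
  have hd : ∀ x, HasFDerivAt (fun x => r x - x) (A x) x := fun x =>
    ((hr.differentiable one_ne_zero) x).hasFDerivAt.sub (hasFDerivAt_id x)
  have hlip : LipschitzOnWith ⟨K, hK0⟩ (fun x => r x - x) B := by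
    refine (convex_closedBall (0 : E) M).lipschitzOnWith_of_nnnorm_hasFDerivWithin_le
      (fun x _ => (hd x).hasFDerivWithinAt) fun x hx => ?_
    exact hK x hx
  -- For small `t` the volume of the ball is the integral of the Jacobian determinant.
  have hsmall : ∀ t : ℝ, 0 ≤ t → t * K < 1 →
      ∫ x in B, (ContinuousLinearMap.id ℝ E + t • A x).det ∂μ = μ.real B := by
    intro t ht0 htK
    have hbij := bijOn_closedBall_id_add_smul hlip (fun x hx => by simp [hfix x hx])
      (t := t) (by rwa [abs_of_nonneg ht0])
    have h := integral_image_eq_integral_abs_det_fderiv_smul μ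
      (s := B) (f := fun x => x + t • (r x - x))
      (f' := fun x => ContinuousLinearMap.id ℝ E + t • A x) measurableSet_closedBall
      (fun x _ => ((hasFDerivAt_id x).add ((hd x).const_smul t)).hasFDerivWithinAt) hbij.injOn
      (fun _ => (1 : ℝ))
    rw [hbij.image_eq] at h
    simp only [integral_const, smul_eq_mul, mul_one, measureReal_restrict_apply_univ] at h
    rw [h]
    refine setIntegral_congr_fun measurableSet_closedBall fun x hx => ?_
    exact (abs_of_pos (det_id_add_smul_pos (A x) (hK x hx) ht0 htK)).symm
  have hdet : ∀ t : ℝ, IntegrableOn (fun x => (ContinuousLinearMap.id ℝ E + t • A x).det) B μ :=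
    fun t => (ContinuousLinearMap.continuous_det.comp
      (continuous_const.add (hAc.const_smul t))).continuousOn.integrableOn_compact hBc
  -- Nodes below `(K + 1)⁻¹` are small enough for `hsmall`.
  obtain ⟨c, t, ht, hc⟩ := exists_extrapolation (Module.finrank ℝ E)
    (δ := (K + 1)⁻¹) (by positivity)
  have ht' : ∀ i ∈ Finset.range (Module.finrank ℝ E + 1), 0 ≤ t i ∧ t i * K < 1 := by
    intro i hi
    refine ⟨(ht i hi).1, ?_⟩
    have h1 : t i * (K + 1) < 1 := by
      have := mul_lt_mul_of_pos_right (ht i hi).2 (show 0 < K + 1 by positivity)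
      rwa [inv_mul_cancel₀ (by positivity)] at this
    nlinarith [(ht i hi).1]
  have h1 : ∫ x in B, (ContinuousLinearMap.id ℝ E + (1 : ℝ) • A x).det ∂μ = μ.real B := by
    have e1 : ∀ x, (ContinuousLinearMap.id ℝ E + (1 : ℝ) • A x).det =
        ∑ i ∈ Finset.range (Module.finrank ℝ E + 1),
          c i * (ContinuousLinearMap.id ℝ E + t i • A x).det := by
      intro x
      obtain ⟨q, hqd, hq⟩ := exists_polynomial_det_id_add_smul (A x)
      simp only [← hq]
      exact hc q hqd
    simp only [e1]
    rw [integral_finsetSum _ fun i _ => (hdet (t i)).const_mul (c i)]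
    have e2 : ∑ i ∈ Finset.range (Module.finrank ℝ E + 1), c i = 1 := by
      simpa using (hc 1 (by simp)).symm
    rw [Finset.sum_congr rfl fun i hi => by
      rw [integral_const_mul, hsmall (t i) (ht' i hi).1 (ht' i hi).2], ← Finset.sum_mul, e2, one_mul]
  have h0 : ∀ x, (ContinuousLinearMap.id ℝ E + (1 : ℝ) • A x).det = 0 := by
    intro x
    have : ContinuousLinearMap.id ℝ E + (1 : ℝ) • A x = fderiv ℝ r x := by simp [A]
    rw [this]
    by_contra hne
    -- The derivative of `‖r‖ ^ 2` in a direction that is mapped to `r x` would not vanish.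
    obtain ⟨v, hv⟩ := (LinearMap.equivOfDetNeZero _ hne).surjective (r x)
    have hv' : fderiv ℝ r x v = r x := hv
    have hn : HasFDerivAt (fun y => ‖r y‖ ^ 2) _ x :=
      ((hr.differentiable one_ne_zero) x).hasFDerivAt.norm_sq
    have hn' : HasFDerivAt (fun y => ‖r y‖ ^ 2) (0 : E →L[ℝ] ℝ) x := by
      simp only [hrM]
      exact hasFDerivAt_const _ _
    have := congrArg (fun L => L v) (hn.unique hn')
    simp [hv', hrM, hM.ne'] at this
  have hpos : 0 < μ.real B :=
    ENNReal.toReal_pos (measure_closedBall_pos μ 0 hM).ne' hBc.measure_lt_top.ne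
  simp only [h0, integral_zero] at h1
  exact hpos.ne h1

/-- A smooth vector field that is the identity off a ball has a zero: otherwise its normalization
would be a retraction onto the sphere. -/
theorem exists_zero_of_smooth {E : Type*} [NormedAddCommGroup E] [InnerProductSpace ℝ E]
    [FiniteDimensional ℝ E] {M : ℝ} (hM : 0 < M) {V : E → E} (hV : ContDiff ℝ 1 V)
    (hid : ∀ x, M ≤ ‖x‖ → V x = x) : ∃ x, V x = 0 := by
  by_contra! hne
  refine not_exists_smooth_retraction hM (r := fun x => (M * ‖V x‖⁻¹) • V x) ?_ ?_ ?_
  · exact (contDiff_const.mul ((hV.norm ℝ hne).inv fun x => norm_ne_zero_iff.2 (hne x))).smul hV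
  · intro x
    have := norm_pos_iff.2 (hne x)
    rw [norm_smul, Real.norm_eq_abs, abs_of_pos (by positivity)]
    field_simp
  · intro x hx
    have hx' : ‖x‖ = M := by simpa using hx
    simp only [hid x hx'.ge, hx', mul_inv_cancel₀ hM.ne', one_smul]

/-- **Brouwer's fixed point theorem** for a continuous map with compact support. -/
theorem exists_fixedPoint_of_hasCompactSupport {E : Type*} [NormedAddCommGroup E]
    [InnerProductSpace ℝ E] [FiniteDimensional ℝ E] {T : E → E} (hT : Continuous T)
    (hs : HasCompactSupport T) : ∃ x, T x = x := by
  obtain ⟨M, hM, hTM⟩ : ∃ M : ℝ, 0 < M ∧ ∀ x, M ≤ ‖x‖ → T x = 0 := by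
    obtain ⟨M, hM⟩ := hs.isCompact.isBounded.subset_ball (0 : E)
    refine ⟨max M 1, by positivity, fun x hx => ?_⟩
    refine image_eq_zero_of_notMem_tsupport fun hx' => ?_
    have := mem_ball_zero_iff.1 (hM hx')
    exact absurd (le_trans (le_max_left _ _) hx) (not_le.2 this)
  have happ : ∀ ε : ℝ, 0 < ε → ∃ x ∈ closedBall (0 : E) M, dist x (T x) < ε := by
    intro ε hε
    obtain ⟨g, hg, hgT, hgs⟩ := hT.exists_contDiff_approx 1 (ε := fun _ => ε) continuous_const
      fun _ => hε
    have hg0 : ∀ x, M ≤ ‖x‖ → g x = 0 := fun x hx => by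
      by_contra hne
      exact hgs hne (hTM x hx)
    obtain ⟨x, hx⟩ := exists_zero_of_smooth hM (V := fun x => x - g x) (contDiff_id.sub hg)
      fun x hx => by simp [hg0 x hx]
    have hxg : x = g x := sub_eq_zero.1 hx
    refine ⟨x, ?_, by nth_rewrite 1 [hxg]; exact hgT x⟩
    by_contra hn
    simp only [mem_closedBall_zero_iff, not_le] at hn
    have := hg0 x hn.le
    rw [← hxg] at this
    rw [this, norm_zero] at hn
    exact absurd hM hn.not_gt
  obtain ⟨x, hx, hmin⟩ := (isCompact_closedBall (0 : E) M).exists_isMinOn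
    ⟨0, by simp [hM.le]⟩ (continuous_id.dist hT).continuousOn
  refine ⟨x, ?_⟩
  by_contra hne
  obtain ⟨y, hy, hy'⟩ := happ (dist x (T x)) (dist_pos.2 (Ne.symm hne))
  exact absurd (hmin hy) (not_le.2 hy')

/-- **Leray–Schauder principle** in finite dimension: apply Brouwer's theorem to `χ T`, where the
cutoff `χ` is one on the ball of radius `R + 1` and zero off that of radius `R + 2`. -/
theorem exists_fixedPoint_of_bounded {E : Type*} [NormedAddCommGroup E]
    [InnerProductSpace ℝ E] [FiniteDimensional ℝ E] {T : E → E} (hT : Continuous T) (R : ℝ)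
    (hR : ∀ l ∈ Icc (0 : ℝ) 1, ∀ x, x = l • T x → ‖x‖ ≤ R) : ∃ x, T x = x := by
  let χ : E → ℝ := fun x => max 0 (min 1 (R + 2 - ‖x‖))
  have hχc : Continuous χ := by fun_prop
  have hχ : ∀ x, χ x ∈ Icc (0 : ℝ) 1 := fun x => ⟨le_max_left _ _, max_le zero_le_one (min_le_left _ _)⟩
  obtain ⟨x, hx⟩ := exists_fixedPoint_of_hasCompactSupport (T := fun x => χ x • T x)
    (hχc.smul hT) (HasCompactSupport.of_support_subset_isCompact
      (isCompact_closedBall (0 : E) (R + 2)) fun x hx => by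
        by_contra hn
        simp only [mem_closedBall_zero_iff, not_le] at hn
        refine hx ?_
        have : χ x = 0 := max_eq_left ((min_le_right _ _).trans (by linarith))
        simp [this])
  have hxR := hR _ (hχ x) x hx.symm
  have h1 : χ x = 1 := by
    simp only [χ]
    rw [min_eq_left (by linarith), max_eq_right zero_le_one]
  exact ⟨x, by simpa [h1] using hx⟩

/-! ### Solvability of finite systems -/

/-- Solvability of a finite system `m u + C(u) + E(A(u)) = m b`, where `E` is nonnegative when
tested with its argument and `C` is nonnegative when tested with `A(u)` or with the sign of `u`.
The test with `A(u)` bounds `A(u)`, hence `E(A(u))`; the test with the sign then bounds `u`.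
No growth of `A` or of `C` is assumed. -/
theorem exists_solution_of_test_nonneg {ι : Type*} [Fintype ι] {A : ℝ → ℝ} (hA : Continuous A)
    (hAm : Monotone A) (hA0 : A 0 = 0) (m b : ι → ℝ) (hm : ∀ i, 0 < m i)
    {C E : (ι → ℝ) → ι → ℝ} (hC : Continuous C) (hE : Continuous E)
    (hEw : ∀ w, 0 ≤ ∑ i, w i * E w i) (hCA : ∀ u : ι → ℝ, 0 ≤ ∑ i, A (u i) * C u i)
    (hCs : ∀ u : ι → ℝ, 0 ≤ ∑ i, (SignType.sign (u i) : ℝ) * C u i) :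
    ∃ u : ι → ℝ, ∀ i, m i * u i + C u i + E (fun j => A (u j)) i = m i * b i := by
  have hsgn : ∀ x : ℝ, |(SignType.sign x : ℝ)| ≤ 1 := by
    intro x
    rcases lt_trichotomy x 0 with h | h | h <;> simp [h]
  have hAs : ∀ x : ℝ, 0 ≤ x * A x := by
    intro x
    rcases le_total 0 x with h | h
    · exact mul_nonneg h (hA0 ▸ hAm h)
    · exact mul_nonneg_of_nonpos_of_nonpos h (hA0 ▸ hAm h)
  obtain ⟨B, hB0, hB⟩ : ∃ B : ℝ, 0 ≤ B ∧ ∀ i, |b i| ≤ B :=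
    ⟨∑ i, |b i|, by positivity, fun i =>
      Finset.single_le_sum (f := fun i => |b i|) (fun _ _ => abs_nonneg _) (Finset.mem_univ i)⟩
  obtain ⟨a, ha⟩ := (isCompact_Icc (a := -(B + 1)) (b := B + 1)).exists_bound_of_continuousOn
    hA.continuousOn
  have ha0 : 0 ≤ a := (norm_nonneg _).trans (ha 0 ⟨by linarith, by linarith⟩)
  -- Testing with `A(u)` bounds `A(u)`: where `|u i| > B + 1`, the term of index `i` in the test
  -- is at least `m i * |A (u i)|`, and all terms are bounded below by the values of `A` on
  -- `[-(B + 1), B + 1]`.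
  obtain ⟨W, hW⟩ : ∃ W : ℝ, ∀ l ∈ Icc (0 : ℝ) 1, ∀ u : ι → ℝ,
      (∀ i, m i * u i + l * (C u i + E (fun j => A (u j)) i) = l * (m i * b i)) →
      ∀ i, |A (u i)| ≤ W := by
    refine ⟨a + ∑ j, (∑ i, m i * ((2 * B + 1) * a)) / m j, fun l hl u hu i => ?_⟩
    have htest : ∑ i, m i * ((u i - l * b i) * A (u i)) ≤ 0 := by
      have h1 : ∀ i, m i * ((u i - l * b i) * A (u i)) =
          -(l * (A (u i) * C u i + A (u i) * E (fun j => A (u j)) i)) := by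
        intro i; linear_combination (A (u i)) * hu i
      simp only [h1, Finset.sum_neg_distrib, ← Finset.mul_sum, Finset.sum_add_distrib]
      have := mul_nonneg hl.1 (add_nonneg (hCA u) (hEw fun j => A (u j)))
      linarith
    have hlb : ∀ i, |l * b i| ≤ B := fun i => by
      rw [abs_mul, abs_of_nonneg hl.1]
      exact (mul_le_of_le_one_left (abs_nonneg _) hl.2).trans (hB i)
    have hlow : ∀ i, -((2 * B + 1) * a) ≤ (u i - l * b i) * A (u i) ∧
        (B + 1 < |u i| → |A (u i)| ≤ (u i - l * b i) * A (u i)) := by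
      intro i
      have hb := abs_le.1 (hlb i)
      have hbig : B + 1 < |u i| → |A (u i)| ≤ (u i - l * b i) * A (u i) := by
        intro h
        rcases lt_abs.1 h with h | h
        · have h2 : 0 ≤ A (u i) := hA0 ▸ hAm (by linarith)
          rw [abs_of_nonneg h2]
          nlinarith
        · have h2 : A (u i) ≤ 0 := hA0 ▸ hAm (by linarith)
          rw [abs_of_nonpos h2]
          nlinarith
      refine ⟨?_, hbig⟩
      by_cases h : B + 1 < |u i|
      · exact le_trans (by nlinarith) ((abs_nonneg _).trans (hbig h))
      · have h' := abs_le.1 (not_lt.1 h)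
        have h1 : |A (u i)| ≤ a := ha _ ⟨h'.1, h'.2⟩
        have h2 : |u i - l * b i| ≤ 2 * B + 1 := by
          rw [abs_le]; constructor <;> linarith
        have := mul_le_mul h2 h1 (abs_nonneg _) (by linarith)
        rw [← abs_mul] at this
        exact (abs_le.1 this).1
    have hnn : ∀ j, 0 ≤ (∑ i, m i * ((2 * B + 1) * a)) / m j := fun j =>
      div_nonneg (Finset.sum_nonneg fun i _ => mul_nonneg (hm i).le (by positivity)) (hm j).le
    by_cases h : B + 1 < |u i|
    · have h1 : m i * |A (u i)| ≤ ∑ i, m i * ((2 * B + 1) * a) := by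
        have h2 : ∑ j, (m j * ((u j - l * b j) * A (u j)) + m j * ((2 * B + 1) * a)) ≤
            ∑ i, m i * ((2 * B + 1) * a) := by
          rw [Finset.sum_add_distrib]; linarith
        refine le_trans ?_ h2
        have h3 := Finset.single_le_sum
          (f := fun j => m j * ((u j - l * b j) * A (u j)) + m j * ((2 * B + 1) * a))
          (fun j _ => by rw [← mul_add]; exact mul_nonneg (hm j).le (by linarith [(hlow j).1]))
          (Finset.mem_univ i)
        refine le_trans ?_ h3
        have h4 := mul_le_mul_of_nonneg_left ((hlow i).2 h) (hm i).le
        have h5 : 0 ≤ m i * ((2 * B + 1) * a) := mul_nonneg (hm i).le (by positivity)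
        linarith
      have h2 : |A (u i)| ≤ (∑ i, m i * ((2 * B + 1) * a)) / m i := by
        rw [le_div_iff₀ (hm i)]; linarith
      have := Finset.single_le_sum (f := fun j => (∑ i, m i * ((2 * B + 1) * a)) / m j)
        (fun j _ => hnn j) (Finset.mem_univ i)
      linarith
    · have h' := abs_le.1 (not_lt.1 h)
      have h1 : |A (u i)| ≤ a := ha _ ⟨h'.1, h'.2⟩
      have := Finset.sum_nonneg fun j (_ : j ∈ Finset.univ) => hnn j
      linarith
  obtain ⟨Q, hQ⟩ := (isCompact_Icc (a := fun _ : ι => -W) (b := fun _ => W)).exists_bound_of_continuousOn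
    hE.continuousOn
  -- Testing with the sign of `u` gives an `ℓ¹` bound, as `E (A u)` is bounded by now.
  have hbound : ∀ l ∈ Icc (0 : ℝ) 1, ∀ u : ι → ℝ,
      (∀ i, m i * u i + l * (C u i + E (fun j => A (u j)) i) = l * (m i * b i)) →
      ∑ i, m i * |u i| ≤ ∑ i, (m i * B + |Q|) := by
    intro l hl u hu
    have hw : (fun j => A (u j)) ∈ Icc (fun _ : ι => -W) (fun _ => W) :=
      ⟨fun i => (abs_le.1 (hW l hl u hu i)).1, fun i => (abs_le.1 (hW l hl u hu i)).2⟩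
    have hEQ : ∀ i, |E (fun j => A (u j)) i| ≤ |Q| := fun i =>
      (norm_le_pi_norm (E fun j => A (u j)) i).trans ((hQ _ hw).trans (le_abs_self Q))
    have h1 : ∀ i, m i * |u i| = l * ((SignType.sign (u i) : ℝ) * (m i * b i)
        - (SignType.sign (u i) : ℝ) * E (fun j => A (u j)) i)
        - l * ((SignType.sign (u i) : ℝ) * C u i) := by
      intro i
      rw [← sign_mul_self (u i)]
      linear_combination (SignType.sign (u i) : ℝ) * hu i
    calc ∑ i, m i * |u i| ≤ ∑ i, l * ((SignType.sign (u i) : ℝ) * (m i * b i)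
        - (SignType.sign (u i) : ℝ) * E (fun j => A (u j)) i) := by
          simp only [h1, Finset.sum_sub_distrib, ← Finset.mul_sum]
          have := mul_nonneg hl.1 (hCs u)
          linarith
      _ ≤ _ := by
        refine Finset.sum_le_sum fun i _ => ?_
        have hs : ∀ x y : ℝ, |y| ≤ x → |(SignType.sign (u i) : ℝ) * y| ≤ x := fun x y h => by
          rw [abs_mul]
          exact (mul_le_of_le_one_left (abs_nonneg _) (hsgn _)).trans h
        have h2 := abs_le.1 (hs (m i * B) (m i * b i) (by
          rw [abs_mul, abs_of_pos (hm i)]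
          exact mul_le_mul_of_nonneg_left (hB i) (hm i).le))
        have h3 := abs_le.1 (hs _ _ (hEQ i))
        have h4 : 0 ≤ m i * B + |Q| := add_nonneg (mul_nonneg (hm i).le hB0) (abs_nonneg _)
        nlinarith [hl.1, hl.2]
  let F : (ι → ℝ) → ι → ℝ := fun u i => b i - (m i)⁻¹ * (C u i + E (fun j => A (u j)) i)
  have hF : Continuous F := by
    refine continuous_pi fun i => continuous_const.sub (continuous_const.mul ?_)
    exact ((continuous_apply i).comp hC).add ((continuous_apply i).comp
      (hE.comp (continuous_pi fun j => hA.comp (continuous_apply j))))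
  have hFeq : ∀ l u, (∀ i, u i = l * F u i) →
      ∀ i, m i * u i + l * (C u i + E (fun j => A (u j)) i) = l * (m i * b i) := by
    intro l u h i
    have hmi := (hm i).ne'
    have h1 : m i * F u i = m i * b i - (C u i + E (fun j => A (u j)) i) := by
      simp only [F]; field_simp
    have h2 := h i
    linear_combination (m i) * h2 + l * h1
  obtain ⟨x, hx⟩ := exists_fixedPoint_of_bounded
    (T := fun x : EuclideanSpace ℝ ι => WithLp.toLp 2 (F (WithLp.ofLp x)))
    ((PiLp.continuous_toLp 2 _).comp (hF.comp (PiLp.continuous_ofLp 2 _)))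
    (∑ j, (∑ i, (m i * B + |Q|)) / m j) (fun l hl x hx => by
      have hx' : ∀ i, x i = l * F (WithLp.ofLp x) i := fun i => by
        have := congrArg (fun y : EuclideanSpace ℝ ι => y i) hx
        simpa using this
      have h1 := hbound l hl (WithLp.ofLp x) (hFeq l _ hx')
      have h2 : ‖x‖ ≤ ∑ j, |x j| := by
        conv_lhs => rw [← (EuclideanSpace.basisFun ι ℝ).sum_repr x]
        refine (norm_sum_le _ _).trans (Finset.sum_le_sum fun j _ => ?_)
        rw [norm_smul]; simp
      refine h2.trans (Finset.sum_le_sum fun j _ => ?_)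
      rw [le_div_iff₀ (hm j), mul_comm]
      exact (Finset.single_le_sum (f := fun i => m i * |x i|)
        (fun i _ => mul_nonneg (hm i).le (abs_nonneg _)) (Finset.mem_univ j)).trans h1)
  refine ⟨WithLp.ofLp x, fun i => ?_⟩
  have := hFeq 1 (WithLp.ofLp x) (fun i => by
    have := congrArg (fun y : EuclideanSpace ℝ ι => y i) hx
    simpa using this.symm) i
  linarith

end FixedPoints

open MeasureTheory Set Filter Topology

/-! ### Volumes of simplices -/

/-- The determinant of `d` vectors of the `d`-dimensional space. -/
def vdet {d : ℕ} (v : Fin d → Pt d) : ℝ := (Matrix.of fun i j => v i j).det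

theorem vdet_eq_zero_of_orthogonal {d : ℕ} {v : Fin d → Pt d} {n : Pt d} (hn : n ≠ 0)
    (h : ∀ i, inner ℝ n (v i) = 0) : vdet v = 0 := by
  refine Matrix.exists_mulVec_eq_zero_iff.1 ⟨WithLp.ofLp n, fun h0 => hn ?_, ?_⟩
  · ext i; simpa using congrFun h0 i
  · ext i
    have := h i
    simp only [PiLp.inner_apply, RCLike.inner_apply, conj_trivial] at this
    simpa [Matrix.mulVec, dotProduct] using this

/-- The linear map that sends the standard basis to the family `v`. -/
def frameMap {d : ℕ} (v : Fin d → Pt d) : Pt d →ₗ[ℝ] Pt d :=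
  (EuclideanSpace.basisFun (Fin d) ℝ).toBasis.constr ℝ v

theorem det_frameMap {d : ℕ} (v : Fin d → Pt d) : LinearMap.det (frameMap v) = vdet v := by
  rw [← LinearMap.det_toMatrix (EuclideanSpace.basisFun (Fin d) ℝ).toBasis, vdet,
    ← Matrix.det_transpose]
  congr 1
  ext i j
  simp [LinearMap.toMatrix_apply, frameMap]

/-- The simplex with vertices `p` and `p + v i`. -/
def simplexAt {d m : ℕ} (p : Pt d) (v : Fin m → Pt d) : Set (Pt d) :=
  convexHull ℝ (insert p (range fun i => p + v i))

/-- The simplex spanned by the origin and the standard basis. -/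
def unitSimplex (d : ℕ) : Set (Pt d) :=
  simplexAt 0 (fun i => EuclideanSpace.basisFun (Fin d) ℝ i)

theorem simplexAt_eq_image {d m : ℕ} (p : Pt d) (v : Fin m → Pt d) :
    simplexAt p v = (fun x => p + x) '' simplexAt 0 v := by
  have h := (AffineEquiv.constVAdd ℝ (Pt d) p).toAffineMap.image_convexHull
    (insert 0 (range fun i => 0 + v i))
  rw [image_insert_eq, ← range_comp] at h
  simpa [simplexAt, Function.comp_def] using h.symm

theorem simplexAt_image_linear {d m k : ℕ} (f : Pt d →ₗ[ℝ] Pt m) (v : Fin k → Pt d) :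
    f '' simplexAt 0 v = simplexAt 0 (fun i => f (v i)) := by
  rw [simplexAt, f.image_convexHull, image_insert_eq, ← range_comp]
  simp [simplexAt, Function.comp_def]

theorem volume_simplexAt {d : ℕ} (p : Pt d) (v : Fin d → Pt d) :
    volume (simplexAt p v) = ENNReal.ofReal |vdet v| * volume (unitSimplex d) := by
  have h : simplexAt 0 v = frameMap v '' unitSimplex d := by
    rw [unitSimplex, simplexAt_image_linear]
    congr 1
    ext1 i
    rw [frameMap, ← OrthonormalBasis.coe_toBasis, Module.Basis.constr_basis]
  rw [simplexAt_eq_image, image_add_left, measure_preimage_add, h,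
    Measure.addHaar_image_linearMap, det_frameMap]

theorem volume_unitSimplex_lt_top (d : ℕ) : volume (unitSimplex d) < ⊤ := by
  refine (IsCompact.measure_lt_top ?_)
  exact (((Set.finite_range _).insert _).isCompact_convexHull (𝕜 := ℝ))

theorem volumeReal_simplexAt {d : ℕ} (p : Pt d) (v : Fin d → Pt d) :
    volume.real (simplexAt p v) = |vdet v| * volume.real (unitSimplex d) := by
  rw [Measure.real, volume_simplexAt, ENNReal.toReal_mul, ENNReal.toReal_ofReal (abs_nonneg _)]
  rfl

theorem volumeReal_unitSimplex_pos (d : ℕ) : 0 < volume.real (unitSimplex d) := by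
  have hspan : affineSpan ℝ (insert (0 : Pt d)
      (range fun i => 0 + EuclideanSpace.basisFun (Fin d) ℝ i)) = ⊤ := by
    refine SetLike.coe_injective ?_
    rw [affineSpan_insert_zero]
    have := (EuclideanSpace.basisFun (Fin d) ℝ).toBasis.span_eq
    rw [OrthonormalBasis.coe_toBasis] at this
    simp only [zero_add]
    rw [this]
    rfl
  have hne : (interior (unitSimplex d)).Nonempty :=
    interior_convexHull_nonempty_iff_affineSpan_eq_top.2 hspan
  exact ENNReal.toReal_pos (Measure.measure_pos_of_nonempty_interior _ hne).ne'
    (volume_unitSimplex_lt_top d).ne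

/-- The measure of a simplex of codimension one with unit normal `n`. -/
theorem faceMeasure_simplexAt {m : ℕ} (p : Pt (m + 1)) (v : Fin m → Pt (m + 1)) {n : Pt (m + 1)}
    (hn : ‖n‖ = 1) (hv : ∀ i, inner ℝ n (v i) = 0) :
    faceMeasure (simplexAt p v) =
      |vdet (Fin.cons n v : Fin (m + 1) → Pt (m + 1))| * volume.real (unitSimplex m) := by
  have hn0 : n ≠ 0 := fun h => by simp [h] at hn
  have : Fact (Module.finrank ℝ (Pt (m + 1)) = m + 1) := ⟨by simp⟩
  let b := OrthonormalBasis.fromOrthogonalSpanSingleton (𝕜 := ℝ) m hn0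
  let J : Pt m →ₗᵢ[ℝ] Pt (m + 1) :=
    (ℝ ∙ n)ᗮ.subtypeₗᵢ.comp b.repr.symm.toLinearIsometry
  let y : Fin m → Pt m := fun i => b.repr ⟨v i, Submodule.mem_orthogonal_singleton_iff_inner_right.2 (hv i)⟩
  have hJ : ∀ i, J (y i) = v i := fun i => by simp [J, y]
  have himg : simplexAt p v = (fun x => p + J x) '' simplexAt 0 y := by
    rw [simplexAt_eq_image]
    have h1 : simplexAt 0 v = J.toLinearMap '' simplexAt 0 y := by
      rw [simplexAt_image_linear]
      congr 1
      ext1 i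
      exact (hJ i).symm
    rw [h1, image_image]
    rfl
  have hiso : Isometry fun x => p + J x := (isometry_add_left p).comp J.isometry
  have h2 : faceMeasure (simplexAt p v) = volume.real (simplexAt 0 y) := by
    rw [faceMeasure, himg, Measure.real]
    congr 1
    rw [← EuclideanSpace.euclideanHausdorffMeasure_eq_volume]
    exact hiso.euclideanHausdorffMeasure_image _
  rw [h2, volumeReal_simplexAt]
  congr 1
  rw [← sq_eq_sq₀ (abs_nonneg _) (abs_nonneg _), sq_abs, sq_abs]
  have hgram : ∀ {k l : ℕ} (w : Fin k → Pt l) (i j : Fin k),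
      ((Matrix.of fun i j => w i j) * (Matrix.of fun i j => w i j).transpose) i j =
        inner ℝ (w i) (w j) := by
    intro k l w i j
    simp [Matrix.mul_apply, PiLp.inner_apply, mul_comm]
  have hsq : ∀ {k : ℕ} (w : Fin k → Pt k),
      vdet w ^ 2 = (Matrix.of fun i j => inner ℝ (w i) (w j)).det := by
    intro k w
    rw [vdet, sq]
    nth_rewrite 2 [← Matrix.det_transpose]
    rw [← Matrix.det_mul]
    congr 1
    ext i j
    exact hgram w i j
  rw [hsq, hsq, Matrix.det_succ_row_zero, Fin.sum_univ_succ]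
  have hn1 : inner ℝ n n = 1 := by rw [real_inner_self_eq_norm_sq, hn]; norm_num
  simp only [Matrix.of_apply, Fin.cons_zero, Fin.cons_succ, hv, hn1]
  simp only [Fin.val_zero, pow_zero, mul_one, mul_zero, zero_mul, Finset.sum_const_zero, add_zero,
    one_mul]
  congr 1
  ext i j
  simp only [Matrix.of_apply, Matrix.submatrix_apply, Fin.succAbove_zero, Fin.cons_succ]
  rw [← hJ i, ← hJ j, J.inner_map_map]

/-! ### Barycentric coordinates and centres -/

theorem affineMap_sum_smul {ι : Type*} {d : ℕ} (l : Pt d →ᵃ[ℝ] ℝ) (s : Finset ι) (w : ι → ℝ)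
    (x : ι → Pt d) (hw : ∑ i ∈ s, w i = 1) :
    l (∑ i ∈ s, w i • x i) = ∑ i ∈ s, w i * l (x i) := by
  have h : ∀ y, l y = l.linear y + l 0 := fun y => congrFun l.decomp y
  rw [h, map_sum]
  have : ∑ i ∈ s, w i * l (x i) = ∑ i ∈ s, (l.linear (w i • x i) + w i * l 0) := by
    refine Finset.sum_congr rfl fun i _ => ?_
    rw [h (x i), map_smul, smul_eq_mul, mul_add]
  rw [this, Finset.sum_add_distrib, ← Finset.sum_mul, hw, one_mul]

theorem affineMap_combo {d : ℕ} (l : Pt d →ᵃ[ℝ] ℝ) (x v : Pt d) (t : ℝ) :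
    l (x + t • (v - x)) = (1 - t) * l x + t * l v := by
  have h : ∀ y, l y = l.linear y + l 0 := fun y => congrFun l.decomp y
  rw [h, h x, h v]
  simp only [map_add, map_smul, map_sub, smul_eq_mul]
  ring

theorem affineSpan_eq_top_of_card {d : ℕ} {K : Finset (Pt d)}
    (hK : AffineIndependent ℝ ((↑) : K → Pt d)) (hc : K.card = d + 1) :
    affineSpan ℝ (K : Set (Pt d)) = ⊤ := by
  have := hK.affineSpan_eq_top_iff_card_eq_finrank_add_one.2 (by simp [hc])
  rw [← this]
  simp

/-- Barycentric coordinates of a full-dimensional simplex: `l p` is the affine function that is one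
at the vertex `p` and zero at the others. -/
theorem exists_barycentric {d : ℕ} {K : Finset (Pt d)}
    (hK : AffineIndependent ℝ ((↑) : K → Pt d)) (hc : K.card = d + 1) :
    ∃ l : Pt d → (Pt d →ᵃ[ℝ] ℝ), (∀ p ∈ K, l p p = 1) ∧
      (∀ p ∈ K, ∀ q ∈ K, p ≠ q → l p q = 0) ∧
      (∀ x, x ∈ convexHull ℝ (K : Set (Pt d)) ↔ ∀ p ∈ K, 0 ≤ l p x) := by
  let b : AffineBasis K ℝ (Pt d) := ⟨(↑), hK, by
    have := affineSpan_eq_top_of_card hK hc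
    rw [← this]; simp⟩
  have hb : ∀ i, b i = i := fun i => rfl
  refine ⟨fun p => if h : p ∈ K then b.coord ⟨p, h⟩ else 0, fun p hp => ?_, fun p hp q hq hne => ?_,
    fun x => ?_⟩
  · simp only [hp, dif_pos]
    exact b.coord_apply_eq ⟨p, hp⟩
  · simp only [hp, dif_pos]
    exact b.coord_apply_ne (i := ⟨p, hp⟩) (j := ⟨q, hq⟩) (by simpa using hne)
  · have h := b.convexHull_eq_nonneg_coord
    have hr : range b = (K : Set (Pt d)) := by
      ext y; simp [hb]
    rw [hr] at h
    rw [h]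
    constructor
    · intro hx p hp
      simp only [hp, dif_pos]
      exact hx ⟨p, hp⟩
    · intro hx i
      have := hx i i.2
      simpa only [i.2, dif_pos] using this

/-- A point in the relative interior of a face, namely its centroid. -/
theorem exists_pos_barycentric {d : ℕ} {K F : Finset (Pt d)} {l : Pt d → (Pt d →ᵃ[ℝ] ℝ)}
    (h1 : ∀ p ∈ K, l p p = 1) (h0 : ∀ p ∈ K, ∀ q ∈ K, p ≠ q → l p q = 0) (hFK : F ⊆ K)
    (hF : F.Nonempty) :
    ∃ x ∈ convexHull ℝ (F : Set (Pt d)), (∀ p ∈ F, 0 < l p x) ∧ ∀ p ∈ K, p ∉ F → l p x = 0 := by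
  have hcard : (0 : ℝ) < F.card := by exact_mod_cast hF.card_pos
  have hw : ∑ _i ∈ F, (F.card : ℝ)⁻¹ = 1 := by
    rw [Finset.sum_const, nsmul_eq_mul, mul_inv_cancel₀ hcard.ne']
  refine ⟨∑ i ∈ F, (F.card : ℝ)⁻¹ • i, ?_, fun p hp => ?_, fun p hp hpF => ?_⟩
  · exact (convex_convexHull ℝ _).sum_mem (fun _ _ => by positivity) hw
      fun i hi => subset_convexHull ℝ _ hi
  · rw [affineMap_sum_smul _ _ _ _ hw]
    refine Finset.sum_pos' (fun i hi => ?_) ⟨p, hp, ?_⟩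
    · by_cases h : p = i
      · rw [← h, h1 p (hFK hp)]; positivity
      · rw [h0 p (hFK hp) i (hFK hi) h, mul_zero]
    · rw [h1 p (hFK hp)]; positivity
  · rw [affineMap_sum_smul _ _ _ _ hw]
    refine Finset.sum_eq_zero fun i hi => ?_
    rw [h0 p hp i (hFK hi) (fun h => hpF (h ▸ hi)), mul_zero]

theorem affineMap_eq_zero_of_mem_affineSpan {d : ℕ} (l : Pt d →ᵃ[ℝ] ℝ) {s : Set (Pt d)}
    (h : ∀ p ∈ s, l p = 0) {x : Pt d} (hx : x ∈ affineSpan ℝ s) : l x = 0 := by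
  have h1 : s ⊆ ((AffineSubspace.mk' (0 : ℝ) (⊥ : Submodule ℝ ℝ)).comap l : Set (Pt d)) := by
    intro p hp
    simp [h p hp]
  have h2 := affineSpan_le.2 h1 hx
  simpa using h2

theorem affineMap_eq_zero_of_mem_convexHull {d : ℕ} (l : Pt d →ᵃ[ℝ] ℝ) {s : Set (Pt d)}
    (h : ∀ p ∈ s, l p = 0) {x : Pt d} (hx : x ∈ convexHull ℝ s) : l x = 0 :=
  affineMap_eq_zero_of_mem_affineSpan l h (convexHull_subset_affineSpan s hx)

theorem affineMap_ext_of_card {d : ℕ} {K : Finset (Pt d)}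
    (hK : AffineIndependent ℝ ((↑) : K → Pt d)) (hc : K.card = d + 1) {l l' : Pt d →ᵃ[ℝ] ℝ}
    (h : ∀ p ∈ K, l p = l' p) (x : Pt d) : l x = l' x := by
  have hx : x ∈ affineSpan ℝ (K : Set (Pt d)) := by
    rw [affineSpan_eq_top_of_card hK hc]; trivial
  have := affineMap_eq_zero_of_mem_affineSpan (l - l') (s := K) (fun p hp => by simp [h p hp]) hx
  simpa [sub_eq_zero] using this

/-- The choice in the definition of `center` is effective: Mathlib has the circumcentre. -/
theorem center_spec {d : ℕ} {F : Finset (Pt d)} (hF : AffineIndependent ℝ ((↑) : F → Pt d))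
    (hne : F.Nonempty) :
    center F ∈ affineSpan ℝ (F : Set (Pt d)) ∧
      ∀ p ∈ F, ∀ q ∈ F, dist p (center F) = dist q (center F) := by
  obtain ⟨n, hn⟩ : ∃ n, F.card = n + 1 := ⟨F.card - 1, by have := hne.card_pos; omega⟩
  let e := F.equivFinOfCardEq hn
  let s : Affine.Simplex ℝ (Pt d) n :=
    ⟨fun i => (e.symm i : Pt d), hF.comp_embedding e.symm.toEmbedding⟩
  have hr : range s.points = (F : Set (Pt d)) := by
    ext y
    constructor
    · rintro ⟨i, rfl⟩; exact (e.symm i).2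
    · intro hy; exact ⟨e ⟨y, hy⟩, by simp [s]⟩
  have hd : ∀ p ∈ F, dist p s.circumcenter = s.circumradius := by
    intro p hp
    have : p ∈ range s.points := by rw [hr]; exact hp
    obtain ⟨i, rfl⟩ := this
    exact s.dist_circumcenter_eq_circumradius i
  refine Classical.epsilon_spec (p := fun c => c ∈ affineSpan ℝ (F : Set (Pt d)) ∧
    ∀ p ∈ F, ∀ q ∈ F, dist p c = dist q c) ⟨s.circumcenter, ?_, fun p hp q hq => ?_⟩
  · rw [← hr]; exact s.circumcenter_mem_affineSpan
  · rw [hd p hp, hd q hq]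

/-- The inner products of a difference of centres are read off from the squared distances: this is
how the Delaunay condition enters. -/
theorem dist_sq_sub {d : ℕ} (p q c c' : Pt d) :
    2 * inner ℝ (c' - c) (p - q) =
      (dist p c ^ 2 - dist q c ^ 2) - (dist p c' ^ 2 - dist q c' ^ 2) := by
  simp only [dist_eq_norm, ← real_inner_self_eq_norm_sq, inner_sub_left, inner_sub_right]
  rw [real_inner_comm c p, real_inner_comm c q, real_inner_comm c' p, real_inner_comm c' q]
  ring

/-- A vector orthogonal to the differences of the elements of `F` is orthogonal to the affine
hull of `F`. -/
theorem inner_eq_zero_of_mem_affineSpan {d : ℕ} {F : Set (Pt d)} {n f : Pt d}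
    (h : ∀ q ∈ F, inner ℝ n (q - f) = 0) {x : Pt d} (hx : x ∈ affineSpan ℝ F) :
    inner ℝ n (x - f) = 0 := by
  let l : Pt d →ᵃ[ℝ] ℝ := ((innerSL ℝ n).toLinearMap.toAffineMap).comp
    (AffineMap.id ℝ (Pt d) - AffineMap.const ℝ (Pt d) f)
  exact affineMap_eq_zero_of_mem_affineSpan l (fun p hp => h p hp) hx

/-! ### Volume of a pyramid -/

theorem vdet_cons_add {m : ℕ} (x y : Pt (m + 1)) (v : Fin m → Pt (m + 1)) :
    vdet (Fin.cons (x + y) v : Fin (m + 1) → Pt (m + 1)) =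
      vdet (Fin.cons x v : Fin (m + 1) → Pt (m + 1)) +
        vdet (Fin.cons y v : Fin (m + 1) → Pt (m + 1)) := by
  simp only [vdet]
  rw [Matrix.det_succ_row_zero, Matrix.det_succ_row_zero, Matrix.det_succ_row_zero,
    ← Finset.sum_add_distrib]
  refine Finset.sum_congr rfl fun j _ => ?_
  have : ∀ z : Pt (m + 1), (Matrix.of fun i j =>
      (Fin.cons z v : Fin (m + 1) → Pt (m + 1)) i j).submatrix Fin.succ j.succAbove =
      Matrix.of fun i k => v i (j.succAbove k) := by
    intro z; ext i k; simp
  rw [this, this, this]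
  simp
  ring

theorem vdet_cons_smul {m : ℕ} (c : ℝ) (x : Pt (m + 1)) (v : Fin m → Pt (m + 1)) :
    vdet (Fin.cons (c • x) v : Fin (m + 1) → Pt (m + 1)) =
      c * vdet (Fin.cons x v : Fin (m + 1) → Pt (m + 1)) := by
  simp only [vdet]
  rw [Matrix.det_succ_row_zero, Matrix.det_succ_row_zero, Finset.mul_sum]
  refine Finset.sum_congr rfl fun j _ => ?_
  have : ∀ z : Pt (m + 1), (Matrix.of fun i j =>
      (Fin.cons z v : Fin (m + 1) → Pt (m + 1)) i j).submatrix Fin.succ j.succAbove =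
      Matrix.of fun i k => v i (j.succAbove k) := by
    intro z; ext i k; simp
  rw [this, this]
  simp
  ring

/-- If the vectors `v` are orthogonal to the unit vector `n`, then only the component along `n` of
the remaining vector enters into the determinant. -/
theorem vdet_cons_eq_inner_mul {m : ℕ} {n : Pt (m + 1)} {v : Fin m → Pt (m + 1)} (hn : ‖n‖ = 1)
    (hv : ∀ i, inner ℝ n (v i) = 0) (x : Pt (m + 1)) :
    vdet (Fin.cons x v : Fin (m + 1) → Pt (m + 1)) =
      inner ℝ n x * vdet (Fin.cons n v : Fin (m + 1) → Pt (m + 1)) := by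
  have hn0 : n ≠ 0 := fun h => by simp [h] at hn
  have hx : x = (inner ℝ n x : ℝ) • n + (x - (inner ℝ n x : ℝ) • n) := by abel
  conv_lhs => rw [hx]
  rw [vdet_cons_add, vdet_cons_smul]
  refine add_eq_left.2 (vdet_eq_zero_of_orthogonal hn0 fun i => ?_)
  refine Fin.cases ?_ (fun i => ?_) i
  · simp only [Fin.cons_zero, inner_sub_right, inner_smul_right, real_inner_self_eq_norm_sq, hn]
    ring
  · simpa using hv i

/-- The ratio between base times height and volume of a simplex of dimension `m + 1`. Its value
`m + 1` is not needed. -/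
def pyramidRatio (m : ℕ) : ℝ :=
  volume.real (unitSimplex m) / volume.real (unitSimplex (m + 1))

theorem pyramidRatio_pos (m : ℕ) : 0 < pyramidRatio m :=
  div_pos (volumeReal_unitSimplex_pos m) (volumeReal_unitSimplex_pos (m + 1))

theorem faceMeasure_simplexAt_mul {m : ℕ} (p : Pt (m + 1)) (v : Fin m → Pt (m + 1))
    {n : Pt (m + 1)} (hn : ‖n‖ = 1) (hv : ∀ i, inner ℝ n (v i) = 0) (x q : Pt (m + 1)) :
    faceMeasure (simplexAt p v) * |inner ℝ n x| =
      pyramidRatio m * volume.real (simplexAt q (Fin.cons x v : Fin (m + 1) → Pt (m + 1))) := by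
  rw [faceMeasure_simplexAt p v hn hv, volumeReal_simplexAt, vdet_cons_eq_inner_mul hn hv x, abs_mul,
    pyramidRatio]
  have := (volumeReal_unitSimplex_pos (m + 1)).ne'
  field_simp

/-- The measure of a face times the height over it is a multiple of the volume of the simplex; the
factor depends only on the dimension. -/
theorem faceMeasure_mul_height {m : ℕ} {F : Finset (Pt (m + 1))} (hF : F.card = m + 1)
    {f n : Pt (m + 1)} (hf : f ∈ F) (hn : ‖n‖ = 1) (h : ∀ q ∈ F, inner ℝ n (q - f) = 0)
    (p : Pt (m + 1)) :
    faceMeasure (convexHull ℝ (F : Set (Pt (m + 1)))) * |inner ℝ n (p - f)| =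
      pyramidRatio m * volume.real (convexHull ℝ (insert p (F : Set (Pt (m + 1))))) := by
  have hc : (F.erase f).card = m := by rw [Finset.card_erase_of_mem hf, hF]; rfl
  let e := (F.erase f).equivFinOfCardEq hc
  let v : Fin m → Pt (m + 1) := fun i => (e.symm i : Pt (m + 1)) - f
  have hr : insert f (range fun i => f + v i) = (F : Set (Pt (m + 1))) := by
    ext y
    constructor
    · rintro (rfl | ⟨i, rfl⟩)
      · exact hf
      · simpa [v] using Finset.mem_of_mem_erase (e.symm i).2
    · intro hy
      by_cases hyf : y = f
      · exact Or.inl hyf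
      · exact Or.inr ⟨e ⟨y, Finset.mem_erase.2 ⟨hyf, hy⟩⟩, by simp [v]⟩
  have h1 : convexHull ℝ (F : Set (Pt (m + 1))) = simplexAt f v := by rw [simplexAt, hr]
  have h2 : convexHull ℝ (insert p (F : Set (Pt (m + 1)))) =
      simplexAt f (Fin.cons (p - f) v : Fin (m + 1) → Pt (m + 1)) := by
    rw [simplexAt, Fin.range_fin_succ]
    simp only [Fin.cons_zero, add_sub_cancel]
    rw [insert_comm]
    congr 2
    exact hr.symm
  rw [h1, h2]
  exact faceMeasure_simplexAt_mul f v hn (fun i => h _ (Finset.mem_of_mem_erase (e.symm i).2)) _ _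

/-! ### Simplices and their neighbours -/

namespace SimplicialMesh

variable {d : ℕ} {Ω : Set (Pt d)} (T : SimplicialMesh Ω)

theorem mem_primal {K : Finset (Pt d)} : K ∈ T.primal ↔ K ∈ T.complex.faces ∧ K.card = d + 1 := by
  simp [primal]

theorem mem_primalBdry {K : Finset (Pt d)} : K ∈ T.primalBdry ↔
    K ∈ T.complex.faces ∧ K.card = d ∧ convexHull ℝ (K : Set (Pt d)) ⊆ frontier Ω := by
  simp [primalBdry]

theorem mem_primalBar {K : Finset (Pt d)} : K ∈ T.primalBar ↔ K ∈ T.primal ∨ K ∈ T.primalBdry := by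
  simp [primalBar]

theorem mem_neighbours {K L : Finset (Pt d)} : L ∈ T.neighbours K ↔
    (L ∈ T.primal ∨ L ∈ T.primalBdry) ∧ L ≠ K ∧ (K ∩ L).card = d ∧
      (K ∩ L ∈ T.primalBdry → K ∈ T.primalBdry ∨ L ∈ T.primalBdry) := by
  simp [neighbours, mem_primalBar]

theorem neighbours_symm {K L : Finset (Pt d)} (hK : K ∈ T.primalBar) (hL : L ∈ T.neighbours K) :
    K ∈ T.neighbours L := by
  obtain ⟨-, h2, h3, h4⟩ := T.mem_neighbours.1 hL
  rw [Finset.inter_comm] at h3 h4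
  exact T.mem_neighbours.2 ⟨T.mem_primalBar.1 hK, h2.symm, h3, fun h => (h4 h).symm⟩

theorem mem_primalBar_of_neighbours {K L : Finset (Pt d)} (hL : L ∈ T.neighbours K) :
    L ∈ T.primalBar := T.mem_primalBar.2 (T.mem_neighbours.1 hL).1

theorem notMem_primalBdry_of_primal {K : Finset (Pt d)} (hK : K ∈ T.primal) :
    K ∉ T.primalBdry := fun h => by
  have h1 := (T.mem_primal.1 hK).2
  have h2 := (T.mem_primalBdry.1 h).2.1
  omega

/-- Two simplices on the same side of a common face coincide. -/
theorem eq_of_same_side {L M : Finset (Pt d)} (hd : 0 < d) (hL : L ∈ T.primal) (hM : M ∈ T.primal)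
    {q r : Pt d} (hq : q ∈ L) (hr : r ∈ M) (hLM : L.erase q ⊆ M) {l : Pt d →ᵃ[ℝ] ℝ}
    (hl1 : l q = 1) (hl0 : ∀ f ∈ L.erase q, l f = 0) (hlr : 0 < l r) : L = M := by
  obtain ⟨hLf, hLc⟩ := T.mem_primal.1 hL
  obtain ⟨hMf, hMc⟩ := T.mem_primal.1 hM
  suffices hqM : q ∈ M by
    refine Finset.eq_of_subset_of_card_le (fun x hx => ?_) (by omega)
    by_cases h : x = q
    · rwa [h]
    · exact hLM (Finset.mem_erase.2 ⟨h, hx⟩)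
  by_contra hqM
  obtain ⟨b, h1, h0, hconv⟩ := exists_barycentric (T.complex.indep hLf) hLc
  have hbl : ∀ x, b q x = l x := affineMap_ext_of_card (T.complex.indep hLf) hLc fun p hp => by
    by_cases h : p = q
    · rw [h, h1 q hq, hl1]
    · rw [h0 q hq p hp (Ne.symm h), hl0 p (Finset.mem_erase.2 ⟨h, hp⟩)]
  have hFne : (L.erase q).Nonempty := by
    rw [← Finset.card_pos, Finset.card_erase_of_mem hq]; omega
  obtain ⟨x, hx, hxpos, hx0⟩ := exists_pos_barycentric h1 h0 (Finset.erase_subset q L) hFne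
  have hlx : l x = 0 := by rw [← hbl]; exact hx0 q hq (by simp)
  -- points close to `x` on the segment from `x` to `r` lie in both simplices
  have hev : ∀ p ∈ L.erase q, ∀ᶠ t in 𝓝[>] (0 : ℝ), 0 < b p (x + t • (r - x)) := by
    intro p hp
    have hc : ContinuousAt (fun t : ℝ => b p (x + t • (r - x))) 0 := by
      simp only [affineMap_combo]; fun_prop
    have : 0 < b p (x + (0 : ℝ) • (r - x)) := by simpa using hxpos p hp
    exact (hc.eventually (lt_mem_nhds this)).filter_mono nhdsWithin_le_nhds
  have hlt1 : ∀ᶠ t in 𝓝[>] (0 : ℝ), t < 1 :=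
    (gt_mem_nhds zero_lt_one).filter_mono nhdsWithin_le_nhds
  obtain ⟨t, hpos, ht1, ht0⟩ := (((eventually_all_finset _).2 hev).and
    (hlt1.and self_mem_nhdsWithin)).exists
  have ht0' : (0 : ℝ) < t := ht0
  have hzl : l (x + t • (r - x)) = t * l r := by rw [affineMap_combo, hlx]; ring
  have hzL : x + t • (r - x) ∈ convexHull ℝ (L : Set (Pt d)) := by
    rw [hconv]
    intro p hp
    by_cases h : p = q
    · rw [h, hbl, hzl]; positivity
    · exact (hpos p (Finset.mem_erase.2 ⟨h, hp⟩)).le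
  have hzM : x + t • (r - x) ∈ convexHull ℝ (M : Set (Pt d)) :=
    (convex_convexHull ℝ _).add_smul_sub_mem (convexHull_mono (by exact_mod_cast hLM) hx)
      (subset_convexHull ℝ _ hr) ⟨ht0'.le, ht1.le⟩
  have hz := T.complex.inter_subset_convexHull hLf hMf ⟨hzL, hzM⟩
  have := affineMap_eq_zero_of_mem_convexHull l (fun p hp => hl0 p (Finset.mem_erase.2
    ⟨fun h => hqM (h ▸ hp.2), hp.1⟩)) hz
  rw [hzl] at this
  exact (mul_pos ht0' hlr).ne' this

theorem nonempty_interior_convexHull {K : Finset (Pt d)} (hK : K ∈ T.primal) :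
    (interior (convexHull ℝ (K : Set (Pt d)))).Nonempty := by
  obtain ⟨hKf, hKc⟩ := T.mem_primal.1 hK
  exact interior_convexHull_nonempty_iff_affineSpan_eq_top.2
    (affineSpan_eq_top_of_card (T.complex.indep hKf) hKc)

theorem convexHull_subset_closure {K : Finset (Pt d)} (hK : K ∈ T.primal) :
    convexHull ℝ (K : Set (Pt d)) ⊆ closure Ω := by
  obtain ⟨hKf, hKc⟩ := T.mem_primal.1 hK
  refine subset_closure.trans ?_
  rw [← (convex_convexHull ℝ (K : Set (Pt d))).closure_interior_eq_closure_of_nonempty_interior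
    (T.nonempty_interior_convexHull hK)]
  exact closure_mono (T.interior_subset K hKf hKc)

/-- A face that is not on the boundary has a simplex on its other side. -/
theorem exists_opposite (hd : 0 < d) (hΩ : IsOpen Ω) {K : Finset (Pt d)} (hK : K ∈ T.primal)
    {p : Pt d} (hp : p ∈ K) (hF : K.erase p ∉ T.primalBdry) :
    ∃ L ∈ T.primal, K ∩ L = K.erase p := by
  obtain ⟨hKf, hKc⟩ := T.mem_primal.1 hK
  obtain ⟨b, h1, h0, hconv⟩ := exists_barycentric (T.complex.indep hKf) hKc
  have hFc : (K.erase p).card = d := by rw [Finset.card_erase_of_mem hp, hKc]; rfl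
  have hFne : (K.erase p).Nonempty := by rw [← Finset.card_pos]; omega
  have hFf : K.erase p ∈ T.complex.faces :=
    T.complex.down_closed hKf (Finset.erase_subset p K) hFne
  have hFK : convexHull ℝ ((K.erase p : Finset (Pt d)) : Set (Pt d)) ⊆ convexHull ℝ (K : Set (Pt d)) :=
    convexHull_mono (by exact_mod_cast Finset.erase_subset p K)
  have hnot : ¬ convexHull ℝ ((K.erase p : Finset (Pt d)) : Set (Pt d)) ⊆ frontier Ω := fun h =>
    hF (T.mem_primalBdry.2 ⟨hFf, hFc, h⟩)
  obtain ⟨x, hx, hxf⟩ := not_subset.1 hnot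
  have hxΩ : x ∈ Ω := by
    by_contra hn
    refine hxf ?_
    rw [hΩ.frontier_eq]
    exact ⟨T.convexHull_subset_closure hK (hFK hx), hn⟩
  obtain ⟨y, hy, hypos, hy0⟩ := exists_pos_barycentric h1 h0 (Finset.erase_subset p K) hFne
  have hbF : ∀ z ∈ convexHull ℝ ((K.erase p : Finset (Pt d)) : Set (Pt d)), b p z = 0 := fun z hz =>
    affineMap_eq_zero_of_mem_convexHull (b p) (fun q hq => by
      have hq' := Finset.mem_erase.1 (Finset.mem_coe.1 hq)
      exact h0 p hp q hq'.2 (Ne.symm hq'.1)) hz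
  have hlt1 : ∀ᶠ t in 𝓝[>] (0 : ℝ), t < 1 :=
    (gt_mem_nhds zero_lt_one).filter_mono nhdsWithin_le_nhds
  have hcont : ∀ a v : Pt d, Tendsto (fun t : ℝ => a + t • v) (𝓝[>] 0) (𝓝 a) := by
    intro a v
    have : ContinuousAt (fun t : ℝ => a + t • v) 0 := by fun_prop
    simpa [ContinuousAt] using this.tendsto.mono_left (nhdsWithin_le_nhds (s := Ioi 0))
  -- a point of `Ω` in the relative interior of the face
  obtain ⟨s, hsΩ, hs1, hs0⟩ := (((hcont x (y - x)).eventually (hΩ.mem_nhds hxΩ)).and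
    (hlt1.and self_mem_nhdsWithin)).exists
  have hs0' : (0 : ℝ) < s := hs0
  set z := x + s • (y - x) with hz
  have hzF : z ∈ convexHull ℝ ((K.erase p : Finset (Pt d)) : Set (Pt d)) :=
    (convex_convexHull ℝ _).add_smul_sub_mem hx hy ⟨hs0'.le, hs1.le⟩
  have hzpos : ∀ q ∈ K.erase p, 0 < b q z := by
    intro q hq
    have hbx : 0 ≤ b q x := (hconv x).1 (hFK hx) q (Finset.mem_of_mem_erase hq)
    rw [hz, affineMap_combo]
    have := hypos q hq
    have h2 : 0 ≤ (1 - s) * b q x := mul_nonneg (by linarith) hbx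
    have h3 : 0 < s * b q y := mul_pos hs0' this
    linarith
  -- nearby points beyond the face belong to some other simplex
  have hspace : ∀ᶠ t in 𝓝[>] (0 : ℝ), ∃ L ∈ T.primal, z + t • (z - p) ∈ convexHull ℝ (L : Set (Pt d)) := by
    filter_upwards [(hcont z (z - p)).eventually (hΩ.mem_nhds hsΩ)] with t ht
    obtain ⟨f, hf, htf⟩ := T.complex.mem_space_iff.1 (T.subset_space ht)
    obtain ⟨L, hL, hfL, hLc⟩ := T.pure f hf
    exact ⟨L, T.mem_primal.2 ⟨hL, hLc⟩, convexHull_mono (by exact_mod_cast hfL) htf⟩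
  obtain ⟨L, hL, hfr⟩ : ∃ L ∈ T.primal, ∃ᶠ t in 𝓝[>] (0 : ℝ),
      z + t • (z - p) ∈ convexHull ℝ (L : Set (Pt d)) := by
    by_contra! hn
    obtain ⟨t, ⟨L, hL, h⟩, h'⟩ := (hspace.and ((eventually_all_finset _).2 hn)).exists
    exact h' L hL h
  obtain ⟨hLf, hLc⟩ := T.mem_primal.1 hL
  have hzL : z ∈ convexHull ℝ (L : Set (Pt d)) :=
    (L.finite_toSet.isClosed_convexHull (𝕜 := ℝ)).mem_of_frequently_of_tendsto hfr (hcont z (z - p))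
  have hne : L ≠ K := by
    rintro rfl
    obtain ⟨t, ht, ht0⟩ := (hfr.and_eventually self_mem_nhdsWithin).exists
    have ht0' : (0 : ℝ) < t := ht0
    have h2 := (hconv _).1 ht p hp
    have e : z + t • (z - p) = z + (-t) • (p - z) := by module
    rw [e, affineMap_combo, hbF z hzF, h1 p hp] at h2
    linarith
  have hz2 := T.complex.inter_subset_convexHull hKf hLf ⟨hFK hzF, hzL⟩
  have hsub : K.erase p ⊆ K ∩ L := by
    intro q hq
    have hqK := Finset.mem_of_mem_erase hq
    refine Finset.mem_inter.2 ⟨hqK, ?_⟩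
    by_contra hqL
    have := affineMap_eq_zero_of_mem_convexHull (b q) (fun r hr =>
      h0 q hqK r hr.1 fun h => hqL (h ▸ hr.2)) hz2
    exact (hzpos q hq).ne' this
  refine ⟨L, hL, (Finset.eq_of_subset_of_card_le hsub ?_).symm⟩
  rw [hFc]
  by_contra hn
  have h3 : K ∩ L = K := Finset.eq_of_subset_of_card_le Finset.inter_subset_left (by omega)
  exact hne (Finset.eq_of_subset_of_card_le (Finset.inter_eq_left.1 h3) (by omega)).symm

/-- Every face of a simplex separates it from a neighbour, which is the face itself if it is on the
boundary. -/
theorem exists_neighbour (hd : 0 < d) (hΩ : IsOpen Ω) {K : Finset (Pt d)} (hK : K ∈ T.primal)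
    {p : Pt d} (hp : p ∈ K) : ∃ L ∈ T.neighbours K, K ∩ L = K.erase p := by
  have hKc := (T.mem_primal.1 hK).2
  have hFc : (K.erase p).card = d := by rw [Finset.card_erase_of_mem hp, hKc]; rfl
  by_cases hF : K.erase p ∈ T.primalBdry
  · refine ⟨K.erase p, T.mem_neighbours.2 ⟨Or.inr hF, ?_, ?_, fun _ => Or.inr hF⟩, ?_⟩
    · exact fun h => by rw [h] at hFc; omega
    · rw [Finset.inter_eq_right.2 (Finset.erase_subset p K), hFc]
    · exact Finset.inter_eq_right.2 (Finset.erase_subset p K)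
  · obtain ⟨L, hL, hKL⟩ := T.exists_opposite hd hΩ hK hp hF
    refine ⟨L, T.mem_neighbours.2 ⟨Or.inl hL, ?_, by rw [hKL, hFc], fun h => absurd (hKL ▸ h) hF⟩, hKL⟩
    rintro rfl
    rw [Finset.inter_self] at hKL
    rw [← hKL] at hFc; omega

/-- The common face of a simplex and a neighbour omits exactly one vertex. -/
theorem exists_inter_eq_erase {K L : Finset (Pt d)} (hK : K ∈ T.primal) (hL : L ∈ T.neighbours K) :
    ∃ p ∈ K, K ∩ L = K.erase p := by
  have hKc := (T.mem_primal.1 hK).2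
  have hc := (T.mem_neighbours.1 hL).2.2.1
  have h1 : (K \ L).card = 1 := by
    have := Finset.card_inter_add_card_sdiff K L
    omega
  obtain ⟨p, hp⟩ := Finset.card_eq_one.1 h1
  have hpm : p ∈ K \ L := by rw [hp]; simp
  refine ⟨p, (Finset.mem_sdiff.1 hpm).1, ?_⟩
  rw [Finset.erase_eq, ← hp]
  ext x; simp

/-- The barycentric coordinate at a vertex is negative at the opposite vertex of the neighbour. -/
theorem barycentric_opposite_neg {K L : Finset (Pt d)} (hd : 0 < d) (hK : K ∈ T.primal)
    (hL : L ∈ T.primal) {p q : Pt d} (hp : p ∈ K) (hq : q ∈ L) (hKL : K ∩ L = K.erase p)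
    (hKL' : K ∩ L = L.erase q) {l : Pt d →ᵃ[ℝ] ℝ} (hl1 : l p = 1)
    (hl0 : ∀ f ∈ K.erase p, l f = 0) : l q < 0 := by
  have hne : K ≠ L := by
    rintro rfl
    rw [Finset.inter_self] at hKL
    exact (Finset.notMem_erase p K) (hKL ▸ hp)
  rcases lt_trichotomy (l q) 0 with h | h | h
  · exact h
  · -- otherwise the coordinate vanishes on `L`, hence everywhere
    obtain ⟨hLf, hLc⟩ := T.mem_primal.1 hL
    have := affineMap_ext_of_card (T.complex.indep hLf) hLc (l := l) (l' := 0) (fun r hr => by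
      by_cases hrq : r = q
      · rw [hrq, h]; rfl
      · rw [hl0 r (by rw [← hKL, hKL']; exact Finset.mem_erase.2 ⟨hrq, hr⟩)]; rfl) p
    rw [hl1] at this
    exact absurd this one_ne_zero
  · exact absurd (T.eq_of_same_side hd hK hL hp hq (by rw [← hKL]; exact Finset.inter_subset_right)
      hl1 hl0 h) hne

/-- A simplex has just one neighbour across each face. On boundary faces this rests on the
convention that these separate the simplices on their two sides. -/
theorem neighbour_unique (hd : 0 < d) {K L M : Finset (Pt d)} (hK : K ∈ T.primal)
    (hL : L ∈ T.neighbours K) (hM : M ∈ T.neighbours K) (h : K ∩ L = K ∩ M) : L = M := by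
  have hbd : ∀ B ∈ T.primalBdry, B ∈ T.neighbours K → K ∩ B = B := fun B hB hBK => by
    refine Finset.eq_of_subset_of_card_le Finset.inter_subset_right ?_
    rw [(T.mem_neighbours.1 hBK).2.2.1, (T.mem_primalBdry.1 hB).2.1]
  have hmix : ∀ B ∈ T.primalBdry, B ∈ T.neighbours K → ∀ N ∈ T.primal, N ∈ T.neighbours K →
      K ∩ B ≠ K ∩ N := by
    intro B hB hBK N hN hNK hBN
    rcases (T.mem_neighbours.1 hNK).2.2.2 (by rw [← hBN, hbd B hB hBK]; exact hB) with h | h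
    · exact T.notMem_primalBdry_of_primal hK h
    · exact T.notMem_primalBdry_of_primal hN h
  rcases (T.mem_neighbours.1 hL).1 with hL' | hL' <;> rcases (T.mem_neighbours.1 hM).1 with hM' | hM'
  · obtain ⟨p, hp, hKp⟩ := T.exists_inter_eq_erase hK hL
    obtain ⟨q, hq, hLq⟩ := T.exists_inter_eq_erase hL' (T.neighbours_symm (T.mem_primalBar.2 (Or.inl hK)) hL)
    obtain ⟨r, hr, hMr⟩ := T.exists_inter_eq_erase hM' (T.neighbours_symm (T.mem_primalBar.2 (Or.inl hK)) hM)
    rw [Finset.inter_comm] at hLq hMr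
    obtain ⟨b, h1, h0, -⟩ := exists_barycentric (T.complex.indep (T.mem_primal.1 hK).1) (T.mem_primal.1 hK).2
    have hb0 : ∀ f ∈ K.erase p, b p f = 0 := fun f hf =>
      h0 p hp f (Finset.mem_of_mem_erase hf) (Finset.ne_of_mem_erase hf).symm
    have hnq := T.barycentric_opposite_neg hd hK hL' hp hq hKp hLq (h1 p hp) hb0
    have hnr := T.barycentric_opposite_neg hd hK hM' hp hr (h ▸ hKp) hMr (h1 p hp) hb0
    refine T.eq_of_same_side hd hL' hM' hq hr ?_ (l := (b p q)⁻¹ • b p) ?_ (fun f hf => ?_) ?_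
    · rw [← hLq, h]; exact Finset.inter_subset_right
    · simp [hnq.ne]
    · have : f ∈ K.erase p := by rw [← hKp, hLq]; exact hf
      simp [hb0 f this]
    · simpa using mul_pos_of_neg_of_neg (inv_lt_zero.2 hnq) hnr
  · exact absurd h.symm (hmix M hM' hM L hL' hL)
  · exact absurd h (hmix L hL' hL M hM' hM)
  · rw [← hbd L hL' hL, ← hbd M hM' hM, h]

end SimplicialMesh

/-! ### The primal interfaces around a simplex -/

theorem inner_unitVec {d : ℕ} (x y z : Pt d) :
    inner ℝ (unitVec x y) z = (dist x y)⁻¹ * inner ℝ (y - x) z := by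
  rw [unitVec, real_inner_smul_left]

theorem norm_unitVec {d : ℕ} {x y : Pt d} (h : x ≠ y) : ‖unitVec x y‖ = 1 := by
  have : 0 < dist x y := dist_pos.2 h
  rw [unitVec, norm_smul, norm_inv, Real.norm_eq_abs, abs_of_pos this, ← dist_eq_norm, dist_comm y x]
  exact inv_mul_cancel₀ this.ne'

theorem unitVec_comm {d : ℕ} (x y : Pt d) : unitVec y x = -unitVec x y := by
  rw [unitVec, unitVec, dist_comm, ← smul_neg, neg_sub]

theorem dist_smul_unitVec {d : ℕ} (x y : Pt d) : dist x y • unitVec x y = y - x := by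
  by_cases h : x = y
  · simp [h]
  · rw [unitVec, smul_smul, mul_inv_cancel₀ (dist_pos.2 h).ne', one_smul]

namespace SimplicialMesh

variable {d : ℕ} {Ω : Set (Pt d)} (T : SimplicialMesh Ω)

theorem mem_faces_of_mem_primalBar {K : Finset (Pt d)} (hK : K ∈ T.primalBar) :
    K ∈ T.complex.faces := by
  rcases T.mem_primalBar.1 hK with h | h
  · exact (T.mem_primal.1 h).1
  · exact (T.mem_primalBdry.1 h).1

theorem dist_center_eq {K : Finset (Pt d)} (hK : K ∈ T.complex.faces) {p q : Pt d} (hp : p ∈ K)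
    (hq : q ∈ K) : dist p (center K) = dist q (center K) :=
  (center_spec (T.complex.indep hK) ⟨p, hp⟩).2 p hp q hq

/-- The line through two centres is orthogonal to the common face. -/
theorem inner_center_sub_center {K L : Finset (Pt d)} (hK : K ∈ T.complex.faces)
    (hL : L ∈ T.complex.faces) {f g : Pt d} (hf : f ∈ K ∩ L) (hg : g ∈ K ∩ L) :
    inner ℝ (center L - center K) (f - g) = 0 := by
  rw [Finset.mem_inter] at hf hg
  have := dist_sq_sub f g (center K) (center L)
  rw [T.dist_center_eq hK hf.1 hg.1, T.dist_center_eq hL hf.2 hg.2] at this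
  linarith

/-- The neighbours of a simplex are in bijection with its vertices: every vertex has a neighbour
opposite to it. -/
theorem exists_neighbour_opposite (hd : 0 < d) (hΩ : IsOpen Ω) {K : Finset (Pt d)}
    (hK : K ∈ T.primal) : ∃ N : Pt d → Finset (Pt d),
      (∀ p ∈ K, N p ∈ T.neighbours K ∧ K ∩ N p = K.erase p) ∧
      ∀ {E : Type} [AddCommMonoid E] (h : Finset (Pt d) → E),
        ∑ L ∈ T.neighbours K, h L = ∑ p ∈ K, h (N p) := by
  have hex : ∀ p : Pt d, ∃ L, p ∈ K → L ∈ T.neighbours K ∧ K ∩ L = K.erase p := fun p => by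
    by_cases hp : p ∈ K
    · obtain ⟨L, h⟩ := T.exists_neighbour hd hΩ hK hp
      exact ⟨L, fun _ => h⟩
    · exact ⟨∅, fun h => absurd h hp⟩
  choose N hN using hex
  refine ⟨N, hN, fun h => ?_⟩
  symm
  refine Finset.sum_bij (fun p _ => N p) (fun p hp => (hN p hp).1) (fun p hp q hq h => ?_)
    (fun L hL => ?_) fun p _ => rfl
  · have h1 := (hN p hp).2
    rw [h, (hN q hq).2] at h1
    by_contra hne
    have : p ∈ K.erase p := h1 ▸ Finset.mem_erase.2 ⟨hne, hp⟩
    simp at this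
  · obtain ⟨p, hp, hKL⟩ := T.exists_inter_eq_erase hK hL
    exact ⟨p, hp, T.neighbour_unique hd hK (hN p hp).1 hL ((hN p hp).2.trans hKL.symm)⟩

end SimplicialMesh

namespace DoubleMesh

variable {d : ℕ} {Ω : Set (Pt d)} (T : DoubleMesh Ω)

/-- By the strict Delaunay condition, the vector from `x_K` to `x_L` points to the side of `L`. -/
theorem inner_center_sub_pos {K L : Finset (Pt d)} (hK : K ∈ T.primal) (hL : L ∈ T.primal)
    (hKL : L ∈ T.neighbours K) {q f : Pt d} (hq : q ∈ L \ K) (hf : f ∈ K ∩ L) :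
    0 < inner ℝ (center L - center K) (q - f) := by
  rw [Finset.mem_inter] at hf
  have h1 := T.delaunay K hK L hL hKL q hq f hf.1
  have := dist_sq_sub q f (center K) (center L)
  rw [T.dist_center_eq (T.mem_primal.1 hL).1 (Finset.mem_sdiff.1 hq).1 hf.2] at this
  have h2 : dist f (center K) ^ 2 < dist q (center K) ^ 2 := by
    have := dist_nonneg (x := f) (y := center K)
    nlinarith
  linarith

/-- The vector from `x_K` to `x_L` points away from `K`, also if `L` is on the boundary. -/
theorem inner_center_sub_neg {K L : Finset (Pt d)} (hK : K ∈ T.primal)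
    (hL : L ∈ T.neighbours K) {p f : Pt d} (hKL : K ∩ L = K.erase p) (hp : p ∈ K)
    (hf : f ∈ K.erase p) : inner ℝ (center L - center K) (p - f) < 0 := by
  rcases (T.mem_neighbours.1 hL).1 with hL' | hL'
  · have h1 := T.inner_center_sub_pos hL' hK
      (T.neighbours_symm (T.mem_primalBar.2 (Or.inl hK)) hL) (q := p) (f := f)
      (Finset.mem_sdiff.2 ⟨hp, fun h => by
        have : p ∈ K.erase p := hKL ▸ Finset.mem_inter.2 ⟨hp, h⟩
        simp at this⟩) (by rw [Finset.inter_comm, hKL]; exact hf)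
    rw [← neg_sub, inner_neg_left]; linarith
  · have hLe : L = K.erase p := by
      rw [← hKL]
      refine (Finset.eq_of_subset_of_card_le Finset.inter_subset_right ?_).symm
      rw [(T.mem_neighbours.1 hL).2.2.1, (T.mem_primalBdry.1 hL').2.1]
    have h1 := T.delaunay_bdry K hK L hL' (hLe ▸ Finset.erase_subset p K) p
      (by rw [hLe]; simp [hp])
    have hLf := (T.mem_primalBdry.1 hL').1
    have h2 := inner_eq_zero_of_mem_affineSpan (F := (L : Set (Pt d))) (n := center L - center K)
      (f := f) (fun q hq => by
        have hqL : q ∈ L := hq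
        refine T.inner_center_sub_center (T.mem_primal.1 hK).1 hLf ?_ ?_
        · rw [hKL, ← hLe]; exact hqL
        · rw [hKL]; exact hf)
      (center_spec (T.complex.indep hLf) (T.complex.nonempty_of_mem_faces hLf)).1
    have e : p - f = (p - center L) + (center L - f) := by abel
    rw [e, inner_add_right, h2, add_zero, real_inner_comm, ← neg_sub (center K), inner_neg_right]
    linarith

theorem center_ne_center {K L : Finset (Pt d)} (hd : 0 < d) (hK : K ∈ T.primal)
    (hL : L ∈ T.neighbours K) : center K ≠ center L := by
  obtain ⟨p, hp, hKL⟩ := T.exists_inter_eq_erase hK hL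
  have hne : (K.erase p).Nonempty := by
    rw [← Finset.card_pos, Finset.card_erase_of_mem hp, (T.mem_primal.1 hK).2]; omega
  obtain ⟨f, hf⟩ := hne
  have := T.inner_center_sub_neg hK hL hKL hp hf
  intro h
  rw [h, sub_self, inner_zero_left] at this
  exact lt_irrefl _ this

/-- The component of the weighted normal along an edge of the simplex does not depend on the face,
as the measure of a face times the height over it is a multiple of the volume of the simplex. -/
theorem interfaceMeasure_mul_height {K L : Finset (Pt d)} (hd : 0 < d) (hK : K ∈ T.primal)
    (hL : L ∈ T.neighbours K) {p f : Pt d} (hKL : K ∩ L = K.erase p) (hp : p ∈ K)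
    (hf : f ∈ K.erase p) : SimplicialMesh.interfaceMeasure K L *
      inner ℝ (SimplicialMesh.normal K L) (p - f) =
      -(pyramidRatio (d - 1) * volume.real (convexHull ℝ (K : Set (Pt d)))) := by
  obtain ⟨m, rfl⟩ : ∃ m, d = m + 1 := ⟨d - 1, by omega⟩
  have hpos : 0 < dist (center K) (center L) := dist_pos.2 (T.center_ne_center hd hK hL)
  have h := faceMeasure_mul_height (F := K.erase p) (f := f) (n := SimplicialMesh.normal K L)
    (by rw [Finset.card_erase_of_mem hp, (T.mem_primal.1 hK).2]; rfl) hf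
    (norm_unitVec (T.center_ne_center hd hK hL)) (fun q hq => by
      rw [SimplicialMesh.normal, inner_unitVec, T.inner_center_sub_center (T.mem_primal.1 hK).1
        (T.mem_faces_of_mem_primalBar (T.mem_primalBar_of_neighbours hL)) (by rwa [hKL])
        (by rwa [hKL]), mul_zero]) p
  rw [← Finset.coe_insert, Finset.insert_erase hp, abs_of_neg] at h
  · rw [SimplicialMesh.interfaceMeasure, hKL, Nat.add_sub_cancel, ← h]; ring
  · rw [SimplicialMesh.normal, inner_unitVec]
    exact mul_neg_of_pos_of_neg (inv_pos.2 hpos) (T.inner_center_sub_neg hK hL hKL hp hf)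

/-- The outward normals of a simplex, weighted by the measures of the faces, sum up to zero: their
sum is orthogonal to all edges `p q`, as only the faces opposite to `p` and `q` contribute, with
opposite values. -/
theorem sum_interfaceMeasure_smul_normal (hd : 1 < d) (hΩ : IsOpen Ω) {K : Finset (Pt d)}
    (hK : K ∈ T.primal) :
    ∑ L ∈ T.neighbours K, SimplicialMesh.interfaceMeasure K L • SimplicialMesh.normal K L = 0 := by
  have hd0 : 0 < d := by omega
  obtain ⟨hKf, hKc⟩ := T.mem_primal.1 hK
  obtain ⟨N, hN, hNsum⟩ := T.exists_neighbour_opposite hd0 hΩ hK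
  set V : Pt d → Pt d := fun p =>
    SimplicialMesh.interfaceMeasure K (N p) • SimplicialMesh.normal K (N p) with hV
  have hsum : ∑ L ∈ T.neighbours K, SimplicialMesh.interfaceMeasure K L • SimplicialMesh.normal K L =
      ∑ p ∈ K, V p := hNsum _
  have hV1 : ∀ p ∈ K, ∀ f ∈ K.erase p, inner ℝ (V p) (p - f) =
      -(pyramidRatio (d - 1) * volume.real (convexHull ℝ (K : Set (Pt d)))) := fun p hp f hf => by
    rw [hV, real_inner_smul_left]
    exact T.interfaceMeasure_mul_height hd0 hK (hN p hp).1 (hN p hp).2 hp hf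
  have hV0 : ∀ p ∈ K, ∀ f ∈ K.erase p, ∀ g ∈ K.erase p, inner ℝ (V p) (f - g) = 0 := by
    intro p hp f hf g hg
    rw [hV, real_inner_smul_left, SimplicialMesh.normal, inner_unitVec, T.inner_center_sub_center hKf
        (T.mem_faces_of_mem_primalBar (T.mem_primalBar_of_neighbours (hN p hp).1))
        (by rwa [(hN p hp).2]) (by rwa [(hN p hp).2]), mul_zero, mul_zero]
  have hperp : ∀ p ∈ K, ∀ q ∈ K, inner ℝ (∑ r ∈ K, V r) (q - p) = 0 := by
    intro p hp q hq
    by_cases hpq : p = q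
    · simp [hpq]
    rw [sum_inner, ← Finset.add_sum_erase _ _ hp,
      ← Finset.add_sum_erase _ _ (Finset.mem_erase.2 ⟨Ne.symm hpq, hq⟩), Finset.sum_eq_zero, add_zero]
    · rw [hV1 q hq p (Finset.mem_erase.2 ⟨hpq, hp⟩), ← neg_sub p q, inner_neg_right,
        hV1 p hp q (Finset.mem_erase.2 ⟨Ne.symm hpq, hq⟩)]
      ring
    · intro r hr
      obtain ⟨hrq, hr'⟩ := Finset.mem_erase.1 hr
      obtain ⟨hrp, hrK⟩ := Finset.mem_erase.1 hr'
      exact hV0 r hrK q (Finset.mem_erase.2 ⟨Ne.symm hrq, hq⟩) p (Finset.mem_erase.2 ⟨Ne.symm hrp, hp⟩)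
  obtain ⟨p, hp⟩ := T.complex.nonempty_of_mem_faces hKf
  have h := inner_eq_zero_of_mem_affineSpan (F := (K : Set (Pt d))) (f := p)
    (fun q hq => hperp p hp q hq) (x := p + ∑ r ∈ K, V r) (by
      rw [affineSpan_eq_top_of_card (T.complex.indep hKf) hKc]; trivial)
  rw [add_sub_cancel_left, inner_self_eq_zero] at h
  rw [hsum, h]

end DoubleMesh

namespace SimplicialMesh

variable {d : ℕ} {Ω : Set (Pt d)} (T : SimplicialMesh Ω)

/-! ### Control volumes have positive measure -/

theorem volume_cell_pos {K : Finset (Pt d)} (hK : K ∈ T.primal) : 0 < volume.real (cell K) := by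
  have h1 : (interior (cell K)).Nonempty := by
    refine (T.nonempty_interior_convexHull hK).mono ?_
    exact interior_maximal interior_subset_intrinsicInterior isOpen_interior
  refine ENNReal.toReal_pos (Measure.measure_pos_of_nonempty_interior _ h1).ne' ?_
  refine ((measure_mono intrinsicInterior_subset).trans_lt ?_).ne
  exact (K.finite_toSet.isCompact_convexHull (𝕜 := ℝ)).measure_lt_top

theorem edist_le_pathDist (X : Set (Pt d)) (x y : Pt d) : edist x y ≤ pathDist X x y := by
  refine le_iInf₂ fun γ hγ => ?_
  rw [← hγ.2.1, ← hγ.2.2.1]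
  exact eVariationOn.edist_le γ (by simp) (by simp)

theorem pathDist_le_edist {X : Set (Pt d)} {x y : Pt d} (h : segment ℝ x y ⊆ X) :
    pathDist X x y ≤ edist x y := by
  have hc : ContinuousOn (AffineMap.lineMap x y : ℝ → Pt d) (Icc 0 1) :=
    AffineMap.lineMap_continuous.continuousOn
  have hm : MapsTo (AffineMap.lineMap x y : ℝ → Pt d) (Icc 0 1) X := by
    intro t ht
    refine h ?_
    rw [segment_eq_image_lineMap]
    exact mem_image_of_mem _ ht
  refine (iInf₂_le (AffineMap.lineMap x y : ℝ → Pt d) ⟨hc, by simp, by simp, hm⟩).trans ?_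
  have h1 := ((lipschitzWith_lineMap (𝕜 := ℝ) x y).lipschitzOnWith
    (s := univ)).comp_eVariationOn_le (s := Icc (0 : ℝ) 1) (g := (id : ℝ → ℝ)) (mapsTo_univ _ _)
  have h2 : eVariationOn (id : ℝ → ℝ) (Icc 0 1) = 1 := by simp
  rw [Function.comp_id, h2, mul_one] at h1
  rwa [edist_nndist]

/-- The path distance agrees with the Euclidean one near `v`, so that the dual cell contains a
ball. -/
theorem volume_dualCell_pos (hΩ : IsOpen Ω) (hΩb : Bornology.IsBounded Ω) {v : Pt d}
    (hv : v ∈ Ω) : 0 < volume.real (T.dualCell v) := by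
  have hnear : ∀ᶠ x in 𝓝 v, ∀ w ∈ T.vertices, w ≠ v → dist x v < dist x w := by
    refine (eventually_all_finset _).2 fun w _ => ?_
    by_cases h : w = v
    · simp [h]
    · have : ∀ᶠ x in 𝓝 v, dist x v < dist x w :=
        (continuous_id.dist continuous_const).continuousAt.eventually_lt
          (continuous_id.dist continuous_const).continuousAt (by simpa using Ne.symm h)
      exact this.mono fun x hx _ => hx
  obtain ⟨r, hr, hball⟩ := Metric.mem_nhds_iff.1 ((hΩ.mem_nhds hv))
  obtain ⟨s, hs, hsub⟩ := Metric.mem_nhds_iff.1 hnear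
  have hsubset : Metric.ball v (min r s) ⊆ T.dualCell v := by
    intro x hx
    have hxr : x ∈ Metric.ball v r := Metric.ball_subset_ball (min_le_left _ _) hx
    refine ⟨hball hxr, fun w hw hwv => ?_⟩
    have h1 := hsub (Metric.ball_subset_ball (min_le_right _ _) hx) w hw hwv
    calc pathDist (closure Ω) x v ≤ edist x v := pathDist_le_edist
          ((((convex_ball v r).segment_subset hxr (Metric.mem_ball_self hr)).trans hball).trans
            subset_closure)
      _ < edist x w := by
          rw [edist_dist, edist_dist]
          exact (ENNReal.ofReal_lt_ofReal_iff (dist_nonneg.trans_lt h1)).2 h1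
      _ ≤ _ := edist_le_pathDist _ _ _
  refine ENNReal.toReal_pos ?_ ?_
  · exact ((Metric.measure_ball_pos volume v (lt_min hr hs)).trans_le (measure_mono hsubset)).ne'
  · exact ((measure_mono fun x hx => hx.1).trans_lt hΩb.measure_lt_top).ne

theorem size_nonneg : 0 ≤ T.size := by
  refine Real.sSup_nonneg ?_
  rintro _ ((⟨K, -, rfl⟩ | ⟨v, -, rfl⟩) | ⟨D, -, rfl⟩) <;> exact Metric.diam_nonneg

end SimplicialMesh

/-! ### Sums over diamonds -/

theorem mk_out {α : Type*} (D : Sym2 α) : s((Quot.out D).1, (Quot.out D).2) = D := Quot.out_eq D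

/-- A sum over a symmetric irreflexive set of ordered pairs as a sum over unordered pairs. -/
theorem sum_pairs_eq_sum_sym2 {α : Type*} (P : Finset (α × α)) (E : Finset (Sym2 α))
    (hP : ∀ a b, (a, b) ∈ P ↔ s(a, b) ∈ E) (hne : ∀ a b, (a, b) ∈ P → a ≠ b) (h : α → α → ℝ) :
    ∑ p ∈ P, h p.1 p.2 =
      ∑ D ∈ E, (h (Quot.out D).1 (Quot.out D).2 + h (Quot.out D).2 (Quot.out D).1) := by
  rw [← Finset.sum_fiberwise_of_maps_to (t := E) (g := fun p : α × α => s(p.1, p.2))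
    (fun p hp => (hP p.1 p.2).1 hp)]
  refine Finset.sum_congr rfl fun D hD => ?_
  have hD' : s((Quot.out D).1, (Quot.out D).2) ∈ E := by rwa [mk_out]
  have hmem := (hP _ _).2 hD'
  have hne' := hne _ _ hmem
  have hset : P.filter (fun p => s(p.1, p.2) = D) =
      {((Quot.out D).1, (Quot.out D).2), ((Quot.out D).2, (Quot.out D).1)} := by
    ext ⟨a, b⟩
    simp only [Finset.mem_filter, Finset.mem_insert, Finset.mem_singleton, Prod.mk.injEq]
    constructor
    · rintro ⟨-, h⟩
      rw [← mk_out D] at h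
      exact Sym2.eq_iff.1 h
    · intro h
      have : s(a, b) = D := by
        rw [← mk_out D]; exact Sym2.eq_iff.2 h
      exact ⟨(hP a b).2 (this ▸ hD), this⟩
  rw [hset, Finset.sum_pair]
  intro heq
  exact hne' (Prod.mk.inj heq).1

namespace SimplicialMesh

theorem mem_edges {d : ℕ} {F : Finset (Pt d)} {a b : Pt d} :
    s(a, b) ∈ edges F ↔ a ∈ F ∧ b ∈ F ∧ a ≠ b := by
  simp [edges, and_assoc]

theorem out_mem_edges {d : ℕ} {F : Finset (Pt d)} {e : Sym2 (Pt d)} (he : e ∈ edges F) :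
    (Quot.out e).1 ∈ F ∧ (Quot.out e).2 ∈ F ∧ (Quot.out e).1 ≠ (Quot.out e).2 :=
  mem_edges.1 (by rwa [mk_out])

variable {d : ℕ} {Ω : Set (Pt d)} (T : SimplicialMesh Ω)

theorem mem_diamonds {K L : Finset (Pt d)} :
    s(K, L) ∈ T.diamonds ↔ K ∈ T.primalBar ∧ L ∈ T.neighbours K := by
  simp only [diamonds, Finset.mem_filter, Finset.mk_mem_sym2_iff]
  constructor
  · rintro ⟨⟨hK, hL⟩, K', L', h, hL'⟩
    rcases Sym2.eq_iff.1 h with ⟨rfl, rfl⟩ | ⟨rfl, rfl⟩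
    · exact ⟨hK, hL'⟩
    · exact ⟨hK, T.neighbours_symm hL hL'⟩
  · rintro ⟨hK, hL⟩
    exact ⟨⟨hK, T.mem_primalBar_of_neighbours hL⟩, K, L, rfl, hL⟩

theorem out_mem_diamonds {D : Sym2 (Finset (Pt d))} (hD : D ∈ T.diamonds) :
    diaK D ∈ T.primalBar ∧ diaL D ∈ T.neighbours (diaK D) :=
  T.mem_diamonds.1 (by rw [diaK, diaL, mk_out]; exact hD)

theorem card_diaFace {D : Sym2 (Finset (Pt d))} (hD : D ∈ T.diamonds) : (diaFace D).card = d :=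
  (T.mem_neighbours.1 (T.out_mem_diamonds hD).2).2.2.1

theorem diaFace_subset_primal {D : Sym2 (Finset (Pt d))} (hD : D ∈ T.diamonds) :
    ∃ K ∈ T.primal, diaFace D ⊆ K := by
  obtain ⟨hK, hL⟩ := T.out_mem_diamonds hD
  rcases T.mem_primalBar.1 hK with h | h
  · exact ⟨_, h, Finset.inter_subset_left⟩
  · rcases (T.mem_neighbours.1 hL).1 with h' | h'
    · exact ⟨_, h', Finset.inter_subset_right⟩
    · -- two boundary faces are not neighbours
      exfalso
      obtain ⟨h1, h2, h3, -⟩ := T.mem_neighbours.1 hL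
      have e1 := Finset.eq_of_subset_of_card_le (Finset.inter_subset_left (s₁ := diaK D) (s₂ := diaL D))
        (by rw [h3, (T.mem_primalBdry.1 h).2.1])
      have e2 := Finset.eq_of_subset_of_card_le (Finset.inter_subset_right (s₁ := diaK D) (s₂ := diaL D))
        (by rw [h3, (T.mem_primalBdry.1 h').2.1])
      exact h2 (e2.symm.trans e1)

theorem mem_vertices_of_mem_diaFace {D : Sym2 (Finset (Pt d))} (hD : D ∈ T.diamonds) {v : Pt d}
    (hv : v ∈ diaFace D) : v ∈ T.vertices := by
  obtain ⟨K, hK, hDK⟩ := T.diaFace_subset_primal hD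
  exact Finset.mem_biUnion.2 ⟨K, hK, hDK hv⟩

theorem mem_dualNeighbours_of_mem_diaFace {D : Sym2 (Finset (Pt d))} (hD : D ∈ T.diamonds)
    {v w : Pt d} (hv : v ∈ diaFace D) (hw : w ∈ diaFace D) (hvw : v ≠ w) :
    w ∈ T.dualNeighbours v := by
  obtain ⟨K, hK, hDK⟩ := T.diaFace_subset_primal hD
  refine Finset.mem_filter.2 ⟨T.mem_vertices_of_mem_diaFace hD hw, hvw.symm, ?_⟩
  refine T.complex.down_closed (T.mem_primal.1 hK).1 ?_ ⟨v, by simp⟩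
  intro x hx
  rcases Finset.mem_insert.1 hx with rfl | h
  · exact hDK hv
  · exact hDK (Finset.mem_singleton.1 h ▸ hw)

theorem sum_neighbours_eq_sum_diamonds (h : Finset (Pt d) → Finset (Pt d) → ℝ) :
    ∑ K ∈ T.primalBar, ∑ L ∈ T.neighbours K, h K L =
      ∑ D ∈ T.diamonds, (h (diaK D) (diaL D) + h (diaL D) (diaK D)) := by
  rw [Finset.sum_sigma']
  refine Eq.trans ?_ (sum_pairs_eq_sum_sym2
    ((T.primalBar ×ˢ T.primalBar).filter fun p => p.2 ∈ T.neighbours p.1) T.diamonds ?_ ?_ h)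
  · refine Finset.sum_bij' (fun x _ => (x.1, x.2)) (fun p _ => ⟨p.1, p.2⟩) ?_ ?_ ?_ ?_ ?_
    · rintro ⟨K, L⟩ h
      obtain ⟨hK, hL⟩ := Finset.mem_sigma.1 h
      exact Finset.mem_filter.2 ⟨Finset.mem_product.2 ⟨hK, T.mem_primalBar_of_neighbours hL⟩, hL⟩
    · rintro ⟨K, L⟩ h
      obtain ⟨h1, h2⟩ := Finset.mem_filter.1 h
      exact Finset.mem_sigma.2 ⟨(Finset.mem_product.1 h1).1, h2⟩
    · intros; rfl
    · intros; rfl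
    · intros; rfl
  · intro K L
    rw [T.mem_diamonds, Finset.mem_filter, Finset.mem_product]
    exact ⟨fun h => ⟨h.1.1, h.2⟩, fun h => ⟨⟨h.1, T.mem_primalBar_of_neighbours h.2⟩, h.2⟩⟩
  · intro K L h
    exact (T.mem_neighbours.1 (Finset.mem_filter.1 h).2).2.1.symm

theorem sum_dualNeighbours_eq_sum_offDiag (h : Sym2 (Finset (Pt d)) → Pt d → Pt d → ℝ) :
    ∑ v ∈ T.vertices, ∑ w ∈ T.dualNeighbours v, ∑ D ∈ T.diamondsAt v w, h D v w =
      ∑ D ∈ T.diamonds, ∑ p ∈ (diaFace D).offDiag, h D p.1 p.2 := by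
  simp only [Finset.sum_sigma']
  refine Finset.sum_bij' (fun x _ => ⟨x.2.2, (x.1, x.2.1)⟩) (fun y _ => ⟨y.2.1, y.2.2, y.1⟩)
    ?_ ?_ ?_ ?_ ?_
  · rintro ⟨v, w, D⟩ h
    simp only [Finset.mem_sigma, diamondsAt, dualNeighbours, Finset.mem_filter] at h
    simp only [Finset.mem_sigma, Finset.mem_offDiag]
    exact ⟨h.2.2.1, h.2.2.2.1, h.2.2.2.2, h.2.1.2.1.symm⟩
  · rintro ⟨D, v, w⟩ h
    simp only [Finset.mem_sigma, Finset.mem_offDiag] at h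
    simp only [Finset.mem_sigma]
    exact ⟨T.mem_vertices_of_mem_diaFace h.1 h.2.1,
      T.mem_dualNeighbours_of_mem_diaFace h.1 h.2.1 h.2.2.1 h.2.2.2,
      Finset.mem_filter.2 ⟨h.1, h.2.1, h.2.2.1⟩⟩
  · intros; rfl
  · intros; rfl
  · intros; rfl

theorem sum_offDiag_eq_sum_edges (F : Finset (Pt d)) (h : Pt d → Pt d → ℝ) :
    ∑ p ∈ F.offDiag, h p.1 p.2 = ∑ e ∈ edges F,
      (h (Quot.out e).1 (Quot.out e).2 + h (Quot.out e).2 (Quot.out e).1) :=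
  sum_pairs_eq_sum_sym2 _ _ (fun a b => by rw [mem_edges, Finset.mem_offDiag])
    (fun a b h => (Finset.mem_offDiag.1 h).2.2) h

theorem sigmaStarMeasure_comm (D : Sym2 (Finset (Pt d))) (a b : Pt d) :
    sigmaStarMeasure D a b = sigmaStarMeasure D b a := by
  rw [sigmaStarMeasure, sigmaStarMeasure, midpoint_comm]

end SimplicialMesh

/-! ### Measures of the pieces of a diamond -/

theorem vdet_two (x y : Pt 2) : vdet ![x, y] = x 0 * y 1 - x 1 * y 0 := by
  simp [vdet, Matrix.det_fin_two]

theorem vdet_three (x y z : Pt 3) : vdet ![x, y, z] =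
    x 0 * y 1 * z 2 - x 0 * y 2 * z 1 - x 1 * y 0 * z 2 + x 1 * y 2 * z 0 + x 2 * y 0 * z 1
      - x 2 * y 1 * z 0 := by
  simp [vdet, Matrix.det_fin_three]

theorem convexHull_insert_pair_eq {d : ℕ} (p x y : Pt d) :
    convexHull ℝ {p, x, y} = simplexAt p ![x - p, y - p] := by
  rw [simplexAt]
  congr 2
  ext z
  simp [eq_comm]

theorem convexHull_insert_triple_eq {d : ℕ} (p x y z : Pt d) :
    convexHull ℝ {p, x, y, z} = simplexAt p ![x - p, y - p, z - p] := by
  rw [simplexAt]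
  congr 2
  ext z
  simp [Fin.exists_fin_succ, eq_comm]

/-- `faceMeasure` of a segment is a multiple of its length; the factor need not be known. -/
theorem exists_faceMeasure_segment : ∃ c : ℝ, 0 ≤ c ∧ ∀ x y : Pt 2,
    faceMeasure (segment ℝ x y) = c * dist x y := by
  refine ⟨_, NNReal.coe_nonneg (Measure.addHaarScalarFactor (volume : Measure (Pt 1))
    (Measure.hausdorffMeasure (1 : ℕ))), fun x y => ?_⟩
  have h : (Measure.hausdorffMeasure ((2 - 1 : ℕ) : ℝ) : Measure (Pt 2)) (segment ℝ x y) =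
      edist x y := by
    rw [show ((2 - 1 : ℕ) : ℝ) = 1 by norm_num]
    exact hausdorffMeasure_segment x y
  rw [faceMeasure, Measure.euclideanHausdorffMeasure_def, Measure.smul_apply, h, ENNReal.smul_def,
    smul_eq_mul, ENNReal.toReal_mul, edist_dist, ENNReal.toReal_ofReal dist_nonneg]
  rfl

/-- The centre of an edge lies on it, so that `σ_S` is the whole edge in the plane. -/
theorem center_pair {d : ℕ} {a b : Pt d} (hF : AffineIndependent ℝ
    ((↑) : ({a, b} : Finset (Pt d)) → Pt d)) : center {a, b} ∈ segment ℝ a b := by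
  obtain ⟨h1, h2⟩ := center_spec hF ⟨a, by simp⟩
  have h3 := h2 a (by simp) b (by simp)
  rw [Finset.coe_pair] at h1
  obtain ⟨t, ht⟩ := mem_affineSpan_pair_iff_exists_lineMap_eq.1 h1
  rw [← ht, dist_left_lineMap, dist_right_lineMap] at h3
  rw [← ht]
  by_cases hab : a = b
  · subst hab; simp
  have h4 : ‖t‖ = ‖1 - t‖ := mul_right_cancel₀ (dist_pos.2 hab).ne' h3
  rw [Real.norm_eq_abs, Real.norm_eq_abs, abs_eq_abs] at h4
  have h5 : t = 1 / 2 := by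
    rcases h4 with h | h <;> linarith
  rw [segment_eq_image_lineMap]
  exact ⟨t, ⟨by rw [h5]; norm_num, by rw [h5]; norm_num⟩, rfl⟩

/-- Two vectors that are orthogonal to a plane of the three-dimensional space, and one of that
plane, are dependent. -/
theorem vdet_eq_zero_of_orthogonal_plane {F : Finset (Pt 3)}
    (hF : AffineIndependent ℝ ((↑) : F → Pt 3)) {a b z : Pt 3} (ha : a ∈ F) (hb : b ∈ F)
    (hz : z ∈ F) (hab : a ≠ b) (hza : z ≠ a) (hzb : z ≠ b) {x y : Pt 3}
    (hx : ∀ f ∈ F, ∀ g ∈ F, inner ℝ x (f - g) = 0) (hy : ∀ f ∈ F, ∀ g ∈ F, inner ℝ y (f - g) = 0) :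
    vdet ![x, b - a, y] = 0 := by
  let s : ℝ := inner ℝ (b - a) (z - a)
  let r : ℝ := inner ℝ (b - a) (b - a)
  have hr : r ≠ 0 := inner_self_ne_zero.2 (sub_ne_zero.2 (Ne.symm hab))
  let u : Pt 3 := r • (z - a) - s • (b - a)
  have hu : u ≠ 0 := by
    intro h0
    have h1 : z = AffineMap.lineMap a b (s / r) := by
      have h2 : z - a = (s / r) • (b - a) := by
        have := sub_eq_zero.1 h0
        rw [div_eq_inv_mul, mul_smul, ← this, smul_smul, inv_mul_cancel₀ hr, one_smul]
      rw [AffineMap.lineMap_apply, vsub_eq_sub, vadd_eq_add, ← h2, sub_add_cancel]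
    have h3 := hF.notMem_affineSpan_sdiff ⟨z, hz⟩ Set.univ
    refine h3 ?_
    have h4 : z ∈ affineSpan ℝ ({a, b} : Set (Pt 3)) := by
      rw [h1]; exact AffineMap.lineMap_mem_affineSpan_pair _ _ _
    refine affineSpan_mono ℝ ?_ h4
    rintro w (rfl | rfl)
    · exact ⟨⟨_, ha⟩, ⟨trivial, by simpa using Ne.symm hza⟩, rfl⟩
    · exact ⟨⟨_, hb⟩, ⟨trivial, by simpa using Ne.symm hzb⟩, rfl⟩
  refine vdet_eq_zero_of_orthogonal hu fun i => ?_
  rw [real_inner_comm]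
  fin_cases i
  · change inner ℝ x (r • (z - a) - s • (b - a)) = 0
    rw [inner_sub_right, inner_smul_right, inner_smul_right, hx z hz a ha, hx b hb a ha]; ring
  · change inner ℝ (b - a) (r • (z - a) - s • (b - a)) = 0
    rw [inner_sub_right, inner_smul_right, inner_smul_right]
    change r * s - s * r = 0
    ring
  · change inner ℝ y (r • (z - a) - s • (b - a)) = 0
    rw [inner_sub_right, inner_smul_right, inner_smul_right, hy z hz a ha, hy b hb a ha]; ring

namespace SimplicialMesh

section Diamond

variable {d : ℕ} {Ω : Set (Pt d)} (T : SimplicialMesh Ω)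

theorem diaFace_mem_faces (hd : 0 < d) {D : Sym2 (Finset (Pt d))} (hD : D ∈ T.diamonds) :
    diaFace D ∈ T.complex.faces :=
  T.complex.down_closed (T.mem_faces_of_mem_primalBar (T.out_mem_diamonds hD).1)
    Finset.inter_subset_left (Finset.card_pos.1 (by rw [T.card_diaFace hD]; exact hd))

theorem diaK_mem_faces {D : Sym2 (Finset (Pt d))} (hD : D ∈ T.diamonds) :
    diaK D ∈ T.complex.faces := T.mem_faces_of_mem_primalBar (T.out_mem_diamonds hD).1

theorem diaL_mem_faces {D : Sym2 (Finset (Pt d))} (hD : D ∈ T.diamonds) :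
    diaL D ∈ T.complex.faces :=
  T.mem_faces_of_mem_primalBar (T.mem_primalBar_of_neighbours (T.out_mem_diamonds hD).2)

theorem inner_diaL_sub_diaK {D : Sym2 (Finset (Pt d))} (hD : D ∈ T.diamonds) {f g : Pt d}
    (hf : f ∈ diaFace D) (hg : g ∈ diaFace D) :
    inner ℝ (center (diaL D) - center (diaK D)) (f - g) = 0 :=
  T.inner_center_sub_center (T.diaK_mem_faces hD) (T.diaL_mem_faces hD) hf hg

theorem inner_diaFace_sub_diaK (hd : 0 < d) {D : Sym2 (Finset (Pt d))} (hD : D ∈ T.diamonds)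
    {f g : Pt d} (hf : f ∈ diaFace D) (hg : g ∈ diaFace D) :
    inner ℝ (center (diaFace D) - center (diaK D)) (f - g) = 0 :=
  T.inner_center_sub_center (T.diaK_mem_faces hD) (T.diaFace_mem_faces hd hD)
    (Finset.mem_inter.2 ⟨(Finset.mem_inter.1 hf).1, hf⟩)
    (Finset.mem_inter.2 ⟨(Finset.mem_inter.1 hg).1, hg⟩)

end Diamond

/-- A subdiamond in space is split by `σ_S` into two pyramids of total height `d_{KL}`, possibly of
opposite orientation. -/
theorem sigmaMeasure_mul_dist {Ω : Set (Pt 3)} (T : SimplicialMesh Ω) {D : Sym2 (Finset (Pt 3))}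
    (hD : D ∈ T.diamonds) {a b : Pt 3} (ha : a ∈ diaFace D) (hb : b ∈ diaFace D) (hab : a ≠ b) :
    sigmaMeasure D a b * dist (center (diaK D)) (center (diaL D)) =
      pyramidRatio 2 * subdiamondVolume D a b := by
  obtain ⟨z, hz, hza, hzb⟩ : ∃ z ∈ diaFace D, z ≠ a ∧ z ≠ b := by
    by_contra! hn
    have : diaFace D ⊆ {a, b} := fun z hz => by
      by_cases h : z = a
      · simp [h]
      · simp [hn z hz h]
    have h2 := Finset.card_le_card this
    rw [T.card_diaFace hD, Finset.card_pair hab] at h2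
    omega
  have hdet : |vdet ![center (diaL D) - center (diaK D), b - a, center (diaFace D) - a]| =
      |vdet ![center (diaL D) - center (diaK D), a - center (diaK D), b - center (diaK D)]| := by
    have h0 := vdet_eq_zero_of_orthogonal_plane
      (T.complex.indep (T.diaFace_mem_faces (by norm_num) hD)) ha hb hz hab hza hzb
      (x := center (diaL D) - center (diaK D)) (y := center (diaFace D) - center (diaK D))
      (fun f hf g hg => T.inner_diaL_sub_diaK hD hf hg)
      (fun f hf g hg => T.inner_diaFace_sub_diaK (by norm_num) hD hf hg)
    rw [vdet_three] at h0 ⊢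
    rw [vdet_three]
    simp only [PiLp.sub_apply] at h0 ⊢
    congr 1
    linear_combination h0
  by_cases hc : center (diaK D) = center (diaL D)
  · rw [subdiamondVolume, subdiamond, if_neg (by norm_num), convexHull_insert_triple_eq,
      volumeReal_simplexAt, ← hdet, hc, sub_self, dist_self, vdet_three]
    simp
  · have hspan : ∀ f ∈ diaFace D, inner ℝ (unitVec (center (diaK D)) (center (diaL D))) (f - a) = 0 :=
      fun f hf => by rw [inner_unitVec, T.inner_diaL_sub_diaK hD hf ha, mul_zero]
    have hcen : inner ℝ (unitVec (center (diaK D)) (center (diaL D))) (center (diaFace D) - a) = 0 :=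
      inner_eq_zero_of_mem_affineSpan (F := (diaFace D : Set (Pt 3))) hspan
        (center_spec (T.complex.indep (T.diaFace_mem_faces (by norm_num) hD)) ⟨a, ha⟩).1
    have h := faceMeasure_simplexAt_mul a ![b - a, center (diaFace D) - a] (norm_unitVec hc)
      (fun i => by fin_cases i; exacts [hspan b hb, hcen])
      (center (diaL D) - center (diaK D)) (center (diaK D))
    rw [inner_unitVec, real_inner_self_eq_norm_sq, ← dist_eq_norm, dist_comm (center (diaL D))] at h
    have hpos : 0 < dist (center (diaK D)) (center (diaL D)) := dist_pos.2 hc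
    rw [sq, inv_mul_cancel_left₀ hpos.ne', abs_of_pos hpos, ← convexHull_insert_pair_eq,
      volumeReal_simplexAt] at h
    rw [sigmaMeasure, h, subdiamondVolume, subdiamond, if_neg (by norm_num),
      convexHull_insert_triple_eq, volumeReal_simplexAt, ← hdet]
    rfl

/-- A subdiamond in space is split by `σ*_S` into two pyramids of total height `d_{ab}`. -/
theorem sigmaStarMeasure_mul_dist {Ω : Set (Pt 3)} (T : SimplicialMesh Ω)
    {D : Sym2 (Finset (Pt 3))}
    (hD : D ∈ T.diamonds) {a b : Pt 3} (ha : a ∈ diaFace D) (hb : b ∈ diaFace D) (hab : a ≠ b) :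
    sigmaStarMeasure D a b * dist a b = pyramidRatio 2 * subdiamondVolume D a b := by
  have hdet : |vdet ![b - a, center (diaL D) - center (diaK D), midpoint ℝ a b - center (diaK D)]| =
      |vdet ![center (diaL D) - center (diaK D), a - center (diaK D), b - center (diaK D)]| := by
    rw [vdet_three, vdet_three, midpoint_eq_smul_add]
    simp only [PiLp.sub_apply, PiLp.smul_apply, PiLp.add_apply, smul_eq_mul, invOf_eq_inv]
    congr 1
    ring
  have h := faceMeasure_simplexAt_mul (center (diaK D))
    ![center (diaL D) - center (diaK D), midpoint ℝ a b - center (diaK D)] (norm_unitVec hab)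
    (fun i => by
      fin_cases i
      · change inner ℝ (unitVec a b) (center (diaL D) - center (diaK D)) = 0
        rw [inner_unitVec, real_inner_comm, T.inner_diaL_sub_diaK hD hb ha, mul_zero]
      · change inner ℝ (unitVec a b) (midpoint ℝ a b - center (diaK D)) = 0
        have h1 := T.dist_center_eq (T.diaK_mem_faces hD) (Finset.mem_inter.1 ha).1
          (Finset.mem_inter.1 hb).1
        have h2 := dist_sq_sub b a (center (diaK D)) (midpoint ℝ a b)
        rw [h1, dist_right_midpoint, dist_left_midpoint] at h2
        rw [inner_unitVec, real_inner_comm]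
        have h3 : inner ℝ (midpoint ℝ a b - center (diaK D)) (b - a) = 0 := by linarith
        rw [h3, mul_zero]) (b - a) (center (diaK D))
  have hpos : 0 < dist a b := dist_pos.2 hab
  rw [inner_unitVec, real_inner_self_eq_norm_sq, ← dist_eq_norm, dist_comm b, sq,
    inv_mul_cancel_left₀ hpos.ne', abs_of_pos hpos, ← convexHull_insert_pair_eq,
    volumeReal_simplexAt] at h
  rw [sigmaStarMeasure, if_neg (by norm_num), h, subdiamondVolume, subdiamond, if_neg (by norm_num),
    convexHull_insert_triple_eq, volumeReal_simplexAt, ← hdet]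
  rfl

theorem edges_pair {d : ℕ} {a b : Pt d} (hab : a ≠ b) : edges {a, b} = {s(a, b)} := by
  ext e
  induction e with | _ x y =>
  simp only [mem_edges, Finset.mem_insert, Finset.mem_singleton, Sym2.eq_iff]
  constructor
  · rintro ⟨rfl | rfl, rfl | rfl, h⟩ <;> simp_all
  · rintro (⟨rfl, rfl⟩ | ⟨rfl, rfl⟩)
    · exact ⟨Or.inl rfl, Or.inr rfl, hab⟩
    · exact ⟨Or.inr rfl, Or.inl rfl, hab.symm⟩

/-- On one diamond in the plane, the fluxes of a vector through the primal and dual interfaces,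
weighted by the jumps of a discrete function, give a multiple of the product of this vector and the
discrete gradient. -/
theorem sum_edges_flux_two {Ω : Set (Pt 2)} (T : SimplicialMesh Ω) {D : Sym2 (Finset (Pt 2))}
    (hD : D ∈ T.diamonds) : ∃ c : ℝ, 0 ≤ c ∧ ∀ (w : DiscreteFunction 2) (F : Pt 2),
      ∑ e ∈ edges (diaFace D), (sigmaMeasure D (Quot.out e).1 (Quot.out e).2 *
          ((w.onPrimal (diaL D) - w.onPrimal (diaK D)) * inner ℝ F (normal (diaK D) (diaL D))) +
        sigmaStarMeasure D (Quot.out e).1 (Quot.out e).2 *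
          ((w.onDual (Quot.out e).2 - w.onDual (Quot.out e).1) *
            inner ℝ F (unitVec (Quot.out e).1 (Quot.out e).2))) =
      c * inner ℝ F (discreteGradient w D) := by
  obtain ⟨a, b, hab, hF⟩ := Finset.card_eq_two.1 (T.card_diaFace hD)
  have he : edges (diaFace D) = {s(a, b)} := by rw [hF, edges_pair hab]
  have hout := out_mem_edges (F := diaFace D) (e := s(a, b)) (by rw [he]; simp)
  simp only [discreteGradient, he, Finset.sum_singleton, if_true, one_smul]
  have hF' : diaFace D = {(Quot.out s(a, b)).1, (Quot.out s(a, b)).2} := by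
    rw [hF]
    rcases Sym2.eq_iff.1 (mk_out s(a, b)) with ⟨h1, h2⟩ | ⟨h1, h2⟩
    · rw [h1, h2]
    · rw [h1, h2, Finset.pair_comm]
  generalize (Quot.out s(a, b)).1 = x at *
  generalize (Quot.out s(a, b)).2 = y at *
  obtain ⟨c, hc, hseg⟩ := exists_faceMeasure_segment
  have hind := T.complex.indep (T.diaFace_mem_faces (by norm_num) hD)
  have hs : sigmaMeasure D x y = c * dist x y := by
    rw [sigmaMeasure, ← hseg]
    congr 1
    have hcen : center (diaFace D) ∈ segment ℝ x y := by
      rw [hF'] at hind ⊢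
      exact center_pair hind
    refine Subset.antisymm (convexHull_min ?_ (convex_segment x y)) ?_
    · rintro z (rfl | rfl | rfl)
      · exact left_mem_segment ℝ _ _
      · exact right_mem_segment ℝ _ _
      · exact hcen
    · rw [← convexHull_pair]
      exact convexHull_mono (by rintro z (rfl | rfl) <;> simp)
  have hs' : sigmaStarMeasure D x y = c * dist (center (diaK D)) (center (diaL D)) := by
    rw [sigmaStarMeasure, if_pos rfl, convexHull_pair, hseg]
  refine ⟨c * dist x y * dist (center (diaK D)) (center (diaL D)), by positivity, fun w F => ?_⟩
  have hxy : dist x y ≠ 0 := (dist_pos.2 hout.2.2).ne'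
  rw [hs, hs', inner_add_right, inner_smul_right, inner_smul_right]
  by_cases hKL : center (diaK D) = center (diaL D)
  · rw [normal, hKL, unitVec, sub_self]
    simp
  · have := (dist_pos.2 hKL).ne'
    field_simp

/-- On one diamond in space, the primal fluxes and twice the dual fluxes, weighted by the jumps of
a discrete function, give a multiple of the product with the discrete gradient. -/
theorem sum_edges_flux_three {Ω : Set (Pt 3)} (T : SimplicialMesh Ω) {D : Sym2 (Finset (Pt 3))}
    (hD : D ∈ T.diamonds) : ∃ c : ℝ, 0 ≤ c ∧ ∀ (w : DiscreteFunction 3) (F : Pt 3),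
      ∑ e ∈ edges (diaFace D), (sigmaMeasure D (Quot.out e).1 (Quot.out e).2 *
          ((w.onPrimal (diaL D) - w.onPrimal (diaK D)) * inner ℝ F (normal (diaK D) (diaL D))) +
        2 * (sigmaStarMeasure D (Quot.out e).1 (Quot.out e).2 *
          ((w.onDual (Quot.out e).2 - w.onDual (Quot.out e).1) *
            inner ℝ F (unitVec (Quot.out e).1 (Quot.out e).2)))) =
      c * inner ℝ F (discreteGradient w D) := by
  have hSnn : ∀ a b, 0 ≤ subdiamondVolume D a b := fun a b => measureReal_nonneg
  have hDnn : 0 ≤ diamondVolume D := Finset.sum_nonneg fun e _ => hSnn _ _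
  refine ⟨pyramidRatio 2 * diamondVolume D, mul_nonneg (pyramidRatio_pos 2).le hDnn,
    fun w F => ?_⟩
  have h32 : (3 : ℕ) ≠ 2 := by norm_num
  simp only [discreteGradient, if_neg h32]
  rw [inner_add_right, inner_sum, Finset.sum_add_distrib, mul_add]
  congr 1
  · rw [← Finset.sum_mul, inner_smul_right]
    have h1 : (∑ e ∈ edges (diaFace D), sigmaMeasure D (Quot.out e).1 (Quot.out e).2) *
        dist (center (diaK D)) (center (diaL D)) = pyramidRatio 2 * diamondVolume D := by
      rw [diamondVolume, Finset.sum_mul, Finset.mul_sum]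
      refine Finset.sum_congr rfl fun e he => ?_
      obtain ⟨h1, h2, h3⟩ := out_mem_edges he
      exact T.sigmaMeasure_mul_dist hD h1 h2 h3
    rw [← h1]
    by_cases hKL : center (diaK D) = center (diaL D)
    · rw [normal, hKL, unitVec, sub_self]
      simp
    · have := (dist_pos.2 hKL).ne'
      field_simp
  · rw [Finset.mul_sum]
    refine Finset.sum_congr rfl fun e he => ?_
    obtain ⟨h1, h2, h3⟩ := out_mem_edges he
    have hs := T.sigmaStarMeasure_mul_dist hD h1 h2 h3
    have hSD : subdiamondVolume D (Quot.out e).1 (Quot.out e).2 ≤ diamondVolume D := by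
      have hnn : ∀ i ∈ edges (diaFace D),
          0 ≤ (fun i : Sym2 (Pt 3) => subdiamondVolume D (Quot.out i).1 (Quot.out i).2) i :=
        fun i _ => measureReal_nonneg
      exact Finset.single_le_sum hnn he
    have hS0 := hSnn (Quot.out e).1 (Quot.out e).2
    have hab := (dist_pos.2 h3).ne'
    have hs' : sigmaStarMeasure D (Quot.out e).1 (Quot.out e).2 = pyramidRatio 2 *
        subdiamondVolume D (Quot.out e).1 (Quot.out e).2 / dist (Quot.out e).1 (Quot.out e).2 := by
      rw [eq_div_iff hab, hs]
    rw [smul_smul, inner_smul_right, hs']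
    -- For a degenerate diamond the quotient by `m_D` is zero, and so are the measures `m_S`.
    by_cases h0 : diamondVolume D = 0
    · have : subdiamondVolume D (Quot.out e).1 (Quot.out e).2 = 0 := by linarith
      rw [this, h0]; simp
    · field_simp

/-- Duality between the discrete divergences and the discrete gradient. The weights `c D` are
multiples of the measures of the diamonds; only their sign matters for coercivity. -/
theorem exists_discrete_duality (hd : d = 2 ∨ d = 3) {Ω : Set (Pt d)} (T : SimplicialMesh Ω) :
    ∃ c : Sym2 (Finset (Pt d)) → ℝ, (∀ D ∈ T.diamonds, 0 ≤ c D) ∧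
      ∀ (w : DiscreteFunction d) (F : Sym2 (Finset (Pt d)) → Pt d),
        ∑ K ∈ T.primalBar, w.onPrimal K * ∑ L ∈ T.neighbours K, ∑ e ∈ edges (K ∩ L),
            sigmaMeasure s(K, L) (Quot.out e).1 (Quot.out e).2 * inner ℝ (F s(K, L)) (normal K L) +
          ((d : ℝ) - 1) * ∑ v ∈ T.vertices, w.onDual v *
            ∑ x ∈ T.dualNeighbours v, ∑ D ∈ T.diamondsAt v x,
              sigmaStarMeasure D v x * inner ℝ (F D) (unitVec v x) =
        -∑ D ∈ T.diamonds, c D * inner ℝ (F D) (discreteGradient w D) := by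
  have hex : ∀ D : Sym2 (Finset (Pt d)), ∃ c : ℝ, D ∈ T.diamonds → 0 ≤ c ∧
      ∀ (w : DiscreteFunction d) (F : Pt d),
      ∑ e ∈ edges (diaFace D), (sigmaMeasure D (Quot.out e).1 (Quot.out e).2 *
          ((w.onPrimal (diaL D) - w.onPrimal (diaK D)) * inner ℝ F (normal (diaK D) (diaL D))) +
        ((d : ℝ) - 1) * (sigmaStarMeasure D (Quot.out e).1 (Quot.out e).2 *
          ((w.onDual (Quot.out e).2 - w.onDual (Quot.out e).1) *
            inner ℝ F (unitVec (Quot.out e).1 (Quot.out e).2)))) =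
      c * inner ℝ F (discreteGradient w D) := by
    intro D
    by_cases hD : D ∈ T.diamonds
    · rcases hd with rfl | rfl
      · obtain ⟨c, hc, h⟩ := T.sum_edges_flux_two hD
        refine ⟨c, fun _ => ⟨hc, fun w F => ?_⟩⟩
        rw [← h w F]
        refine Finset.sum_congr rfl fun e _ => ?_
        norm_num
      · obtain ⟨c, hc, h⟩ := T.sum_edges_flux_three hD
        refine ⟨c, fun _ => ⟨hc, fun w F => ?_⟩⟩
        rw [← h w F]
        refine Finset.sum_congr rfl fun e _ => ?_
        norm_num
    · exact ⟨0, fun h => absurd h hD⟩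
  choose c hc using hex
  refine ⟨c, fun D hD => (hc D hD).1, fun w F => ?_⟩
  have e1 : ∑ K ∈ T.primalBar, w.onPrimal K * ∑ L ∈ T.neighbours K, ∑ e ∈ edges (K ∩ L),
      sigmaMeasure s(K, L) (Quot.out e).1 (Quot.out e).2 * inner ℝ (F s(K, L)) (normal K L) =
      ∑ D ∈ T.diamonds, ∑ e ∈ edges (diaFace D), -(sigmaMeasure D (Quot.out e).1 (Quot.out e).2 *
        ((w.onPrimal (diaL D) - w.onPrimal (diaK D)) *
          inner ℝ (F D) (normal (diaK D) (diaL D)))) := by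
    have h := T.sum_neighbours_eq_sum_diamonds fun K L => w.onPrimal K * ∑ e ∈ edges (K ∩ L),
      sigmaMeasure s(K, L) (Quot.out e).1 (Quot.out e).2 * inner ℝ (F s(K, L)) (normal K L)
    simp only [← Finset.mul_sum] at h
    rw [h]
    refine Finset.sum_congr rfl fun D _ => ?_
    have h1 : s(diaK D, diaL D) = D := mk_out D
    have h2 : s(diaL D, diaK D) = D := by rw [Sym2.eq_swap]; exact h1
    have h3 : diaL D ∩ diaK D = diaFace D := Finset.inter_comm _ _
    have h4 : diaK D ∩ diaL D = diaFace D := rfl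
    rw [h1, h2, h3, h4, Finset.mul_sum, Finset.mul_sum, ← Finset.sum_add_distrib]
    refine Finset.sum_congr rfl fun e _ => ?_
    have h5 : normal (diaL D) (diaK D) = -normal (diaK D) (diaL D) := unitVec_comm _ _
    rw [h5, inner_neg_right]
    ring
  have e2 : ∑ v ∈ T.vertices, w.onDual v *
      ∑ x ∈ T.dualNeighbours v, ∑ D ∈ T.diamondsAt v x,
        sigmaStarMeasure D v x * inner ℝ (F D) (unitVec v x) =
      ∑ D ∈ T.diamonds, ∑ e ∈ edges (diaFace D), -(sigmaStarMeasure D (Quot.out e).1 (Quot.out e).2 *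
          ((w.onDual (Quot.out e).2 - w.onDual (Quot.out e).1) *
            inner ℝ (F D) (unitVec (Quot.out e).1 (Quot.out e).2))) := by
    have h := T.sum_dualNeighbours_eq_sum_offDiag fun D v x =>
      w.onDual v * (sigmaStarMeasure D v x * inner ℝ (F D) (unitVec v x))
    simp only [← Finset.mul_sum] at h
    rw [h]
    refine Finset.sum_congr rfl fun D _ => ?_
    rw [sum_offDiag_eq_sum_edges (diaFace D) fun a b =>
      w.onDual a * (sigmaStarMeasure D a b * inner ℝ (F D) (unitVec a b))]
    refine Finset.sum_congr rfl fun e _ => ?_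
    rw [unitVec_comm (Quot.out e).1, inner_neg_right, sigmaStarMeasure_comm D (Quot.out e).2]
    ring
  rw [e1, e2, Finset.mul_sum, ← Finset.sum_add_distrib, ← Finset.sum_neg_distrib]
  refine Finset.sum_congr rfl fun D hD => ?_
  rw [← (hc D hD).2 w (F D), Finset.mul_sum, ← Finset.sum_add_distrib, ← Finset.sum_neg_distrib]
  refine Finset.sum_congr rfl fun e _ => ?_
  ring

end SimplicialMesh

/-! ### The dual interfaces around an interior vertex -/

/-- If `u` is orthogonal to `X`, then only the component along `X` of the first vector enters into
the determinant. -/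
theorem normSq_mul_vdet_cons {m : ℕ} {X : Pt (m + 1)} {u : Fin m → Pt (m + 1)}
    (hu : ∀ i, inner ℝ X (u i) = 0) (y : Pt (m + 1)) :
    ‖X‖ ^ 2 * vdet (Fin.cons y u : Fin (m + 1) → Pt (m + 1)) =
      inner ℝ X y * vdet (Fin.cons X u : Fin (m + 1) → Pt (m + 1)) := by
  by_cases hX : X = 0
  · simp [hX]
  have hn : 0 < ‖X‖ := norm_pos_iff.2 hX
  rw [vdet_cons_eq_inner_mul (n := ‖X‖⁻¹ • X) (by simp [norm_smul, hn.ne'])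
      (fun i => by rw [real_inner_smul_left, hu i, mul_zero]) y,
    vdet_cons_eq_inner_mul (n := ‖X‖⁻¹ • X) (by simp [norm_smul, hn.ne'])
      (fun i => by rw [real_inner_smul_left, hu i, mul_zero]) X,
    real_inner_smul_left, real_inner_smul_left, real_inner_self_eq_norm_sq]
  ring

theorem sign_vdet_cons_of_pos {m : ℕ} {X : Pt (m + 1)} {u : Fin m → Pt (m + 1)}
    (hu : ∀ i, inner ℝ X (u i) = 0) {y : Pt (m + 1)} (hy : 0 < inner ℝ X y) :
    SignType.sign (vdet (Fin.cons y u : Fin (m + 1) → Pt (m + 1))) =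
      SignType.sign (vdet (Fin.cons X u : Fin (m + 1) → Pt (m + 1))) := by
  have hX : 0 < ‖X‖ := norm_pos_iff.2 fun h => by simp [h] at hy
  have h := congrArg SignType.sign (normSq_mul_vdet_cons hu y)
  rwa [sign_mul, sign_mul, sign_pos (by positivity), sign_pos hy, one_mul, one_mul] at h

theorem sign_vdet_cons_of_neg {m : ℕ} {X : Pt (m + 1)} {u : Fin m → Pt (m + 1)}
    (hu : ∀ i, inner ℝ X (u i) = 0) {y : Pt (m + 1)} (hy : inner ℝ X y < 0) :
    SignType.sign (vdet (Fin.cons y u : Fin (m + 1) → Pt (m + 1))) =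
      -SignType.sign (vdet (Fin.cons X u : Fin (m + 1) → Pt (m + 1))) := by
  have hX : 0 < ‖X‖ := norm_pos_iff.2 fun h => by simp [h] at hy
  have h := congrArg SignType.sign (normSq_mul_vdet_cons hu y)
  rwa [sign_mul, sign_mul, sign_pos (by positivity), sign_neg hy, one_mul, neg_one_mul] at h

namespace SimplicialMesh

variable {d : ℕ} {Ω : Set (Pt d)} (T : SimplicialMesh Ω)

theorem notMem_primalBdry_of_mem (hΩ : IsOpen Ω) {v : Pt d} (hv : v ∈ Ω) {K : Finset (Pt d)}
    (hvK : v ∈ K) : K ∉ T.primalBdry := fun h => by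
  have h1 := (T.mem_primalBdry.1 h).2.2 (subset_convexHull ℝ _ hvK)
  rw [hΩ.frontier_eq] at h1
  exact h1.2 hv

/-- A sum over the dual interfaces around an interior vertex `v`, with terms that are split into
contributions of the two simplices of a diamond, as a sum over the simplices `K` around `v`: their
interfaces that contain `v` are the `K.erase p` with `p ≠ v`. -/
theorem sum_diamondsAt_eq_sum_primal (hd : 0 < d) (hΩ : IsOpen Ω) {v : Pt d} (hv : v ∈ Ω)
    (φ : Sym2 (Finset (Pt d)) → Pt d → ℝ) (ψ : Finset (Pt d) → Finset (Pt d) → Pt d → ℝ)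
    (hφ : ∀ D ∈ T.diamonds, ∀ w ∈ diaFace D, v ∈ diaFace D → v ≠ w →
      φ D w = ψ (diaK D) (diaFace D) w + ψ (diaL D) (diaFace D) w) :
    ∑ w ∈ T.dualNeighbours v, ∑ D ∈ T.diamondsAt v w, φ D w =
      ∑ K ∈ T.primal.filter (fun K => v ∈ K), ∑ p ∈ K.erase v,
        ∑ w ∈ (K.erase v).erase p, ψ K (K.erase p) w := by
  let h : Finset (Pt d) → Finset (Pt d) → ℝ := fun K F =>
    if v ∈ F then ∑ w ∈ F.erase v, ψ K F w else 0
  have e1 : ∑ w ∈ T.dualNeighbours v, ∑ D ∈ T.diamondsAt v w, φ D w =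
      ∑ D ∈ T.diamonds.filter (fun D => v ∈ diaFace D), ∑ w ∈ (diaFace D).erase v, φ D w := by
    simp only [Finset.sum_sigma']
    refine Finset.sum_bij' (fun x _ => ⟨x.2, x.1⟩) (fun y _ => ⟨y.2, y.1⟩) ?_ ?_ ?_ ?_ ?_
    · rintro ⟨w, D⟩ h
      simp only [Finset.mem_sigma, diamondsAt, dualNeighbours, Finset.mem_filter] at h
      exact Finset.mem_sigma.2 ⟨Finset.mem_filter.2 ⟨h.2.1, h.2.2.1⟩,
        Finset.mem_erase.2 ⟨h.1.2.1, h.2.2.2⟩⟩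
    · rintro ⟨D, w⟩ h
      simp only [Finset.mem_sigma, Finset.mem_filter, Finset.mem_erase] at h
      exact Finset.mem_sigma.2 ⟨T.mem_dualNeighbours_of_mem_diaFace h.1.1 h.1.2 h.2.2 h.2.1.symm,
        Finset.mem_filter.2 ⟨h.1.1, h.1.2, h.2.2⟩⟩
    · intros; rfl
    · intros; rfl
    · intros; rfl
  have e2 := T.sum_neighbours_eq_sum_diamonds fun K L => h K (K ∩ L)
  have e3 : ∑ D ∈ T.diamonds.filter (fun D => v ∈ diaFace D), ∑ w ∈ (diaFace D).erase v, φ D w =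
      ∑ D ∈ T.diamonds, (h (diaK D) (diaK D ∩ diaL D) + h (diaL D) (diaL D ∩ diaK D)) := by
    rw [Finset.sum_filter]
    refine Finset.sum_congr rfl fun D hD => ?_
    rw [Finset.inter_comm (diaL D)]
    change _ = h (diaK D) (diaFace D) + h (diaL D) (diaFace D)
    by_cases hvD : v ∈ diaFace D
    · simp only [h, hvD, if_true]
      rw [← Finset.sum_add_distrib]
      refine Finset.sum_congr rfl fun w hw => ?_
      exact hφ D hD w (Finset.mem_of_mem_erase hw) hvD (Finset.ne_of_mem_erase hw).symm
    · simp [h, hvD]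
  rw [e1, e3, ← e2]
  have e4 : ∑ K ∈ T.primalBar, ∑ L ∈ T.neighbours K, h K (K ∩ L) =
      ∑ K ∈ T.primal.filter (fun K => v ∈ K), ∑ L ∈ T.neighbours K, h K (K ∩ L) := by
    symm
    refine Finset.sum_subset (fun K hK => T.mem_primalBar.2 (Or.inl (Finset.mem_filter.1 hK).1))
      fun K hK hK' => Finset.sum_eq_zero fun L _ => ?_
    simp only [h]
    rw [if_neg]
    intro hvKL
    have hvK := (Finset.mem_inter.1 hvKL).1
    rcases T.mem_primalBar.1 hK with h1 | h1
    · exact hK' (Finset.mem_filter.2 ⟨h1, hvK⟩)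
    · exact T.notMem_primalBdry_of_mem hΩ hv hvK h1
  rw [e4]
  refine Finset.sum_congr rfl fun K hK => ?_
  obtain ⟨hK, hvK⟩ := Finset.mem_filter.1 hK
  obtain ⟨N, hN, hsum⟩ := T.exists_neighbour_opposite hd hΩ hK
  rw [hsum, ← Finset.add_sum_erase K _ hvK]
  have h0 : h K (K ∩ N v) = 0 := by
    rw [(hN v hvK).2]
    simp [h]
  rw [h0, zero_add]
  refine Finset.sum_congr rfl fun p hp => ?_
  obtain ⟨hpv, hpK⟩ := Finset.mem_erase.1 hp
  rw [(hN p hpK).2, Finset.erase_right_comm]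
  simp only [h]
  rw [if_pos (Finset.mem_erase.2 ⟨hpv.symm, hvK⟩)]

end SimplicialMesh

namespace DoubleMesh

variable {d : ℕ} {Ω : Set (Pt d)} (T : DoubleMesh Ω)

/-- The two simplices of a diamond at an interior vertex and their vertices off the interface. -/
theorem exists_diamond_apexes (hΩ : IsOpen Ω) {v : Pt d} (hv : v ∈ Ω)
    {D : Sym2 (Finset (Pt d))} (hD : D ∈ T.diamonds) (hvD : v ∈ SimplicialMesh.diaFace D) :
    ∃ p q, SimplicialMesh.diaK D \ SimplicialMesh.diaFace D = {p} ∧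
      SimplicialMesh.diaL D \ SimplicialMesh.diaFace D = {q} ∧
      inner ℝ (center (SimplicialMesh.diaL D) - center (SimplicialMesh.diaK D)) (p - v) < 0 ∧
      0 < inner ℝ (center (SimplicialMesh.diaL D) - center (SimplicialMesh.diaK D)) (q - v) := by
  obtain ⟨hK, hL⟩ := T.out_mem_diamonds hD
  have hvKL := Finset.mem_inter.1 hvD
  have hK' := (T.mem_primalBar.1 hK).resolve_right (T.notMem_primalBdry_of_mem hΩ hv hvKL.1)
  have hL' := ((T.mem_neighbours.1 hL).1).resolve_right (T.notMem_primalBdry_of_mem hΩ hv hvKL.2)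
  have hLK := T.neighbours_symm hK hL
  have key : ∀ A B : Finset (Pt d), A ∈ T.primal → B ∈ T.neighbours A → ∃ p, A \ (A ∩ B) = {p} := by
    intro A B hA hB
    obtain ⟨p, hp, hAB⟩ := T.exists_inter_eq_erase hA hB
    exact ⟨p, by rw [hAB, Finset.sdiff_erase hp, Finset.sdiff_self]; rfl⟩
  obtain ⟨p, hp⟩ := key _ _ hK' hL
  obtain ⟨q, hq⟩ := key _ _ hL' hLK
  have hq' : SimplicialMesh.diaL D \ SimplicialMesh.diaFace D = {q} := by
    rw [← hq, Finset.inter_comm]; rfl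
  refine ⟨p, q, hp, hq', ?_, ?_⟩
  · have hpm : p ∈ SimplicialMesh.diaK D \ SimplicialMesh.diaL D := by
      have : p ∈ SimplicialMesh.diaK D \ (SimplicialMesh.diaK D ∩ SimplicialMesh.diaL D) := by
        rw [hp]; simp
      simpa using this
    have := T.inner_center_sub_pos hL' hK' hLK hpm (f := v) (by rw [Finset.inter_comm]; exact hvD)
    rw [← neg_sub, inner_neg_left]; linarith
  · have hqm : q ∈ SimplicialMesh.diaL D \ SimplicialMesh.diaK D := by
      have : q ∈ SimplicialMesh.diaL D \ SimplicialMesh.diaFace D := by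
        rw [hq']; simp
      rw [SimplicialMesh.diaFace] at this
      simp only [Finset.mem_sdiff, Finset.mem_inter, not_and] at this ⊢
      exact ⟨this.1, fun h => this.2 h this.1⟩
    exact T.inner_center_sub_pos hK' hL' hL hqm hvD

/-- In the plane, the dual interface `[x_K, x_L]` as a difference of contributions of `K` and `L`.
The sign of a determinant tells on which side of the interface the simplex lies; by the Delaunay
condition this is the side of its centre, relative to the other one. -/
theorem sigmaStarMeasure_mul_inner_two {Ω : Set (Pt 2)} (T : DoubleMesh Ω) (hΩ : IsOpen Ω)
    {v w : Pt 2} (hv : v ∈ Ω) {D : Sym2 (Finset (Pt 2))} (hD : D ∈ T.diamonds)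
    (hvD : v ∈ SimplicialMesh.diaFace D) (hwD : w ∈ SimplicialMesh.diaFace D) (hvw : v ≠ w)
    (ξ : Pt 2) {ψ : Finset (Pt 2) → Finset (Pt 2) → Pt 2 → ℝ}
    (hψ : ∀ K F w, ψ K F w = -(volume.real (unitSimplex 1) *
      (∑ p ∈ K \ F, (SignType.sign (vdet ![p - v, w - v]) : ℝ)) * vdet ![ξ, center K - v])) :
    SimplicialMesh.sigmaStarMeasure D v w * inner ℝ (unitVec v w) ξ =
      ψ (SimplicialMesh.diaK D) (SimplicialMesh.diaFace D) w +
        ψ (SimplicialMesh.diaL D) (SimplicialMesh.diaFace D) w := by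
  obtain ⟨p, q, hp, hq, hpX, hqX⟩ := T.exists_diamond_apexes hΩ hv hD hvD
  have hperp := T.inner_diaL_sub_diaK hD hwD hvD
  rw [hψ, hψ, hp, hq, Finset.sum_singleton, Finset.sum_singleton]
  set xK := center (SimplicialMesh.diaK D)
  set xL := center (SimplicialMesh.diaL D)
  have hu : ∀ i, inner ℝ (xL - xK) (![w - v] i) = 0 := fun i => by fin_cases i; exact hperp
  have hsp : SignType.sign (vdet ![p - v, w - v]) = -SignType.sign (vdet ![xL - xK, w - v]) :=
    sign_vdet_cons_of_neg hu hpX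
  have hsq : SignType.sign (vdet ![q - v, w - v]) = SignType.sign (vdet ![xL - xK, w - v]) :=
    sign_vdet_cons_of_pos hu hqX
  have hnX : ∀ i, inner ℝ (unitVec v w) (![xL - xK] i) = 0 := fun i => by
    fin_cases i
    change inner ℝ (unitVec v w) (xL - xK) = 0
    rw [inner_unitVec, real_inner_comm, hperp, mul_zero]
  have hσ : SimplicialMesh.sigmaStarMeasure D v w =
      |vdet ![unitVec v w, xL - xK]| * volume.real (unitSimplex 1) := by
    have h := faceMeasure_simplexAt xK ![xL - xK] (norm_unitVec hvw) hnX
    rw [SimplicialMesh.sigmaStarMeasure, if_pos rfl]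
    refine Eq.trans ?_ h
    rw [simplexAt]
    congr 2
    ext z
    simp [xK, xL]
  have hξ : vdet ![ξ, xL - xK] = inner ℝ (unitVec v w) ξ * vdet ![unitVec v w, xL - xK] :=
    vdet_cons_eq_inner_mul (norm_unitVec hvw) hnX ξ
  have hdpos : 0 < dist v w := dist_pos.2 hvw
  have hΔ : vdet ![xL - xK, w - v] = -(dist v w * vdet ![unitVec v w, xL - xK]) := by
    rw [← dist_smul_unitVec v w, vdet_two, vdet_two]
    simp only [PiLp.smul_apply, smul_eq_mul]
    ring
  have habs : |vdet ![unitVec v w, xL - xK]| =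
      -(SignType.sign (vdet ![xL - xK, w - v]) : ℝ) * vdet ![unitVec v w, xL - xK] := by
    rw [hΔ, Left.sign_neg, sign_mul, sign_pos hdpos, one_mul, SignType.coe_neg, neg_neg,
      sign_mul_self]
  rw [hσ, habs, hsp, hsq, SignType.coe_neg]
  have hlin : vdet ![ξ, xL - xK] = vdet ![ξ, xL - v] - vdet ![ξ, xK - v] := by
    simp only [vdet_two, PiLp.sub_apply]; ring
  rw [hξ] at hlin
  linear_combination (-(SignType.sign (vdet ![xL - xK, w - v]) : ℝ) *
    volume.real (unitSimplex 1)) * hlin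

/-- In space, the dual interface triangle `x_K, x_L, m`, where `m` is the middle of `[v, w]`, as a
difference of contributions of `K` and `L`. That the face contains the centre of its circumscribed
circle fixes the orientation. -/
theorem sigmaStarMeasure_mul_inner_three {Ω : Set (Pt 3)} (T : DoubleMesh Ω) (hΩ : IsOpen Ω)
    {v w : Pt 3} (hv : v ∈ Ω) {D : Sym2 (Finset (Pt 3))} (hD : D ∈ T.diamonds)
    (hvD : v ∈ SimplicialMesh.diaFace D) (hwD : w ∈ SimplicialMesh.diaFace D) (hvw : v ≠ w)
    (ξ : Pt 3) {ψ : Finset (Pt 3) → Finset (Pt 3) → Pt 3 → ℝ}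
    (hψ : ∀ K F w, ψ K F w = volume.real (unitSimplex 2) *
      (∑ p ∈ K \ F, ∑ z ∈ (F.erase v).erase w,
        (SignType.sign (vdet ![p - v, w - v, z - v]) : ℝ)) *
          vdet ![ξ, center K - v, midpoint ℝ v w - center F]) :
    SimplicialMesh.sigmaStarMeasure D v w * inner ℝ (unitVec v w) ξ =
      ψ (SimplicialMesh.diaK D) (SimplicialMesh.diaFace D) w +
        ψ (SimplicialMesh.diaL D) (SimplicialMesh.diaFace D) w := by
  obtain ⟨p, q, hp, hq, hpX, hqX⟩ := T.exists_diamond_apexes hΩ hv hD hvD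
  have hcard := T.card_diaFace hD
  obtain ⟨z, hz⟩ : ∃ z, ((SimplicialMesh.diaFace D).erase v).erase w = {z} := by
    refine Finset.card_eq_one.1 ?_
    rw [Finset.card_erase_of_mem (Finset.mem_erase.2 ⟨hvw.symm, hwD⟩),
      Finset.card_erase_of_mem hvD, hcard]
  have hzm : z ∈ ((SimplicialMesh.diaFace D).erase v).erase w := by rw [hz]; simp
  simp only [Finset.mem_erase] at hzm
  obtain ⟨hzw, hzv, hzD⟩ := hzm
  have hFeq : SimplicialMesh.diaFace D = {v, w, z} := by
    symm
    refine Finset.eq_of_subset_of_card_le ?_ ?_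
    · intro x hx
      simp only [Finset.mem_insert, Finset.mem_singleton] at hx
      rcases hx with rfl | rfl | rfl <;> assumption
    · rw [hcard, Finset.card_eq_three.2 ⟨v, w, z, hvw, hzv.symm, hzw.symm, rfl⟩]
  have hFf := T.diaFace_mem_faces (by norm_num) hD
  rw [hψ, hψ, hp, hq, hz]
  simp only [Finset.sum_singleton]
  have hperp := T.inner_diaL_sub_diaK hD hwD hvD
  have hperpz := T.inner_diaL_sub_diaK hD hzD hvD
  have hplane := vdet_eq_zero_of_orthogonal_plane (T.complex.indep hFf) hvD hwD hzD hvw hzv hzw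
      (x := center (SimplicialMesh.diaL D) - center (SimplicialMesh.diaK D))
      (y := center (SimplicialMesh.diaFace D) - center (SimplicialMesh.diaK D))
      (fun f hf g hg => T.inner_diaL_sub_diaK hD hf hg)
      (fun f hf g hg => T.inner_diaFace_sub_diaK (by norm_num) hD hf hg)
  -- the centre of the face in barycentric coordinates
  obtain ⟨a, b, hb, hcen⟩ : ∃ a b : ℝ, 0 ≤ b ∧
      center (SimplicialMesh.diaFace D) - v = a • (w - v) + b • (z - v) := by
    have h := T.center_mem_face rfl _ hFf hcard
    rw [hFeq, Finset.coe_insert, Finset.coe_pair, convexHull_insert ⟨w, by simp⟩, convexHull_pair] at h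
    obtain ⟨x, hx, y, hy, h⟩ := mem_convexJoin.1 h
    rw [mem_singleton_iff] at hx
    subst hx
    obtain ⟨s, t, hs, ht, hst, rfl⟩ := hy
    obtain ⟨s', t', hs', ht', hst', h'⟩ := h
    refine ⟨t' * s, t' * t, by positivity, ?_⟩
    rw [hFeq, ← h']
    have e1 : s' = 1 - t' := by linarith
    have e2 : s = 1 - t := by linarith
    subst e1 e2
    module
  have hmid : inner ℝ (midpoint ℝ v w - center (SimplicialMesh.diaFace D)) (w - v) = 0 := by
    have h1 := T.dist_center_eq hFf hvD hwD
    have h2 := dist_sq_sub w v (center (SimplicialMesh.diaFace D)) (midpoint ℝ v w)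
    rw [h1, dist_right_midpoint, dist_left_midpoint] at h2
    linarith
  have hmidK : inner ℝ (midpoint ℝ v w - center (SimplicialMesh.diaK D)) (w - v) = 0 := by
    have h1 := T.dist_center_eq (T.diaK_mem_faces hD) (Finset.mem_inter.1 hvD).1
      (Finset.mem_inter.1 hwD).1
    have h2 := dist_sq_sub w v (center (SimplicialMesh.diaK D)) (midpoint ℝ v w)
    rw [h1, dist_right_midpoint, dist_left_midpoint] at h2
    linarith
  have hσ0 : SimplicialMesh.sigmaStarMeasure D v w = faceMeasure (convexHull ℝ
    {center (SimplicialMesh.diaK D), center (SimplicialMesh.diaL D), midpoint ℝ v w}) := by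
    rw [SimplicialMesh.sigmaStarMeasure, if_neg (by norm_num)]
  rw [hσ0]
  have hY : midpoint ℝ v w - center (SimplicialMesh.diaFace D) =
      (1 / 2 - a) • (w - v) - b • (z - v) := by
    have h1 : midpoint ℝ v w - center (SimplicialMesh.diaFace D) =
        (1 / 2 : ℝ) • (w - v) - (center (SimplicialMesh.diaFace D) - v) := by
      rw [midpoint_eq_smul_add, invOf_eq_inv]; module
    rw [h1, hcen]; module
  generalize hYdef : midpoint ℝ v w - center (SimplicialMesh.diaFace D) = Y at *
  generalize center (SimplicialMesh.diaK D) = xK at *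
  generalize center (SimplicialMesh.diaL D) = xL at *
  have hu : ∀ i, inner ℝ (xL - xK) (![w - v, z - v] i) = 0 := fun i => by
    fin_cases i
    exacts [hperp, hperpz]
  have hsp : SignType.sign (vdet ![p - v, w - v, z - v]) =
      -SignType.sign (vdet ![xL - xK, w - v, z - v]) := sign_vdet_cons_of_neg hu hpX
  have hsq : SignType.sign (vdet ![q - v, w - v, z - v]) =
      SignType.sign (vdet ![xL - xK, w - v, z - v]) := sign_vdet_cons_of_pos hu hqX
  have hnX : inner ℝ (unitVec v w) (xL - xK) = 0 := by
    rw [inner_unitVec, real_inner_comm, hperp, mul_zero]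
  have hσ := faceMeasure_simplexAt xK ![xL - xK, midpoint ℝ v w - xK] (norm_unitVec hvw)
    (fun i => by
      fin_cases i
      · exact hnX
      · change inner ℝ (unitVec v w) (midpoint ℝ v w - xK) = 0
        rw [inner_unitVec, real_inner_comm, hmidK, mul_zero])
  rw [← convexHull_insert_pair_eq] at hσ
  have hdpos : 0 < dist v w := dist_pos.2 hvw
  have hXY : dist v w * vdet ![unitVec v w, xL - xK, midpoint ℝ v w - xK] =
      b * vdet ![xL - xK, w - v, z - v] := by
    have h1 : dist v w * vdet ![unitVec v w, xL - xK, midpoint ℝ v w - xK] =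
        vdet ![w - v, xL - xK, midpoint ℝ v w - xK] := by
      rw [← dist_smul_unitVec v w]; exact (vdet_cons_smul _ _ _).symm
    have h2 : midpoint ℝ v w - xK = Y + (center (SimplicialMesh.diaFace D) - xK) := by
      rw [← hYdef]; abel
    rw [h1, h2, hY]
    rw [vdet_three] at hplane ⊢
    rw [vdet_three]
    simp only [PiLp.sub_apply, PiLp.add_apply, PiLp.smul_apply, smul_eq_mul] at hplane ⊢
    linear_combination -hplane
  have hsame : vdet ![unitVec v w, xL - xK, midpoint ℝ v w - xK] =
      vdet ![unitVec v w, xL - xK, Y] := by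
    have h2 : midpoint ℝ v w - xK = Y + (center (SimplicialMesh.diaFace D) - xK) := by
      rw [← hYdef]; abel
    refine mul_left_cancel₀ hdpos.ne' ?_
    have h3 : ∀ y, dist v w * vdet ![unitVec v w, xL - xK, y] = vdet ![w - v, xL - xK, y] := by
      intro y
      rw [← dist_smul_unitVec v w]; exact (vdet_cons_smul _ _ _).symm
    rw [h3, h3, h2]
    rw [vdet_three] at hplane ⊢
    rw [vdet_three]
    simp only [PiLp.sub_apply, PiLp.add_apply] at hplane ⊢
    linear_combination -hplane
  have hξ : vdet ![ξ, xL - xK, Y] = inner ℝ (unitVec v w) ξ * vdet ![unitVec v w, xL - xK, Y] :=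
    vdet_cons_eq_inner_mul (norm_unitVec hvw) (fun i => by
      fin_cases i
      · exact hnX
      · change inner ℝ (unitVec v w) Y = 0
        rw [inner_unitVec, real_inner_comm, hmid, mul_zero]) ξ
  have habs : |vdet ![unitVec v w, xL - xK, midpoint ℝ v w - xK]| =
      (SignType.sign (vdet ![xL - xK, w - v, z - v]) : ℝ) *
        vdet ![unitVec v w, xL - xK, midpoint ℝ v w - xK] := by
    have h1 : vdet ![unitVec v w, xL - xK, midpoint ℝ v w - xK] =
        (dist v w)⁻¹ * b * vdet ![xL - xK, w - v, z - v] := by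
      rw [mul_assoc, ← hXY, inv_mul_cancel_left₀ hdpos.ne']
    rw [h1, abs_mul, abs_of_nonneg (by positivity)]
    linear_combination (-((dist v w)⁻¹ * b)) * sign_mul_self (vdet ![xL - xK, w - v, z - v])
  have hlin : vdet ![ξ, xL - xK, Y] = vdet ![ξ, xL - v, Y] - vdet ![ξ, xK - v, Y] := by
    simp only [vdet_three, PiLp.sub_apply]; ring
  have hσ' : faceMeasure (convexHull ℝ {xK, xL, midpoint ℝ v w}) =
    |vdet ![unitVec v w, xL - xK, midpoint ℝ v w - xK]| * volume.real (unitSimplex 2) := hσ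
  rw [hσ', habs, hsp, hsq, SignType.coe_neg, hsame]
  rw [hξ] at hlin
  linear_combination ((SignType.sign (vdet ![xL - xK, w - v, z - v]) : ℝ) *
    volume.real (unitSimplex 2)) * hlin

/-- The outward normals of a dual control volume of the interior, weighted by the measures of the
dual interfaces, sum up to zero. Every piece `σ*_S` is a difference of an expression in `x_K` and
the same expression in `x_L`, and inside each simplex these expressions cancel. -/
theorem sum_dualInterfaceMeasure_smul_unitVec (hd : d = 2 ∨ d = 3) (hΩ : IsOpen Ω) {v : Pt d}
    (hv : v ∈ Ω) :
    ∑ w ∈ T.dualNeighbours v, T.dualInterfaceMeasure v w • unitVec v w = 0 := by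
  refine ext_inner_right ℝ fun ξ => ?_
  rw [sum_inner, inner_zero_left]
  have e : ∀ w, inner ℝ (T.dualInterfaceMeasure v w • unitVec v w) ξ =
      ∑ D ∈ T.diamondsAt v w, SimplicialMesh.sigmaStarMeasure D v w * inner ℝ (unitVec v w) ξ := by
    intro w
    rw [real_inner_smul_left, SimplicialMesh.dualInterfaceMeasure, Finset.sum_mul]
  simp only [e]
  rcases hd with rfl | rfl
  · rw [T.sum_diamondsAt_eq_sum_primal (by norm_num) hΩ hv
      (fun D w => SimplicialMesh.sigmaStarMeasure D v w * inner ℝ (unitVec v w) ξ) _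
      fun D hD w hw hvD hvw => T.sigmaStarMeasure_mul_inner_two hΩ hv hD hvD hw hvw ξ
        fun K F w => rfl]
    refine Finset.sum_eq_zero fun K hK => ?_
    obtain ⟨hK, hvK⟩ := Finset.mem_filter.1 hK
    obtain ⟨a, b, hab, hKv⟩ := Finset.card_eq_two.1
      (show (K.erase v).card = 2 by rw [Finset.card_erase_of_mem hvK, (T.mem_primal.1 hK).2])
    have haK : a ∈ K := Finset.mem_of_mem_erase (show a ∈ K.erase v by rw [hKv]; simp)
    have hbK : b ∈ K := Finset.mem_of_mem_erase (show b ∈ K.erase v by rw [hKv]; simp)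
    have h1 : ∀ p ∈ K, K \ K.erase p = {p} := fun p hp => by
      rw [Finset.sdiff_erase hp, Finset.sdiff_self]; rfl
    have ea : ({a, b} : Finset (Pt 2)).erase a = {b} := by ext x; simp; grind
    have eb : ({a, b} : Finset (Pt 2)).erase b = {a} := by ext x; simp; grind
    rw [hKv, Finset.sum_pair hab, ea, eb, Finset.sum_singleton, Finset.sum_singleton,
      h1 a haK, h1 b hbK, Finset.sum_singleton, Finset.sum_singleton]
    have hs : vdet ![b - v, a - v] = -vdet ![a - v, b - v] := by rw [vdet_two, vdet_two]; ring
    -- The two faces of `K` at `v` have opposite orientation.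
    rw [hs, Left.sign_neg, SignType.coe_neg]
    ring
  · rw [T.sum_diamondsAt_eq_sum_primal (by norm_num) hΩ hv
      (fun D w => SimplicialMesh.sigmaStarMeasure D v w * inner ℝ (unitVec v w) ξ) _
      fun D hD w hw hvD hvw => T.sigmaStarMeasure_mul_inner_three hΩ hv hD hvD hw hvw ξ
        fun K F w => rfl]
    refine Finset.sum_eq_zero fun K hK => ?_
    obtain ⟨hK, hvK⟩ := Finset.mem_filter.1 hK
    obtain ⟨a, b, c, hab, hac, hbc, hKv⟩ := Finset.card_eq_three.1
      (show (K.erase v).card = 3 by rw [Finset.card_erase_of_mem hvK, (T.mem_primal.1 hK).2])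
    have hmem : ∀ x ∈ ({a, b, c} : Finset (Pt 3)), x ∈ K := fun x hx =>
      Finset.mem_of_mem_erase (show x ∈ K.erase v by rw [hKv]; exact hx)
    have h1 : ∀ p ∈ K, K \ K.erase p = {p} := fun p hp => by
      rw [Finset.sdiff_erase hp, Finset.sdiff_self]; rfl
    -- The contribution of the face opposite to `x` is the difference of one term for each of its edges
    -- at `v`; every edge belongs to two faces, and its terms cancel.
    have key : ∀ x y z : Pt 3, x ≠ y → x ≠ z → y ≠ z → ({a, b, c} : Finset (Pt 3)) = {x, y, z} →
        ∑ w ∈ ({a, b, c} : Finset (Pt 3)).erase x, volume.real (unitSimplex 2) *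
          (∑ p ∈ K \ K.erase x, ∑ z ∈ ((K.erase x).erase v).erase w,
            (SignType.sign (vdet ![p - v, w - v, z - v]) : ℝ)) *
              vdet ![ξ, center K - v, midpoint ℝ v w - center (K.erase x)] =
        volume.real (unitSimplex 2) * (SignType.sign (vdet ![x - v, y - v, z - v]) : ℝ) *
          (vdet ![ξ, center K - v, midpoint ℝ v y] - vdet ![ξ, center K - v, midpoint ℝ v z]) := by
      intro x y z hxy hxz hyz he
      have ex : ({x, y, z} : Finset (Pt 3)).erase x = {y, z} := by ext; simp; grind
      have ey : ({y, z} : Finset (Pt 3)).erase y = {z} := by ext; simp; grind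
      have ez : ({y, z} : Finset (Pt 3)).erase z = {y} := by ext; simp; grind
      have hs : vdet ![x - v, z - v, y - v] = -vdet ![x - v, y - v, z - v] := by
        rw [vdet_three, vdet_three]; ring
      have hlin : ∀ m, vdet ![ξ, center K - v, m - center (K.erase x)] =
          vdet ![ξ, center K - v, m] - vdet ![ξ, center K - v, center (K.erase x)] := by
        intro m; simp only [vdet_three, PiLp.sub_apply]; ring
      have exv : (K.erase x).erase v = {y, z} := by rw [Finset.erase_right_comm, hKv, he, ex]
      rw [h1 x (hmem x (by rw [he]; simp)), exv, he, ex,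
        Finset.sum_pair hyz, Finset.sum_singleton, Finset.sum_singleton, ey, ez,
        Finset.sum_singleton, Finset.sum_singleton, hs, Left.sign_neg, SignType.coe_neg,
        hlin, hlin]
      ring
    have hbca : vdet ![b - v, c - v, a - v] = vdet ![a - v, b - v, c - v] := by
      rw [vdet_three, vdet_three]; ring
    have hcab : vdet ![c - v, a - v, b - v] = vdet ![a - v, b - v, c - v] := by
      rw [vdet_three, vdet_three]; ring
    rw [hKv, Finset.sum_insert (by simp [hab, hac]), Finset.sum_pair hbc,
      key a b c hab hac hbc rfl, key b c a hbc hab.symm hac.symm (by ext; simp; tauto),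
      key c a b hac.symm hbc.symm hab (by ext; simp; tauto), hbca, hcab]
    ring

end DoubleMesh

/-! ### Monotone convection fluxes -/

/-- The entropy flux `Φ = ∫ f dA` belonging to the test function `A`: its jumps bound the
product of a monotone flux and the jump of `A` from below. -/
theorem exists_entropyFlux {d : ℕ} {A : ℝ → ℝ} (hA : Continuous A) (hAm : Monotone A)
    {f : ℝ → Pt d} (hf : Continuous f) : ∃ Φ : ℝ → Pt d, Φ 0 = 0 ∧
      ∀ (g : ℝ → ℝ → ℝ) (ν : Pt d), (∀ b, Monotone fun a => g a b) → (∀ a, Antitone fun b => g a b) →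
        (∀ a, g a a = inner ℝ (f a) ν) →
        ∀ a b, inner ℝ (Φ a - Φ b) ν ≤ g a b * (A a - A b) := by
  let S : StieltjesFunction ℝ := ⟨A, hAm, fun x => hA.continuousWithinAt⟩
  refine ⟨fun a => ∫ s in (0 : ℝ)..a, f s ∂S.measure, by simp, fun g ν hg1 hg2 hgc a b => ?_⟩
  have hsub : (∫ s in (0 : ℝ)..a, f s ∂S.measure) - ∫ s in (0 : ℝ)..b, f s ∂S.measure =
      ∫ s in b..a, f s ∂S.measure :=
    intervalIntegral.integral_interval_sub_left (hf.intervalIntegrable _ _)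
      (hf.intervalIntegrable _ _)
  have hin : ∀ x y : ℝ, inner ℝ (∫ s in x..y, f s ∂S.measure) ν =
      ∫ s in x..y, inner ℝ (f s) ν ∂S.measure := by
    intro x y
    have := (innerSL ℝ ν).intervalIntegral_comp_comm (μ := S.measure)
      (hf.intervalIntegrable x y)
    simp only [innerSL_apply_apply] at this
    rw [real_inner_comm, ← this]
    simp only [real_inner_comm]
  have hconst : ∀ x y c : ℝ, x ≤ y → ∫ _s in x..y, c ∂S.measure = c * (A y - A x) := by
    intro x y c hxy
    rw [intervalIntegral.integral_const', Ioc_eq_empty (not_lt.2 hxy), measureReal_empty, sub_zero,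
      Measure.real, S.measure_Ioc, ENNReal.toReal_ofReal (sub_nonneg.2 (hAm hxy)), smul_eq_mul, mul_comm]
  have hfi : Continuous fun s => inner ℝ (f s) ν := hf.inner continuous_const
  change inner ℝ ((∫ s in (0 : ℝ)..a, f s ∂S.measure) - ∫ s in (0 : ℝ)..b, f s ∂S.measure) ν ≤ _
  rw [hsub, hin]
  rcases le_total b a with hab | hab
  · rw [← hconst b a (g a b) hab]
    refine intervalIntegral.integral_mono_on hab (hfi.intervalIntegrable _ _)
      (continuous_const.intervalIntegrable _ _) fun s hs => ?_
    rw [← hgc]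
    exact (hg1 s hs.2).trans (hg2 a hs.1)
  · rw [intervalIntegral.integral_symm]
    have h : ∫ _s in a..b, g a b ∂S.measure ≤ ∫ s in a..b, inner ℝ (f s) ν ∂S.measure := by
      refine intervalIntegral.integral_mono_on hab (continuous_const.intervalIntegrable _ _)
        (hfi.intervalIntegrable _ _) fun s hs => ?_
      rw [← hgc]
      exact (hg1 b hs.1).trans (hg2 s hs.2)
    rw [hconst a b _ hab] at h
    linarith

/-- A monotone flux that vanishes on zero states does not increase the `ℓ¹` norm. -/
theorem sign_sub_sign_mul_nonneg {g : ℝ → ℝ → ℝ} (hg1 : ∀ b, Monotone fun a => g a b)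
    (hg2 : ∀ a, Antitone fun b => g a b) (h0 : g 0 0 = 0) (a b : ℝ) :
    0 ≤ ((SignType.sign a : ℝ) - SignType.sign b) * g a b := by
  have hpos : b ≤ 0 → 0 ≤ a → 0 ≤ g a b := fun hb ha => h0 ▸ (hg1 0 ha).trans (hg2 a hb)
  have hneg : 0 ≤ b → a ≤ 0 → g a b ≤ 0 := fun hb ha => h0 ▸ (hg1 b ha).trans (hg2 0 hb)
  rcases lt_trichotomy a 0 with ha | ha | ha <;> rcases lt_trichotomy b 0 with hb | hb | hb
  · simp [ha, hb]
  · have := hneg hb.ge ha.le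
    simp [ha, hb] at this ⊢; exact this
  · have := hneg hb.le ha.le
    simp [ha, hb]; linarith
  · have := hpos hb.le ha.ge
    simp [ha, hb] at this ⊢; exact this
  · simp [ha, hb]
  · have := hneg hb.le ha.le
    simp [ha, hb] at this ⊢; exact this
  · have := hpos hb.le ha.le
    simp [ha, hb]; linarith
  · have := hpos hb.le ha.le
    simp [ha, hb] at this ⊢; exact this
  · simp [ha, hb]

theorem sum_neighbours_swap {α : Type*} {V : Finset α} {nb : α → Finset α}
    (hsymm : ∀ a ∈ V, ∀ b ∈ nb a, b ∈ V ∧ a ∈ nb b) (h : α → α → ℝ) :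
    ∑ a ∈ V, ∑ b ∈ nb a, h a b = ∑ a ∈ V, ∑ b ∈ nb a, h b a := by
  refine Finset.sum_comm' fun a b => ?_
  constructor
  · rintro ⟨ha, hb⟩
    exact (hsymm a ha b hb).symm
  · rintro ⟨hb, ha⟩
    exact hsymm b ha a hb

/-- Discrete integration by parts for conservative fluxes. -/
theorem two_mul_sum_flux {α : Type*} {V : Finset α} {nb : α → Finset α}
    (hsymm : ∀ a ∈ V, ∀ b ∈ nb a, b ∈ V ∧ a ∈ nb b) {q : α → α → ℝ}
    (hq : ∀ a ∈ V, ∀ b ∈ nb a, q b a = -q a b) (s : α → ℝ) :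
    2 * ∑ a ∈ V, s a * ∑ b ∈ nb a, q a b = ∑ a ∈ V, ∑ b ∈ nb a, (s a - s b) * q a b := by
  have h := sum_neighbours_swap hsymm fun a b => s a * q a b
  have h1 : ∑ a ∈ V, s a * ∑ b ∈ nb a, q a b = ∑ a ∈ V, ∑ b ∈ nb a, s a * q a b :=
    Finset.sum_congr rfl fun a _ => Finset.mul_sum ..
  rw [h1, two_mul]
  nth_rewrite 2 [h]
  rw [← Finset.sum_add_distrib]
  refine Finset.sum_congr rfl fun a ha => ?_
  rw [← Finset.sum_add_distrib]
  refine Finset.sum_congr rfl fun b hb => ?_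
  rw [hq a ha b hb]; ring

/-- The properties of the convection term of a finite volume scheme on which the two a priori
estimates rest. Here `V` are the control volumes, `I` those of the interior, `nb` gives
the neighbours, `m` the measures of the interfaces, `ν` their normals and `g` the numerical fluxes.
The field `closed` says that the boundary of an interior control volume is closed. -/
structure IsConvection {α : Type*} {d : ℕ} (V I : Finset α) (nb : α → Finset α) (m : α → α → ℝ)
    (ν : α → α → Pt d) (f : ℝ → Pt d) (g : α → α → ℝ → ℝ → ℝ) : Prop where
  symm : ∀ a ∈ V, ∀ b ∈ nb a, b ∈ V ∧ a ∈ nb b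
  measure_comm : ∀ a b, m a b = m b a
  measure_nonneg : ∀ a b, 0 ≤ m a b
  normal_comm : ∀ a b, ν b a = -ν a b
  closed : ∀ a ∈ I, ∑ b ∈ nb a, m a b • ν a b = 0
  monotone_left : ∀ a ∈ V, ∀ b ∈ nb a, ∀ y, Monotone fun x => g a b x y
  antitone_right : ∀ a ∈ V, ∀ b ∈ nb a, ∀ x, Antitone fun y => g a b x y
  consistent : ∀ a ∈ V, ∀ b ∈ nb a, ∀ x, g a b x x = inner ℝ (f x) (ν a b)
  conservative : ∀ a ∈ V, ∀ b ∈ nb a, ∀ x y, g a b x y = -g b a y x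

namespace IsConvection

variable {α : Type*} {d : ℕ} {V I : Finset α} {nb : α → Finset α} {m : α → α → ℝ}
  {ν : α → α → Pt d} {f : ℝ → Pt d} {g : α → α → ℝ → ℝ → ℝ}

/-- The convection term does not increase the `ℓ¹` norm. -/
theorem test_sign_nonneg (h : IsConvection V I nb m ν f g) (hf0 : f 0 = 0) (u : α → ℝ) :
    0 ≤ ∑ a ∈ V, (SignType.sign (u a) : ℝ) * ∑ b ∈ nb a, m a b * g a b (u a) (u b) := by
  have h2 := two_mul_sum_flux h.symm (q := fun a b => m a b * g a b (u a) (u b))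
    (fun a ha b hb => by rw [h.conservative a ha b hb, h.measure_comm]; ring)
    (fun a => (SignType.sign (u a) : ℝ))
  have h3 : 0 ≤ ∑ a ∈ V, ∑ b ∈ nb a, ((SignType.sign (u a) : ℝ) - SignType.sign (u b)) *
      (m a b * g a b (u a) (u b)) := by
    refine Finset.sum_nonneg fun a ha => Finset.sum_nonneg fun b hb => ?_
    have := mul_nonneg (h.measure_nonneg a b) (sign_sub_sign_mul_nonneg
      (h.monotone_left a ha b hb) (h.antitone_right a ha b hb)
      (by rw [h.consistent a ha b hb, hf0, inner_zero_left]) (u a) (u b))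
    linarith
  linarith

/-- The convection term tested with a nondecreasing function of the solution: as the control
volumes are closed, the entropy fluxes of the values at their centres do not contribute. -/
theorem test_monotone_nonneg (h : IsConvection V I nb m ν f g) {A : ℝ → ℝ} (hA : Continuous A)
    (hAm : Monotone A) (hf : Continuous f) {u : α → ℝ} (hu : ∀ a ∈ V, a ∉ I → u a = 0) :
    0 ≤ ∑ a ∈ V, A (u a) * ∑ b ∈ nb a, m a b * g a b (u a) (u b) := by
  obtain ⟨Φ, hΦ0, hΦ⟩ := exists_entropyFlux hA hAm hf
  have h2 := two_mul_sum_flux h.symm (q := fun a b => m a b * g a b (u a) (u b))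
    (fun a ha b hb => by rw [h.conservative a ha b hb, h.measure_comm]; ring)
    (fun a => A (u a))
  have h3 : ∑ a ∈ V, ∑ b ∈ nb a, m a b * inner ℝ (Φ (u a) - Φ (u b)) (ν a b) ≤
      ∑ a ∈ V, ∑ b ∈ nb a, (A (u a) - A (u b)) * (m a b * g a b (u a) (u b)) := by
    refine Finset.sum_le_sum fun a ha => Finset.sum_le_sum fun b hb => ?_
    have := mul_le_mul_of_nonneg_left (hΦ (g a b) (ν a b) (h.monotone_left a ha b hb)
      (h.antitone_right a ha b hb) (h.consistent a ha b hb) (u a) (u b)) (h.measure_nonneg a b)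
    linarith
  have h4 : ∑ a ∈ V, ∑ b ∈ nb a, m a b * inner ℝ (Φ (u a)) (ν a b) = 0 := by
    refine Finset.sum_eq_zero fun a ha => ?_
    by_cases haI : a ∈ I
    · have : ∑ b ∈ nb a, m a b * inner ℝ (Φ (u a)) (ν a b) =
          inner ℝ (Φ (u a)) (∑ b ∈ nb a, m a b • ν a b) := by
        rw [inner_sum]
        exact Finset.sum_congr rfl fun b _ => (inner_smul_right _ _ _).symm
      rw [this, h.closed a haI, inner_zero_right]
    · simp [hu a ha haI, hΦ0]
  have h5 : ∑ a ∈ V, ∑ b ∈ nb a, m a b * inner ℝ (Φ (u a) - Φ (u b)) (ν a b) =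
      2 * ∑ a ∈ V, ∑ b ∈ nb a, m a b * inner ℝ (Φ (u a)) (ν a b) := by
    rw [two_mul]
    nth_rewrite 3 [sum_neighbours_swap h.symm]
    rw [← Finset.sum_add_distrib]
    refine Finset.sum_congr rfl fun a _ => ?_
    rw [← Finset.sum_add_distrib]
    refine Finset.sum_congr rfl fun b _ => ?_
    rw [h.measure_comm b a, h.normal_comm a b, inner_neg_right, inner_sub_left]
    ring
  rw [h5, h4] at h3
  linarith

end IsConvection

namespace DoubleMesh

variable {d : ℕ} {Ω : Set (Pt d)} (T : DoubleMesh Ω)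

theorem isConvection_primal (hd : 1 < d) (hΩ : IsOpen Ω) {f : ℝ → Pt d}
    {g : Finset (Pt d) → Finset (Pt d) → ℝ → ℝ → ℝ} (hg : T.toSimplicialMesh.IsPrimalFlux f g) :
    IsConvection T.primalBar T.primal T.neighbours SimplicialMesh.interfaceMeasure
      SimplicialMesh.normal f g where
  symm K hK L hL := ⟨T.mem_primalBar_of_neighbours hL, T.neighbours_symm hK hL⟩
  measure_comm K L := by
    rw [SimplicialMesh.interfaceMeasure, SimplicialMesh.interfaceMeasure, Finset.inter_comm]
  measure_nonneg K L := ENNReal.toReal_nonneg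
  normal_comm K L := unitVec_comm _ _
  closed K hK := T.sum_interfaceMeasure_smul_normal hd hΩ hK
  monotone_left := hg.monotone_left
  antitone_right := hg.antitone_right
  consistent := hg.consistent
  conservative := hg.conservative

theorem isConvection_dual (hd : d = 2 ∨ d = 3) (hΩ : IsOpen Ω) {f : ℝ → Pt d}
    {g : Pt d → Pt d → ℝ → ℝ → ℝ} (hg : T.toSimplicialMesh.IsDualFlux f g) :
    IsConvection T.vertices T.dual T.dualNeighbours T.dualInterfaceMeasure unitVec f g where
  symm v hv w hw := by
    obtain ⟨h1, h2, h3⟩ := Finset.mem_filter.1 hw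
    exact ⟨h1, Finset.mem_filter.2 ⟨hv, h2.symm, by rwa [Finset.pair_comm]⟩⟩
  measure_comm v w := by
    have : T.diamondsAt v w = T.diamondsAt w v := by
      ext D; simp only [SimplicialMesh.diamondsAt, Finset.mem_filter]; tauto
    rw [SimplicialMesh.dualInterfaceMeasure, SimplicialMesh.dualInterfaceMeasure, this]
    exact Finset.sum_congr rfl fun D _ => SimplicialMesh.sigmaStarMeasure_comm D v w
  measure_nonneg v w := Finset.sum_nonneg fun D _ => by
    rw [SimplicialMesh.sigmaStarMeasure]
    split_ifs <;> exact ENNReal.toReal_nonneg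
  normal_comm v w := unitVec_comm _ _
  closed v hv := T.sum_dualInterfaceMeasure_smul_unitVec hd hΩ (Finset.mem_filter.1 hv).2
  monotone_left := hg.monotone_left
  antitone_right := hg.antitone_right
  consistent := hg.consistent
  conservative := hg.conservative

end DoubleMesh

/-! ### One implicit time step -/

namespace SimplicialMesh

variable {d : ℕ} {Ω : Set (Pt d)} (T : SimplicialMesh Ω)

/-- The discrete function with the prescribed values at the interior control volumes, and the value
zero at all others. -/
def extendZero (x : T.primal ⊕ T.dual → ℝ) : DiscreteFunction d where
  onPrimal K := if h : K ∈ T.primal then x (.inl ⟨K, h⟩) else 0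
  onDual v := if h : v ∈ T.dual then x (.inr ⟨v, h⟩) else 0

theorem extendZero_onPrimal_coe (x : T.primal ⊕ T.dual → ℝ) (K : T.primal) :
    (T.extendZero x).onPrimal K = x (.inl K) := dif_pos K.2

theorem extendZero_onDual_coe (x : T.primal ⊕ T.dual → ℝ) (v : T.dual) :
    (T.extendZero x).onDual v = x (.inr v) := dif_pos v.2

theorem extendZero_onPrimal_of_notMem (x : T.primal ⊕ T.dual → ℝ) {K : Finset (Pt d)}
    (hK : K ∉ T.primal) : (T.extendZero x).onPrimal K = 0 := dif_neg hK

theorem extendZero_onDual_of_notMem (x : T.primal ⊕ T.dual → ℝ) {v : Pt d}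
    (hv : v ∉ T.dual) : (T.extendZero x).onDual v = 0 := dif_neg hv

theorem extendZero_comp {φ : ℝ → ℝ} (hφ : φ 0 = 0) (x : T.primal ⊕ T.dual → ℝ) :
    T.extendZero (fun i => φ (x i)) = (T.extendZero x).comp φ := by
  simp only [extendZero, DiscreteFunction.comp, DiscreteFunction.mk.injEq]
  constructor <;> funext y <;> split_ifs <;> simp [hφ]

theorem notMem_dual_of_dualBdry (hΩ : IsOpen Ω) {v : Pt d} (hv : v ∈ T.dualBdry) :
    v ∉ T.dual := fun h => by
  have h1 := (Finset.mem_filter.1 hv).2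
  rw [hΩ.frontier_eq] at h1
  exact h1.2 (Finset.mem_filter.1 h).2

/-- A sum over the unknowns as a sum over all control volumes, those of the boundary included. -/
theorem sum_mul_sumElim (y : T.primal ⊕ T.dual → ℝ) (P : Finset (Pt d) → ℝ) (Q : Pt d → ℝ) :
    ∑ i, y i * Sum.elim (fun K : T.primal => P K) (fun v : T.dual => Q v) i =
      ∑ K ∈ T.primalBar, (T.extendZero y).onPrimal K * P K +
        ∑ v ∈ T.vertices, (T.extendZero y).onDual v * Q v := by
  rw [Fintype.sum_sum_type]
  congr 1
  · have h : T.primal ⊆ T.primalBar := Finset.subset_union_left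
    rw [← Finset.sum_subset h fun K _ hK => by
      rw [T.extendZero_onPrimal_of_notMem y hK, zero_mul],
      ← Finset.sum_coe_sort T.primal fun K => (T.extendZero y).onPrimal K * P K]
    simp only [extendZero_onPrimal_coe, Sum.elim_inl]
  · have h : T.dual ⊆ T.vertices := Finset.filter_subset _ _
    rw [← Finset.sum_subset h fun v _ hv => by
      rw [T.extendZero_onDual_of_notMem y hv, zero_mul],
      ← Finset.sum_coe_sort T.dual fun v => (T.extendZero y).onDual v * Q v]
    simp only [extendZero_onDual_coe, Sum.elim_inr]

theorem continuous_extendZero_onPrimal (K : Finset (Pt d)) :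
    Continuous fun x => (T.extendZero x).onPrimal K := by
  by_cases h : K ∈ T.primal
  · simp only [extendZero, h, dite_true]; fun_prop
  · simp only [extendZero, h, dite_false]; fun_prop

theorem continuous_extendZero_onDual (v : Pt d) :
    Continuous fun x => (T.extendZero x).onDual v := by
  by_cases h : v ∈ T.dual
  · simp only [extendZero, h, dite_true]; fun_prop
  · simp only [extendZero, h, dite_false]; fun_prop

theorem continuous_discreteGradient_extendZero (D : Sym2 (Finset (Pt d))) :
    Continuous fun x => discreteGradient (T.extendZero x) D := by
  have h1 := T.continuous_extendZero_onPrimal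
  have h2 := T.continuous_extendZero_onDual
  unfold discreteGradient
  refine ((((h1 _).sub (h1 _)).div_const _).smul continuous_const).add
    (continuous_finsetSum _ fun e _ => ?_)
  have h3 : ∀ (a b : Pt d) (c : ℝ) (n : Pt d), Continuous fun x =>
      (((T.extendZero x).onDual a - (T.extendZero x).onDual b) / c) • n :=
    fun a b c n => (((h2 a).sub (h2 b)).div_const c).smul continuous_const
  exact (h3 _ _ _ _).const_smul (_ : ℝ)

/-- The total convective flux out of the control volumes; the dual ones are weighted by `d - 1`. -/
def convectionFlux (g : Finset (Pt d) → Finset (Pt d) → ℝ → ℝ → ℝ) (gDual : Pt d → Pt d → ℝ → ℝ → ℝ)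
    (x : T.primal ⊕ T.dual → ℝ) : T.primal ⊕ T.dual → ℝ :=
  let u := T.extendZero x
  Sum.elim
    (fun K : T.primal => ∑ L ∈ T.neighbours K,
      interfaceMeasure K L * g K L (u.onPrimal K) (u.onPrimal L))
    (fun v : T.dual => ((d : ℝ) - 1) * ∑ w ∈ T.dualNeighbours v,
      T.dualInterfaceMeasure v w * gDual v w (u.onDual v) (u.onDual w))

/-- The total diffusive flux out of the control volumes together with the penalization; the dual
control volumes are weighted by `d - 1`, as in discrete duality. -/
def diffusionFlux (k : Pt d → ℝ) (x : T.primal ⊕ T.dual → ℝ) : T.primal ⊕ T.dual → ℝ :=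
  let w := T.extendZero x
  let F := fun D => k (discreteGradient w D) • discreteGradient w D
  Sum.elim
    (fun K : T.primal => -(∑ L ∈ T.neighbours K, ∑ e ∈ edges ((K : Finset (Pt d)) ∩ L),
        sigmaMeasure s(↑K, L) (Quot.out e).1 (Quot.out e).2 * inner ℝ (F s(↑K, L)) (normal K L)) +
      ((d : ℝ) - 1) * T.size⁻¹ * ∑ v ∈ T.vertices, volume.real (cell (K : Finset (Pt d)) ∩ T.dualCell v) *
        (w.onPrimal K - w.onDual v))
    (fun v : T.dual => ((d : ℝ) - 1) * (-(∑ x ∈ T.dualNeighbours v, ∑ D ∈ T.diamondsAt v x,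
        sigmaStarMeasure D v x * inner ℝ (F D) (unitVec (v : Pt d) x)) +
      T.size⁻¹ * ∑ K ∈ T.primalBar, volume.real (cell K ∩ T.dualCell v) *
        (w.onDual v - w.onPrimal K)))

theorem continuous_convectionFlux {f : ℝ → Pt d} {g : Finset (Pt d) → Finset (Pt d) → ℝ → ℝ → ℝ}
    (hg : T.IsPrimalFlux f g) {gDual : Pt d → Pt d → ℝ → ℝ → ℝ} (hgDual : T.IsDualFlux f gDual) :
    Continuous (T.convectionFlux g gDual) := by
  have h1 := T.continuous_extendZero_onPrimal
  have h2 := T.continuous_extendZero_onDual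
  refine continuous_pi fun i => ?_
  rcases i with K | v
  · refine continuous_finsetSum _ fun L hL => continuous_const.mul ?_
    exact (hg.continuous K (Finset.mem_union_left _ K.2) L hL).comp ((h1 K).prodMk (h1 L))
  · refine continuous_const.mul (continuous_finsetSum _ fun w hw => continuous_const.mul ?_)
    exact (hgDual.continuous v (Finset.mem_filter.1 v.2).1 w hw).comp ((h2 v).prodMk (h2 w))

theorem continuous_diffusionFlux {k : Pt d → ℝ} (hk : IsDiffusionFlux k) :
    Continuous (T.diffusionFlux k) := by
  have h1 := T.continuous_extendZero_onPrimal
  have h2 := T.continuous_extendZero_onDual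
  have h3 : ∀ D, Continuous fun x => k (discreteGradient (T.extendZero x) D) •
      discreteGradient (T.extendZero x) D :=
    fun D => hk.continuous.comp (T.continuous_discreteGradient_extendZero D)
  refine continuous_pi fun i => ?_
  rcases i with K | v
  · refine (continuous_finsetSum _ fun L _ => continuous_finsetSum _ fun e _ =>
      continuous_const.mul ((h3 _).inner continuous_const)).neg.add
      (continuous_const.mul (continuous_finsetSum _ fun v _ => continuous_const.mul ?_))
    exact (h1 K).sub (h2 v)
  · refine continuous_const.mul ((continuous_finsetSum _ fun L _ => continuous_finsetSum _ fun e _ =>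
      continuous_const.mul ((h3 _).inner continuous_const)).neg.add
      (continuous_const.mul (continuous_finsetSum _ fun K _ => continuous_const.mul ?_)))
    exact (h2 v).sub (h1 K)

/-- The growth condition gives `k ξ ≥ 0` for `ξ ≠ 0`. -/
theorem diffusion_inner_nonneg {k : Pt d → ℝ} (hk : IsDiffusionFlux k) (ξ : Pt d) :
    0 ≤ inner ℝ (k ξ • ξ) ξ := by
  rcases eq_or_ne ξ 0 with rfl | h
  · simp
  · obtain ⟨p, -, C, hC, hkC⟩ := hk.growth
    rw [real_inner_smul_left]
    refine mul_nonneg (le_trans ?_ (hkC ξ h).1) real_inner_self_nonneg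
    positivity

/-- Coercivity of the diffusion: by discrete duality and since the penalization is a sum of
squares. -/
theorem test_diffusionFlux_nonneg (hd : d = 2 ∨ d = 3) {k : Pt d → ℝ} (hk : IsDiffusionFlux k)
    (x : T.primal ⊕ T.dual → ℝ) : 0 ≤ ∑ i, x i * T.diffusionFlux k x i := by
  have hd1 : (0 : ℝ) ≤ (d : ℝ) - 1 := by rcases hd with rfl | rfl <;> norm_num
  obtain ⟨c, hc, hdual⟩ := T.exists_discrete_duality hd
  simp only [diffusionFlux]
  set w := T.extendZero x with hw
  set F : Sym2 (Finset (Pt d)) → Pt d :=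
    fun D => k (discreteGradient w D) • discreteGradient w D with hF
  rw [T.sum_mul_sumElim x (fun K => -(∑ L ∈ T.neighbours K, ∑ e ∈ edges (K ∩ L),
        sigmaMeasure s(K, L) (Quot.out e).1 (Quot.out e).2 * inner ℝ (F s(K, L)) (normal K L)) +
      ((d : ℝ) - 1) * T.size⁻¹ * ∑ v ∈ T.vertices, volume.real (cell K ∩ T.dualCell v) *
        (w.onPrimal K - w.onDual v))
      (fun v => ((d : ℝ) - 1) * (-(∑ x ∈ T.dualNeighbours v, ∑ D ∈ T.diamondsAt v x,
        sigmaStarMeasure D v x * inner ℝ (F D) (unitVec (v : Pt d) x)) +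
      T.size⁻¹ * ∑ K ∈ T.primalBar, volume.real (cell K ∩ T.dualCell v) *
        (w.onDual v - w.onPrimal K))), ← hw]
  have hF0 : 0 ≤ ∑ D ∈ T.diamonds, c D * inner ℝ (F D) (discreteGradient w D) :=
    Finset.sum_nonneg fun D hD => mul_nonneg (hc D hD) (diffusion_inner_nonneg hk _)
  have hpen : 0 ≤ ((d : ℝ) - 1) * T.size⁻¹ * ∑ K ∈ T.primalBar, ∑ v ∈ T.vertices,
      volume.real (cell K ∩ T.dualCell v) * (w.onPrimal K - w.onDual v) ^ 2 := by
    have := T.size_nonneg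
    refine mul_nonneg (by positivity) (Finset.sum_nonneg fun K _ => Finset.sum_nonneg fun v _ => ?_)
    positivity
  have hsplit : ∑ K ∈ T.primalBar, ∑ v ∈ T.vertices,
      volume.real (cell K ∩ T.dualCell v) * (w.onPrimal K - w.onDual v) ^ 2 =
      ∑ K ∈ T.primalBar, w.onPrimal K * ∑ v ∈ T.vertices, volume.real (cell K ∩ T.dualCell v) *
        (w.onPrimal K - w.onDual v) +
      ∑ v ∈ T.vertices, w.onDual v * ∑ K ∈ T.primalBar, volume.real (cell K ∩ T.dualCell v) *
        (w.onDual v - w.onPrimal K) := by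
    simp only [Finset.mul_sum]
    rw [Finset.sum_comm (s := T.vertices), ← Finset.sum_add_distrib]
    refine Finset.sum_congr rfl fun K _ => ?_
    rw [← Finset.sum_add_distrib]
    exact Finset.sum_congr rfl fun v _ => by ring
  have h := hdual w F
  rw [hsplit] at hpen
  have e1 : ∀ (s : Finset (Finset (Pt d))) (a P Q : Finset (Pt d) → ℝ) (c : ℝ),
      ∑ K ∈ s, a K * (-P K + c * Q K) = -∑ K ∈ s, a K * P K + c * ∑ K ∈ s, a K * Q K := by
    intro s a P Q c
    rw [Finset.mul_sum, ← Finset.sum_neg_distrib, ← Finset.sum_add_distrib]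
    exact Finset.sum_congr rfl fun _ _ => by ring
  have e2 : ∀ (s : Finset (Pt d)) (a P Q : Pt d → ℝ) (b c : ℝ),
      ∑ v ∈ s, a v * (b * (-P v + c * Q v)) =
        -(b * ∑ v ∈ s, a v * P v) + b * c * ∑ v ∈ s, a v * Q v := by
    intro s a P Q b c
    simp only [Finset.mul_sum]
    rw [← Finset.sum_neg_distrib, ← Finset.sum_add_distrib]
    exact Finset.sum_congr rfl fun _ _ => by ring
  rw [e1, e2]
  linarith

end SimplicialMesh

namespace DoubleMesh

variable {d : ℕ} {Ω : Set (Pt d)} (T : DoubleMesh Ω)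

theorem test_convectionFlux_nonneg (hd : d = 2 ∨ d = 3) {u : T.primal ⊕ T.dual → ℝ} {φ : ℝ → ℝ}
    (hφ : φ 0 = 0) {g : Finset (Pt d) → Finset (Pt d) → ℝ → ℝ → ℝ} {gDual : Pt d → Pt d → ℝ → ℝ → ℝ}
    (hP : 0 ≤ ∑ K ∈ T.primalBar, φ ((T.extendZero u).onPrimal K) * ∑ L ∈ T.neighbours K,
      SimplicialMesh.interfaceMeasure K L *
        g K L ((T.extendZero u).onPrimal K) ((T.extendZero u).onPrimal L))
    (hD : 0 ≤ ∑ v ∈ T.vertices, φ ((T.extendZero u).onDual v) * ∑ w ∈ T.dualNeighbours v,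
      T.dualInterfaceMeasure v w *
        gDual v w ((T.extendZero u).onDual v) ((T.extendZero u).onDual w)) :
    0 ≤ ∑ i, φ (u i) * T.convectionFlux g gDual u i := by
  have hd1 : (0 : ℝ) ≤ (d : ℝ) - 1 := by rcases hd with rfl | rfl <;> norm_num
  have h := T.sum_mul_sumElim (fun i => φ (u i))
    (fun K => ∑ L ∈ T.neighbours K, SimplicialMesh.interfaceMeasure K L *
      g K L ((T.extendZero u).onPrimal K) ((T.extendZero u).onPrimal L))
    (fun v => ((d : ℝ) - 1) * ∑ w ∈ T.dualNeighbours v, T.dualInterfaceMeasure v w *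
      gDual v w ((T.extendZero u).onDual v) ((T.extendZero u).onDual w))
  rw [T.extendZero_comp hφ] at h
  refine h.symm ▸ add_nonneg hP ?_
  have := mul_nonneg hd1 hD
  rw [Finset.mul_sum] at this
  refine this.trans_eq (Finset.sum_congr rfl fun v _ => ?_)
  change _ = φ ((T.extendZero u).onDual v) * _
  ring

/-- The equation of the scheme from the balance on a control volume of measure `m`. -/
theorem scheme_of_balance {m Δt : ℝ} (hm : 0 < m) (hΔt : 0 < Δt) {x old q D p r : ℝ}
    (h : m / Δt * x + q + (-D + p) = m / Δt * (old + Δt * r)) :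
    (x - old) / Δt + m⁻¹ * q - m⁻¹ * D + m⁻¹ * p = r := by
  field_simp
  field_simp at h
  linarith

/-- One step of the scheme has a solution, whatever the old values and the source terms. -/
theorem exists_step (hd : d = 2 ∨ d = 3) (hΩ : IsOpen Ω) (hΩb : Bornology.IsBounded Ω)
    {A : ℝ → ℝ} (hA : Continuous A) (hAm : Monotone A) (hA0 : A 0 = 0)
    {f : ℝ → Pt d} (hf : Continuous f) (hf0 : f 0 = 0) {k : Pt d → ℝ} (hk : IsDiffusionFlux k)
    {g : Finset (Pt d) → Finset (Pt d) → ℝ → ℝ → ℝ} (hg : T.toSimplicialMesh.IsPrimalFlux f g)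
    {gDual : Pt d → Pt d → ℝ → ℝ → ℝ} (hgDual : T.toSimplicialMesh.IsDualFlux f gDual)
    {Δt : ℝ} (hΔt : 0 < Δt) (old : DiscreteFunction d) (rP : Finset (Pt d) → ℝ) (rD : Pt d → ℝ) :
    ∃ u : DiscreteFunction d,
      (∀ K ∈ T.primal, (u.onPrimal K - old.onPrimal K) / Δt + T.convPrimal g u K
        - T.divPrimal (fun D => k (SimplicialMesh.discreteGradient (u.comp A) D) •
            SimplicialMesh.discreteGradient (u.comp A) D) K
        + T.penalPrimal (u.comp A) K = rP K) ∧
      (∀ v ∈ T.dual, (u.onDual v - old.onDual v) / Δt + T.convDual gDual u v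
        - T.divDual (fun D => k (SimplicialMesh.discreteGradient (u.comp A) D) •
            SimplicialMesh.discreteGradient (u.comp A) D) v
        + T.penalDual (u.comp A) v = rD v) ∧
      (∀ K ∉ T.primal, u.onPrimal K = 0) ∧ ∀ v ∉ T.dual, u.onDual v = 0 := by
  have hd1 : (0 : ℝ) < (d : ℝ) - 1 := by rcases hd with rfl | rfl <;> norm_num
  have hd2 : 1 < d := by omega
  have hmP : ∀ K : T.primal, 0 < volume.real (SimplicialMesh.cell (K : Finset (Pt d))) :=
    fun K => T.volume_cell_pos K.2
  have hmD : ∀ v : T.dual, 0 < volume.real (T.dualCell v) :=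
    fun v => T.volume_dualCell_pos hΩ hΩb (Finset.mem_filter.1 v.2).2
  have hcP := T.isConvection_primal hd2 hΩ hg
  have hcD := T.isConvection_dual hd hΩ hgDual
  obtain ⟨x, hx⟩ := exists_solution_of_test_nonneg hA hAm hA0
    (ι := T.primal ⊕ T.dual)
    (Sum.elim (fun K : T.primal => volume.real (SimplicialMesh.cell (K : Finset (Pt d))) / Δt)
      fun v : T.dual => ((d : ℝ) - 1) * (volume.real (T.dualCell v) / Δt))
    (Sum.elim (fun K : T.primal => old.onPrimal K + Δt * rP K)
      fun v : T.dual => old.onDual v + Δt * rD v)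
    (by
      rintro (K | v)
      · exact div_pos (hmP K) hΔt
      · exact mul_pos hd1 (div_pos (hmD v) hΔt))
    (T.continuous_convectionFlux hg hgDual) (T.continuous_diffusionFlux hk)
    (T.test_diffusionFlux_nonneg hd hk)
    (fun u => T.test_convectionFlux_nonneg hd hA0
      (hcP.test_monotone_nonneg hA hAm hf fun K _ hK => T.extendZero_onPrimal_of_notMem u hK)
      (hcD.test_monotone_nonneg hA hAm hf fun v _ hv => T.extendZero_onDual_of_notMem u hv))
    (fun u => T.test_convectionFlux_nonneg hd (φ := fun s => (SignType.sign s : ℝ)) (by simp)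
      (hcP.test_sign_nonneg hf0 _) (hcD.test_sign_nonneg hf0 _))
  refine ⟨T.extendZero x, fun K hK => ?_, fun v hv => ?_,
    fun K hK => T.extendZero_onPrimal_of_notMem x hK, fun v hv => T.extendZero_onDual_of_notMem x hv⟩
  · have h := hx (.inl ⟨K, hK⟩)
    have hm := hmP ⟨K, hK⟩
    simp only [SimplicialMesh.convectionFlux, SimplicialMesh.diffusionFlux, Sum.elim_inl,
      T.extendZero_comp hA0] at h
    simp only [SimplicialMesh.convPrimal, SimplicialMesh.divPrimal, SimplicialMesh.penalPrimal]
    rw [← T.extendZero_onPrimal_coe x ⟨K, hK⟩] at h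
    rw [← scheme_of_balance hm hΔt h]
    ring
  · have h := hx (.inr ⟨v, hv⟩)
    have hm := hmD ⟨v, hv⟩
    simp only [SimplicialMesh.convectionFlux, SimplicialMesh.diffusionFlux, Sum.elim_inr,
      T.extendZero_comp hA0] at h
    simp only [SimplicialMesh.convDual, SimplicialMesh.divDual, SimplicialMesh.penalDual]
    rw [← T.extendZero_onDual_coe x ⟨v, hv⟩] at h
    rw [mul_assoc, mul_assoc, ← mul_add, ← mul_add] at h
    rw [← scheme_of_balance hm hΔt (mul_left_cancel₀ hd1.ne' h)]
    ring

end DoubleMesh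

end DDFV

end

theorem proposition6p2 {d : ℕ} (hd : d = 2 ∨ d = 3)
    (Ω : Set (DDFV.Pt d)) (hΩ : IsOpen Ω) (hΩb : Bornology.IsBounded Ω)
    (Tf : ℝ) (hTf : 0 < Tf)
    (A : ℝ → ℝ) (hA : Continuous A) (hAm : Monotone A) (hA0 : A 0 = 0)
    (f : ℝ → DDFV.Pt d) (hf : Continuous f) (hf0 : f 0 = 0)
    (k : DDFV.Pt d → ℝ) (hk : DDFV.IsDiffusionFlux k)
    (u₀ : DDFV.Pt d → ℝ)
    (hu₀ : MeasureTheory.MemLp u₀ ⊤ (MeasureTheory.volume.restrict Ω))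
    (S : ℝ → DDFV.Pt d → ℝ) (hS : DDFV.IsSource Ω Tf S)
    (T : DDFV.DoubleMesh Ω)
    (g : Finset (DDFV.Pt d) → Finset (DDFV.Pt d) → ℝ → ℝ → ℝ)
    (hg : T.toSimplicialMesh.IsPrimalFlux f g)
    (gDual : DDFV.Pt d → DDFV.Pt d → ℝ → ℝ → ℝ)
    (hgDual : T.toSimplicialMesh.IsDualFlux f gDual)
    (Δt : ℝ) (hΔt : 0 < Δt) :
    ∃ u : ℕ → DDFV.DiscreteFunction d,
      DDFV.IsDiscreteSolution T.toSimplicialMesh Tf Δt A k g gDual u₀ S u := by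
  choose step hstepP hstepD hbdryP hbdryD using fun (n : ℕ) (old : DDFV.DiscreteFunction d) =>
    T.exists_step hd hΩ hΩb hA hAm hA0 hf hf0 hk hg hgDual hΔt old
      (fun K => ⨍ x in DDFV.SimplicialMesh.cell K, DDFV.timeMean S Δt n x)
      (fun v => ⨍ x in T.dualCell v, DDFV.timeMean S Δt n x)
  let u : ℕ → DDFV.DiscreteFunction d := fun n => Nat.rec
    ⟨fun K => ⨍ x in DDFV.SimplicialMesh.cell K, u₀ x, fun v => ⨍ x in T.dualCell v, u₀ x⟩
    (fun m old => step (m + 1) old) n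
  have hu : ∀ n ∈ Finset.Icc 1 ⌊Tf / Δt⌋₊, u n = step n (u (n - 1)) := by
    intro n hn
    obtain ⟨m, rfl⟩ := Nat.exists_eq_add_of_le' (Finset.mem_Icc.1 hn).1
    rfl
  refine ⟨u, fun n hn K hK => ?_, fun n hn v hv => ?_, fun n hn K hK => ?_, fun n hn v hv => ?_,
    fun K _ => rfl, fun v _ => rfl⟩
  · rw [hu n hn]
    exact hstepP n _ K hK
  · rw [hu n hn]
    exact hstepD n _ v hv
  · rw [hu n hn]
    exact hbdryP n _ K fun h => T.notMem_primalBdry_of_primal h hK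
  · rw [hu n hn]
    exact hbdryD n _ v (T.notMem_dual_of_dualBdry hΩ hv)
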